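/- Let $\mathfrak n$ be a real Lie algebra with basis $Z_1,\dots,Z_r,Y_1,\dots,Y_d,X_1,\dots,X_d$ ($d\ge 1$) such that $[\mathfrak n,\mathfrak n]\subseteq\mathfrak z(\mathfrak n)$, the centre $\mathfrak z(\mathfrak n)$ is spanned by the $Z_k$, $[Y_i,Y_j]=[X_i,X_j]=0$ for all $i,j$, and some linear functional $f$ on $\mathfrak n$ satisfies $\{u\in\mathfrak n: f([u,v])=0\ \forall v\in\mathfrak n\}=\mathfrak z(\mathfrak n)$. Let $N=\exp\mathfrak n$ be the connected, simply connected Lie group of $\mathfrak n$, with coordinates $\exp(\sum z_kZ_k)\exp(\sum y_jY_j)\exp(\sum x_iX_i)$ and Lebesgue measure in $(z,y,x)$ as Haar measure, and let $L$ be its left regular representation on $L^2(N)$. Identify $\lambda\in\mathbb R^r$ with the functional on $\mathfrak n$ that satisfies $\lambda(Z_k)=\lambda_k$ and vanishes on all $Y_j,X_i$. Let $B(\lambda)=-(\lambda([X_i,Y_j]))_{1\le i,j\le d}$, let $V(\lambda)$ be the $2d\times 2d$ matrix of the form $(u,v)\mapsto\lambda([u,v])$ on the vectors $Y_1,\dots,Y_d,X_1,\dots,X_d$,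 let $\Sigma=\{\lambda\in\mathbb R^r:\det V(\lambda)\ne0\}$ and $d\mu(\lambda)=|\det B(\lambda)|\,d\lambda$. Let $\pi_\lambda$ act on $L^2(\mathbb R^d)$ by $$\pi_\lambda\big(\exp(\textstyle\sum z_kZ_k)\exp(\sum y_jY_j)\exp(\sum x_iX_i)\big)F(t)=e^{2\pi i\langle\lambda,z\rangle}e^{2\pi i\langle t,B(\lambda)y\rangle}F(t-x).$$ The Plancherel transform $\mathcal P$ is the extension to $L^2(N)$, with values in the $\mu$-square-integrable measurable fields of Hilbert–Schmidt operators on $L^2(\mathbb R^d)$, of the Fourier transform $f\mapsto\big(\int_N f(g)\pi_\lambda(g)\,dg\big)_\lambda$ on $L^1(N)\cap L^2(N)$. Let $a\in(0,\infty)^r$, $q,b\in(0,\infty)^d$, let $$\Gamma_{a,q,b}=\Big\{\exp\big(\textstyle\sum_k\tfrac{m_k}{a_k}Z_k\big)\exp\big(\sum_j\tfrac{k_j}{q_j}Y_j\big)\exp\big(\sum_i\tfrac{n_i}{b_i}X_i\big): m\in\mathbb Z^r,\ k,n\in\mathbb Z^d\Big\},$$ and let $\mathbf I\subseteq\{\lambda\in\Sigma:0\le\lambda_k\le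 a_k\text{ for all }k\}$. Let $\mathcal K$ be a closed left-invariant subspace of $L^2(N)$, and suppose that there is $\phi\in\mathcal K$ such that $\{L(\gamma)\phi\}_{\gamma\in\Gamma_{a,q,b}}$ is a Parseval frame of $\mathcal K$. Then there is a measurable field $(P_\lambda)$ of orthogonal projections of $L^2(\mathbb R^d)$ such that $$\mathcal K=\mathcal P^{-1}\Big(\int_\Sigma^{\oplus}L^2(\mathbb R^d)\otimes P_\lambda(L^2(\mathbb R^d))\,d\mu(\lambda)\Big)=\{f\in L^2(N):\mathcal P f(\lambda)P_\lambda=\mathcal P f(\lambda)\text{ for }\mu\text{-a.e. }\lambda\},$$ and for every such field, with the multiplicity function $m(\lambda)=\operatorname{rank}P_\lambda\in\{0,1,2,\dots,\infty\}$, one has for almost every $\lambda\in\mathbf I$ $$|\det B(\lambda)|\,m(\lambda)\le\prod_{i=1}^d b_iq_i .$$ -/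

import Mathlib

open MeasureTheory Filter Topology
open scoped ENNReal Matrix

noncomputable section

namespace NilpotentFrames

/-! ### The class of Lie algebras -/

section LieAlgebraPart

variable {r d : ℕ} {𝔫 : Type*} [LieRing 𝔫] [LieAlgebra ℝ 𝔫]

/-- The basis vectors `Z₁, …, Z_r` (with `r = n - 2d`). -/
def vecZ (β : Module.Basis (Fin r ⊕ Fin d ⊕ Fin d) ℝ 𝔫) (k : Fin r) : 𝔫 := β (Sum.inl k)

/-- The basis vectors `Y₁, …, Y_d`. -/
def vecY (β : Module.Basis (Fin r ⊕ Fin d ⊕ Fin d) ℝ 𝔫) (j : Fin d) : 𝔫 :=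
  β (Sum.inr (Sum.inl j))

/-- The basis vectors `X₁, …, X_d`. -/
def vecX (β : Module.Basis (Fin r ⊕ Fin d ⊕ Fin d) ℝ 𝔫) (i : Fin d) : 𝔫 :=
  β (Sum.inr (Sum.inr i))

/-- `𝔫 = 𝔷 ⊕ span Y ⊕ span X` is two-step nilpotent with centre `𝔷 = span Z`, both
`𝔭 = 𝔷 ⊕ span Y` and `𝔪 = span X` are commutative, and some (equivalently, the generic) linear
functional has the centre as its radical, that is, the simply connected group is
square-integrable modulo its centre. -/
structure IsAdmissibleBasis (β : Module.Basis (Fin r ⊕ Fin d ⊕ Fin d) ℝ 𝔫) : Prop where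
  center_eq : (LieAlgebra.center ℝ 𝔫).toSubmodule = Submodule.span ℝ (Set.range (vecZ β))
  lie_mem_center : ∀ u v : 𝔫, ⁅u, v⁆ ∈ LieAlgebra.center ℝ 𝔫
  lie_Y_Y : ∀ i j, ⁅vecY β i, vecY β j⁆ = 0
  lie_X_X : ∀ i j, ⁅vecX β i, vecX β j⁆ = 0
  exists_radical_eq_center :
    ∃ f : Module.Dual ℝ 𝔫, ∀ u : 𝔫, (∀ v, f ⁅u, v⁆ = 0) → u ∈ LieAlgebra.center ℝ 𝔫

/-- The linear functional on `𝔫` with coordinates `l` in the dual basis of `Z₁, …, Z_r`, vanishing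
on all `Y_j` and `X_i`; this identifies `ℝ^r` with `𝔷*`. -/
def functional (β : Module.Basis (Fin r ⊕ Fin d ⊕ Fin d) ℝ 𝔫) (l : Fin r → ℝ) :
    Module.Dual ℝ 𝔫 :=
  β.constr ℝ (Sum.elim l 0)

/-- The skew-symmetric matrix `V(l)` of `(u, v) ↦ l[u, v]` on the non-central basis vectors. -/
def matV (β : Module.Basis (Fin r ⊕ Fin d ⊕ Fin d) ℝ 𝔫) (l : Fin r → ℝ) :
    Matrix (Fin d ⊕ Fin d) (Fin d ⊕ Fin d) ℝ :=
  Matrix.of fun s t => functional β l ⁅β (Sum.inr s), β (Sum.inr t)⁆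

/-- The matrix `B(l) = -(l[X_i, Y_j])_{i,j}`. -/
def matB (β : Module.Basis (Fin r ⊕ Fin d ⊕ Fin d) ℝ 𝔫) (l : Fin r → ℝ) :
    Matrix (Fin d) (Fin d) ℝ :=
  Matrix.of fun i j => -functional β l ⁅vecX β i, vecY β j⁆

/-- The cross-section `Σ ⊆ 𝔷* = ℝ^r` of the generic coadjoint orbits. -/
def crossSection (β : Module.Basis (Fin r ⊕ Fin d ⊕ Fin d) ℝ 𝔫) : Set (Fin r → ℝ) :=
  {l | (matV β l).det ≠ 0}

/-- The Plancherel measure `|det B(l)| dl`. -/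
def plancherelMeasure (β : Module.Basis (Fin r ⊕ Fin d ⊕ Fin d) ℝ 𝔫) : Measure (Fin r → ℝ) :=
  (volume : Measure (Fin r → ℝ)).withDensity fun l => ENNReal.ofReal |(matB β l).det|

/-- The `Z`-coordinates of `[∑ xᵢ Xᵢ, ∑ yⱼ Yⱼ]`. -/
def bracketXY (β : Module.Basis (Fin r ⊕ Fin d ⊕ Fin d) ℝ 𝔫) (x y : Fin d → ℝ) : Fin r → ℝ :=
  fun k => ∑ i, ∑ j, x i * y j * β.repr ⁅vecX β i, vecY β j⁆ (Sum.inl k)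

/-! ### The group -/

/-- The simply connected group `N = exp 𝔫` in the coordinates `(z, y, x) ↔ exp z · exp y · exp x`,
with `z ∈ span Z`, `y ∈ span Y`, `x ∈ span X`. -/
def NilGroup (_β : Module.Basis (Fin r ⊕ Fin d ⊕ Fin d) ℝ 𝔫) : Type :=
  (Fin r → ℝ) × (Fin d → ℝ) × (Fin d → ℝ)

variable {β : Module.Basis (Fin r ⊕ Fin d ⊕ Fin d) ℝ 𝔫}

/-- `N` carries Lebesgue measure in these coordinates, which is a Haar measure. -/
instance : MeasureSpace (NilGroup β) :=
  inferInstanceAs (MeasureSpace ((Fin r → ℝ) × (Fin d → ℝ) × (Fin d → ℝ)))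

/-- The central coordinates of a group element. -/
def NilGroup.z (g : NilGroup β) : Fin r → ℝ := g.1

/-- The `Y`-coordinates of a group element. -/
def NilGroup.y (g : NilGroup β) : Fin d → ℝ := g.2.1

/-- The `X`-coordinates of a group element. -/
def NilGroup.x (g : NilGroup β) : Fin d → ℝ := g.2.2

/-- The group element `exp z · exp y · exp x`. -/
def NilGroup.mk (z : Fin r → ℝ) (y x : Fin d → ℝ) : NilGroup β := (z, y, x)

theorem NilGroup.ext' {g h : NilGroup β} (hz : g.z = h.z) (hy : g.y = h.y) (hx : g.x = h.x) :
    g = h :=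
  Prod.ext hz (Prod.ext hy hx)

instance : Mul (NilGroup β) :=
  ⟨fun g h => NilGroup.mk (g.z + h.z + bracketXY β g.x h.y) (g.y + h.y) (g.x + h.x)⟩

instance : One (NilGroup β) := ⟨NilGroup.mk 0 0 0⟩

instance : Inv (NilGroup β) :=
  ⟨fun g => NilGroup.mk (-g.z + bracketXY β g.x g.y) (-g.y) (-g.x)⟩

theorem NilGroup.mul_def (g h : NilGroup β) :
    g * h = NilGroup.mk (g.z + h.z + bracketXY β g.x h.y) (g.y + h.y) (g.x + h.x) := rfl

theorem NilGroup.one_def : (1 : NilGroup β) = NilGroup.mk 0 0 0 := rfl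

theorem NilGroup.inv_def (g : NilGroup β) :
    g⁻¹ = NilGroup.mk (-g.z + bracketXY β g.x g.y) (-g.y) (-g.x) := rfl

theorem bracketXY_add_left (x x' y : Fin d → ℝ) :
    bracketXY β (x + x') y = bracketXY β x y + bracketXY β x' y := by
  funext k
  simp [bracketXY, add_mul, Finset.sum_add_distrib]

theorem bracketXY_add_right (x y y' : Fin d → ℝ) :
    bracketXY β x (y + y') = bracketXY β x y + bracketXY β x y' := by
  funext k
  simp [bracketXY, mul_add, add_mul, Finset.sum_add_distrib]

theorem bracketXY_neg_left (x y : Fin d → ℝ) :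
    bracketXY β (-x) y = -bracketXY β x y := by
  funext k
  simp [bracketXY]

instance : Group (NilGroup β) :=
  Group.ofLeftAxioms
    (fun g h k => NilGroup.ext'
      (by
        change g.z + h.z + bracketXY β g.x h.y + k.z + bracketXY β (g.x + h.x) k.y =
          g.z + (h.z + k.z + bracketXY β h.x k.y) + bracketXY β g.x (h.y + k.y)
        rw [bracketXY_add_left, bracketXY_add_right]
        abel)
      (add_assoc _ _ _) (add_assoc _ _ _))
    (fun g => NilGroup.ext'
      (by
        change 0 + g.z + bracketXY β 0 g.y = g.z
        funext k
        simp [bracketXY])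
      (zero_add _) (zero_add _))
    (fun g => NilGroup.ext'
      (by
        change -g.z + bracketXY β g.x g.y + g.z + bracketXY β (-g.x) g.y = 0
        rw [bracketXY_neg_left]
        abel)
      (neg_add_cancel g.y) (neg_add_cancel g.x))

/-- The exponential map: `exp(z + y + x) = exp(z + ½[x, y]) · exp y · exp x`. -/
def nilExp (β : Module.Basis (Fin r ⊕ Fin d ⊕ Fin d) ℝ 𝔫) (u : 𝔫) : NilGroup β :=
  NilGroup.mk
    ((fun k => β.repr u (Sum.inl k)) +
      (1 / 2 : ℝ) • bracketXY β (fun i => β.repr u (Sum.inr (Sum.inr i)))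
        (fun j => β.repr u (Sum.inr (Sum.inl j))))
    (fun j => β.repr u (Sum.inr (Sum.inl j)))
    (fun i => β.repr u (Sum.inr (Sum.inr i)))

/-- Left translation is measure preserving, so Lebesgue measure is a left Haar measure. -/
theorem measurePreserving_mul_left (g : NilGroup β) :
    MeasurePreserving (fun h : NilGroup β => g * h) volume volume := by
  have hB : Measurable fun w : (Fin d → ℝ) × (Fin d → ℝ) => bracketXY β g.x w.1 := by
    unfold bracketXY
    fun_prop
  -- first with the coordinates in the order `((y, x), z)`
  have h0 : MeasurePreserving (fun w : (Fin d → ℝ) × (Fin d → ℝ) => (g.y + w.1, g.x + w.2))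
      (volume.prod volume) (volume.prod volume) :=
    (measurePreserving_add_left volume g.y).prod (measurePreserving_add_left volume g.x)
  have hm : Measurable (Function.uncurry
      fun (w : (Fin d → ℝ) × (Fin d → ℝ)) (z : Fin r → ℝ) => (g.z + bracketXY β g.x w.1) + z) :=
    (measurable_const.add (hB.comp measurable_fst)).add measurable_snd
  have h1 := h0.skew_product (μc := (volume : Measure (Fin r → ℝ)))
    (μd := (volume : Measure (Fin r → ℝ))) hm
    (ae_of_all _ fun w => (measurePreserving_add_left volume _).map_eq)
  have h2 := Measure.measurePreserving_swap.comp (h1.comp Measure.measurePreserving_swap)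
  have h3 : (fun h : NilGroup β => g * h) =
      fun h => (g.z + bracketXY β g.x h.y + h.z, g.y + h.y, g.x + h.x) := by
    funext h
    refine NilGroup.ext' ?_ rfl rfl
    change g.z + h.z + bracketXY β g.x h.y = (g.z + bracketXY β g.x h.y) + h.z
    abel
  rw [h3]
  exact h2

/-- The Hilbert space `L²(N)`. -/
abbrev L2N (β : Module.Basis (Fin r ⊕ Fin d ⊕ Fin d) ℝ 𝔫) : Type :=
  Lp ℂ 2 (volume : Measure (NilGroup β))

/-- The left regular representation, `(L(g) f)(h) = f(g⁻¹ h)`. -/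
def leftRegular (g : NilGroup β) (f : L2N β) : L2N β :=
  Lp.compMeasurePreserving (fun h : NilGroup β => g⁻¹ * h) (measurePreserving_mul_left g⁻¹) f

/-- The quasi-lattice `Γ_{a,q,b}`. -/
def quasiLattice (β : Module.Basis (Fin r ⊕ Fin d ⊕ Fin d) ℝ 𝔫) (a : Fin r → ℝ)
    (q b : Fin d → ℝ) : Set (NilGroup β) :=
  {γ | ∃ (m : Fin r → ℤ) (k n : Fin d → ℤ),
    γ = nilExp β (∑ j, ((m j : ℝ) / a j) • vecZ β j) *
        nilExp β (∑ j, ((k j : ℝ) / q j) • vecY β j) *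
        nilExp β (∑ j, ((n j : ℝ) / b j) • vecX β j)}

/-! ### Irreducible representations and the Plancherel transform -/

/-- The Hilbert space `L²(ℝ^d)`. -/
abbrev L2R (d : ℕ) : Type := Lp ℂ 2 (volume : Measure (Fin d → ℝ))

/-- The function `t ↦ exp(2πi l(z)) exp(2πi ⟨t, B(l) y⟩) F(t - x)`, where `g = exp z exp y exp x`. -/
def repFun (l : Fin r → ℝ) (g : NilGroup β) (F : (Fin d → ℝ) → ℂ) (t : Fin d → ℝ) : ℂ :=
  Complex.exp (2 * Real.pi * Complex.I * ((l ⬝ᵥ g.z + t ⬝ᵥ (matB β l *ᵥ g.y) : ℝ) : ℂ)) *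
    F (t - g.x)

theorem memLp_repFun (l : Fin r → ℝ) (g : NilGroup β) (F : L2R d) :
    MemLp (repFun l g F) 2 (volume : Measure (Fin d → ℝ)) := by
  have hF : MemLp (fun t => (F : (Fin d → ℝ) → ℂ) (t - g.x)) 2 volume :=
    (Lp.memLp F).comp_measurePreserving (measurePreserving_sub_right volume g.x)
  refine hF.of_le ?_ (ae_of_all _ fun t => ?_)
  · refine AEStronglyMeasurable.mul (Continuous.aestronglyMeasurable ?_) hF.aestronglyMeasurable
    unfold dotProduct
    fun_prop
  · have h : (2 * Real.pi * Complex.I * ((l ⬝ᵥ g.z + t ⬝ᵥ (matB β l *ᵥ g.y) : ℝ) : ℂ)) =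
        ((2 * Real.pi * (l ⬝ᵥ g.z + t ⬝ᵥ (matB β l *ᵥ g.y)) : ℝ) : ℂ) * Complex.I := by
      push_cast
      ring
    rw [repFun, h, norm_mul, Complex.norm_exp_ofReal_mul_I, one_mul]

/-- The irreducible representation `π_l`, realized on `L²(ℝ^d)`. -/
def rep (l : Fin r → ℝ) (g : NilGroup β) (F : L2R d) : L2R d :=
  (memLp_repFun l g F).toLp (repFun l g F)

/-- `T = ∫_N f(g) π_l(g) dg` (as a strong integral): `T` is the group Fourier transform of `f ∈ L¹`
at `l`. -/
def IsFourierTransformAt (f : NilGroup β → ℂ) (l : Fin r → ℝ) (T : L2R d →L[ℂ] L2R d) : Prop :=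
  ∀ u : L2R d, T u = ∫ g : NilGroup β, f g • rep l g u

/-- The square of the Hilbert–Schmidt norm of an operator on `L²(ℝ^d)`. -/
def hsNormSq (T : L2R d →L[ℂ] L2R d) : ℝ≥0∞ :=
  ∑' i, ‖T ((exists_hilbertBasis ℂ (L2R d)).choose_spec.choose i)‖ₑ ^ 2

/-- A (weakly) measurable field of operators on `L²(ℝ^d)`. -/
def IsMeasurableField (T : (Fin r → ℝ) → L2R d →L[ℂ] L2R d) : Prop :=
  ∀ u v : L2R d, Measurable fun l => inner ℂ u (T l v)

/-- The field `T` is the Plancherel transform of `f ∈ L²(N)`. The transform is the extension of the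
Fourier transform from `L¹ ∩ L²` by continuity: `T` is the limit, in the square-integrable
Hilbert–Schmidt fields, of the Fourier transforms of functions in `L¹ ∩ L²` tending to `f`. -/
def IsPlancherelTransform (f : L2N β) (T : (Fin r → ℝ) → L2R d →L[ℂ] L2R d) : Prop :=
  IsMeasurableField T ∧
  ∃ (f' : ℕ → L2N β) (S : ℕ → (Fin r → ℝ) → L2R d →L[ℂ] L2R d),
    (∀ k, Integrable (f' k) volume) ∧
    Tendsto f' atTop (𝓝 f) ∧
    (∀ k l, IsFourierTransformAt (f' k) l (S k l)) ∧
    Tendsto (fun k => ∫⁻ l, hsNormSq (S k l - T l) ∂(plancherelMeasure β)) atTop (𝓝 0)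

/-- `P` is a measurable field of orthogonal projections of `L²(ℝ^d)` such that `K` is the inverse
image under the Plancherel transform of `∫^⊕ L²(ℝ^d) ⊗ P_l(L²(ℝ^d)) dμ(l)`. In terms of
Hilbert–Schmidt operators, `L²(ℝ^d) ⊗ P_l(L²(ℝ^d))` consists of the `T` with `T P_l = T`. -/
structure IsProjectionField (K : Submodule ℂ (L2N β))
    (P : (Fin r → ℝ) → L2R d →L[ℂ] L2R d) : Prop where
  isStarProjection : ∀ l, IsStarProjection (P l)
  measurable : IsMeasurableField P
  mem_iff : ∀ f : L2N β, f ∈ K ↔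
    ∃ T, IsPlancherelTransform f T ∧ ∀ᵐ l ∂(plancherelMeasure β), T l ∘L P l = T l

/-- The multiplicity function `m(l) = rank P_l ∈ ℕ ∪ {∞}`. -/
def multiplicity (P : (Fin r → ℝ) → L2R d →L[ℂ] L2R d) (l : Fin r → ℝ) : ℕ∞ :=
  Cardinal.toENat (LinearMap.rank (P l : L2R d →ₗ[ℂ] L2R d))

end LieAlgebraPart

/-- The family `v` is a Parseval frame of the subspace `K`. -/
def IsParsevalFrame {H : Type*} [NormedAddCommGroup H] [InnerProductSpace ℂ H] {ι : Type*}
    (K : Submodule ℂ H) (v : ι → H) : Prop :=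
  (∀ i, v i ∈ K) ∧ ∀ f ∈ K, HasSum (fun i => ‖inner ℂ f (v i)‖ ^ 2) (‖f‖ ^ 2)

end NilpotentFrames

end

set_option linter.unusedSectionVars false

noncomputable section

namespace NilpotentFrames

/-! ### The Fourier transform on `L¹ ∩ L²` -/

section FourierE

open FourierTransform SchwartzMap

variable {E : Type*} [NormedAddCommGroup E] [InnerProductSpace ℝ E] [FiniteDimensional ℝ E]
  [MeasurableSpace E] [BorelSpace E]

/-! Everything is computed with kernels. Let `F` be the Fourier transform of `L²(ℝ^d)`. For
integrable `f`, the operator `π_l(f) ∘ F` has the kernel k_f(l, t, σ) = ∫ f(g) exp 2πi(l·z + t·B(l)y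
+ (x - t)·σ) dg. Up to the factor exp(-2πi t·σ) this is the Euclidean Fourier transform of `f` at
(-l, -B(l)ᵀt, -σ), and the Jacobian of (l, t) ↦ (-l, -B(l)ᵀt) is the Plancherel density |det B(l)|.
Hence f ↦ k_f is unitary (`kernelTransform`). It gives the Plancherel transform
(`isPlancherelTransform_planOp`, `IsPlancherelTransform.ae_eq`), and left translation acts on
kernels through the variables (l, t) only.

Existence of the projections. Let P_l project onto the orthogonal complement of the kernel of the
operator T_l = 𝓟φ(l). The space V attached to (P_l) is closed, invariant and contains φ. A vector of
K orthogonal to K ∩ V is orthogonal to the frame, so it vanishes and K ⊆ V. If f in V is orthogonal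
to K, then all coefficients ⟨L(g)φ, f⟩ vanish. By Fourier uniqueness in (z, y), almost every row of
the kernel of f, conjugated and carried over by `F`, lies in ker T_l. Since 𝓟f(l) P_l = 𝓟f(l), this
forces f = 0 (`eq_zero_of_inner_leftRegular_eq_zero`).

The bound. Let A = ∏ a_k, Q = ∏ q_i, b = ∏ b_i. (1) Apply the frame identity to φ cut off to l in E,
with E inside the central box, and keep only the central lattice points. Fourier series on the box
give A ∫_E h² ≤ ∫_E h for h = |det B| ‖T_l‖²_HS, so A h ≤ 1 almost everywhere on the box
(`ae_hsNormSq_planOp_le`). (2) Apply it to fields of rank one u ↦ ⟪P_l v, u⟫ 1_E(l, ·). For fixed n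
the sum over (m, k) is a Fourier series on the orbits, and the sum over n unfolds a cell of volume
1/b to ℝ^d. The result is b⁻¹ ‖P_l v‖² = A Q ‖T_l P_l v‖² (`ae_enorm_projection_sq_eq`). Summing (2)
over a Hilbert basis gives b⁻¹ ‖P_l‖²_HS = A Q ‖T_l‖²_HS. With (1) this yields |det B| ‖P_l‖²_HS ≤ b
Q, and the rank of a projection is at most its squared Hilbert–Schmidt norm. -/

theorem integral_fourier_smul_schwartz {f : E → ℂ} (hf : Integrable f) (g : 𝓢(E, ℂ)) :
    ∫ ξ, g ξ • 𝓕 f ξ = ∫ x, (𝓕 g : 𝓢(E, ℂ)) x • f x := by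
  have h := VectorFourier.integral_fourierIntegral_smul_eq_flip (L := innerₗ E) (μ := volume)
    (ν := volume) Real.continuous_fourierChar continuous_inner hf g.integrable
  rw [flip_innerₗ] at h
  calc ∫ ξ, g ξ • 𝓕 f ξ = ∫ ξ, 𝓕 f ξ • g ξ := by simp only [smul_eq_mul, mul_comm]
    _ = ∫ x, f x • 𝓕 (g : E → ℂ) x := h
    _ = _ := by simp only [smul_eq_mul, mul_comm, SchwartzMap.fourier_coe]

theorem continuous_fourier_of_integrable {f : E → ℂ} (hf : Integrable f) :
    Continuous (𝓕 f) :=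
  VectorFourier.fourierIntegral_continuous Real.continuous_fourierChar
    (L := innerₗ E) continuous_inner hf

/-- The `L²` Fourier transform of an integrable function is given by the Fourier integral. -/
theorem fourier_coeFn_ae_eq (f : Lp ℂ 2 (volume : Measure E)) (hf : Integrable f) :
    ((𝓕 f : Lp ℂ 2 (volume : Measure E)) : E → ℂ) =ᵐ[volume] 𝓕 (f : E → ℂ) := by
  refine ae_eq_of_integral_contDiff_smul_eq
    ((Lp.memLp _).locallyIntegrable one_le_two)
    (continuous_fourier_of_integrable hf).locallyIntegrable fun g hg hgc => ?_
  have hg₁ : HasCompactSupport (Complex.ofRealCLM ∘ g) := hgc.comp_left rfl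
  have hg₂ : ContDiff ℝ (↑(⊤ : ℕ∞)) (Complex.ofRealCLM ∘ g) := by fun_prop
  set G : 𝓢(E, ℂ) := hg₁.toSchwartzMap hg₂ with hG
  have hGg : ∀ x, G x = (g x : ℂ) := fun x => rfl
  -- Both sides are compared as tempered distributions: the `L²` transform is dual to the transform
  -- of test functions, and so is the Fourier integral by Fubini.
  have h1 := DFunLike.congr_fun (Lp.fourier_toTemperedDistribution_eq f) G
  rw [TemperedDistribution.fourier_apply, Lp.toTemperedDistribution_apply,
    Lp.toTemperedDistribution_apply] at h1
  have h2 := integral_fourier_smul_schwartz hf G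
  simp only [hGg, smul_eq_mul] at h1 h2 ⊢
  simp only [Complex.real_smul]
  rw [h2, ← h1]

/-- An integrable function with vanishing Fourier transform is zero. -/
theorem ae_eq_zero_of_fourier_eq_zero {f : E → ℂ} (hf : Integrable f)
    (h : ∀ ξ, 𝓕 f ξ = 0) : f =ᵐ[volume] 0 := by
  refine ae_eq_zero_of_integral_contDiff_smul_eq_zero hf.locallyIntegrable fun g hg hgc => ?_
  have hg₁ : HasCompactSupport (Complex.ofRealCLM ∘ g) := hgc.comp_left rfl
  have hg₂ : ContDiff ℝ (↑(⊤ : ℕ∞)) (Complex.ofRealCLM ∘ g) := by fun_prop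
  set G : 𝓢(E, ℂ) := hg₁.toSchwartzMap hg₂ with hG
  have hGg : ∀ x, G x = (g x : ℂ) := fun x => rfl
  -- Every test function is the Fourier transform of a Schwartz function, so pairing with `𝓕⁻ G`
  -- recovers the integral of `f` against `g`.
  have h2 := integral_fourier_smul_schwartz hf (𝓕⁻ G)
  rw [fourier_fourierInv_eq] at h2
  simp only [h, mul_zero, integral_zero, hGg, smul_eq_mul] at h2
  simp only [Complex.real_smul]
  exact h2.symm

end FourierE

/-! ### Auxiliary isometries of `L²` spaces -/

section Isometries

variable {X Y : Type*} [MeasurableSpace X] [MeasurableSpace Y] {μ : Measure X} {ν : Measure Y}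

/-- Composition with a measure preserving map that has an almost everywhere inverse. -/
def compEquiv (e : X → Y) (he : MeasurePreserving e μ ν) (e' : Y → X)
    (he' : MeasurePreserving e' ν μ) (h : ∀ᵐ x ∂μ, e' (e x) = x) :
    Lp ℂ 2 ν ≃ₗᵢ[ℂ] Lp ℂ 2 μ :=
  LinearIsometryEquiv.ofSurjective (Lp.compMeasurePreservingₗᵢ ℂ e he) fun k => by
    refine ⟨Lp.compMeasurePreserving e' he' k, ?_⟩
    change Lp.compMeasurePreserving e he (Lp.compMeasurePreserving e' he' k) = k
    refine Lp.ext ?_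
    have h1 := Lp.coeFn_compMeasurePreserving (Lp.compMeasurePreserving e' he' k) he
    have h2 := he.quasiMeasurePreserving.ae (Lp.coeFn_compMeasurePreserving k he')
    filter_upwards [h1, h2, h] with x h1 h2 h
    rw [h1, Function.comp_apply, h2, Function.comp_apply, h]

theorem compEquiv_coeFn (e : X → Y) (he : MeasurePreserving e μ ν) (e' : Y → X)
    (he' : MeasurePreserving e' ν μ) (h : ∀ᵐ x ∂μ, e' (e x) = x) (f : Lp ℂ 2 ν) :
    (compEquiv e he e' he' h f : X → ℂ) =ᵐ[μ] fun x => f (e x) :=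
  Lp.coeFn_compMeasurePreserving f he

theorem memLp_unimodular_mul {w : X → ℂ} (hw : Measurable w) (hn : ∀ x, ‖w x‖ = 1) {f : X → ℂ}
    {p : ℝ≥0∞} (hf : MemLp f p μ) : MemLp (fun x => w x * f x) p μ :=
  hf.of_le (hw.aestronglyMeasurable.mul hf.aestronglyMeasurable)
    (ae_of_all _ fun x => by rw [norm_mul, hn, one_mul])

/-- Multiplication by a unimodular function as an isometry of `L²`. -/
def unimodularMul (w : X → ℂ) (hw : Measurable w) (hn : ∀ x, ‖w x‖ = 1) :
    Lp ℂ 2 μ →ₗᵢ[ℂ] Lp ℂ 2 μ where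
  toFun f := (memLp_unimodular_mul hw hn (Lp.memLp f)).toLp _
  map_add' f g := by
    refine Lp.ext ?_
    filter_upwards [(memLp_unimodular_mul hw hn (Lp.memLp (f + g))).coeFn_toLp,
      (memLp_unimodular_mul hw hn (Lp.memLp f)).coeFn_toLp,
      (memLp_unimodular_mul hw hn (Lp.memLp g)).coeFn_toLp, Lp.coeFn_add f g,
      Lp.coeFn_add ((memLp_unimodular_mul hw hn (Lp.memLp f)).toLp _)
        ((memLp_unimodular_mul hw hn (Lp.memLp g)).toLp _)] with x h1 h2 h3 h4 h5
    rw [h1, h5, Pi.add_apply, h2, h3, h4, Pi.add_apply, mul_add]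
  map_smul' c f := by
    refine Lp.ext ?_
    filter_upwards [(memLp_unimodular_mul hw hn (Lp.memLp (c • f))).coeFn_toLp,
      (memLp_unimodular_mul hw hn (Lp.memLp f)).coeFn_toLp, Lp.coeFn_smul c f,
      Lp.coeFn_smul c ((memLp_unimodular_mul hw hn (Lp.memLp f)).toLp _)] with x h1 h2 h4 h5
    rw [h1, RingHom.id_apply, h5, Pi.smul_apply, h2, h4, Pi.smul_apply, smul_eq_mul, smul_eq_mul]
    ring
  norm_map' f := by
    change ‖(memLp_unimodular_mul hw hn (Lp.memLp f)).toLp _‖ = ‖f‖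
    rw [Lp.norm_toLp, Lp.norm_def]
    congr 1
    exact eLpNorm_congr_norm_ae (ae_of_all _ fun x => by rw [norm_mul, hn, one_mul])

theorem unimodularMul_coeFn (w : X → ℂ) (hw : Measurable w) (hn : ∀ x, ‖w x‖ = 1)
    (f : Lp ℂ 2 μ) : (unimodularMul w hw hn f : X → ℂ) =ᵐ[μ] fun x => w x * f x :=
  (memLp_unimodular_mul hw hn (Lp.memLp f)).coeFn_toLp

/-- Multiplication by a unimodular function as an isometric automorphism of `L²`. -/
def unimodularEquiv (w : X → ℂ) (hw : Measurable w) (hn : ∀ x, ‖w x‖ = 1) :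
    Lp ℂ 2 μ ≃ₗᵢ[ℂ] Lp ℂ 2 μ :=
  LinearIsometryEquiv.ofSurjective (unimodularMul w hw hn) fun f => by
    have hw' : Measurable fun x => (w x)⁻¹ := hw.inv
    have hn' : ∀ x, ‖(w x)⁻¹‖ = 1 := fun x => by rw [norm_inv, hn, inv_one]
    refine ⟨unimodularMul _ hw' hn' f, Lp.ext ?_⟩
    filter_upwards [unimodularMul_coeFn w hw hn (unimodularMul _ hw' hn' f),
      unimodularMul_coeFn _ hw' hn' f] with x h1 h2
    rw [h1, h2, mul_inv_cancel_left₀]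
    intro h0
    simpa [h0] using hn x

theorem unimodularEquiv_coeFn (w : X → ℂ) (hw : Measurable w) (hn : ∀ x, ‖w x‖ = 1)
    (f : Lp ℂ 2 μ) : (unimodularEquiv w hw hn f : X → ℂ) =ᵐ[μ] fun x => w x * f x :=
  unimodularMul_coeFn w hw hn f

/-- Integrable elements are dense in `L²`. -/
theorem dense_integrable_Lp : Dense {f : Lp ℂ 2 μ | Integrable f μ} := by
  intro f
  refine Metric.mem_closure_iff.2 fun ε hε => ?_
  obtain ⟨g, hg1, hg2⟩ := (Lp.memLp f).exists_simpleFunc_eLpNorm_sub_lt ENNReal.ofNat_ne_top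
    (ε := ENNReal.ofReal ε) (by simpa using hε)
  refine ⟨hg2.toLp g, ?_, ?_⟩
  · have : Integrable g μ := (SimpleFunc.memLp_iff_integrable two_ne_zero (by simp)).1 hg2
    exact this.congr hg2.coeFn_toLp.symm
  · rw [Lp.dist_def]
    refine (ENNReal.toReal_lt_of_lt_ofReal (lt_of_le_of_lt (le_of_eq ?_) hg1))
    refine eLpNorm_congr_ae ?_
    filter_upwards [hg2.coeFn_toLp] with x h1
    simp [h1]

end Isometries

/-! ### Fourier transform transported along a measure preserving equivalence -/

section FourierX

open FourierTransform

variable {X : Type*} [MeasureSpace X]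
  {E : Type*} [NormedAddCommGroup E] [InnerProductSpace ℝ E] [FiniteDimensional ℝ E]
  [MeasurableSpace E] [BorelSpace E]

/-- The `L²` Fourier transform, transported along a measure preserving equivalence. -/
def fourierX (e : X ≃ᵐ E) (he : MeasurePreserving e) :
    Lp ℂ 2 (volume : Measure X) ≃ₗᵢ[ℂ] Lp ℂ 2 (volume : Measure X) :=
  (compEquiv e.symm he.symm e he (ae_of_all _ e.apply_symm_apply)).trans
    ((Lp.fourierTransformₗᵢ E ℂ).trans
      (compEquiv e he e.symm he.symm (ae_of_all _ e.symm_apply_apply)))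

theorem fourierX_coeFn (e : X ≃ᵐ E) (he : MeasurePreserving e)
    (f : Lp ℂ 2 (volume : Measure X)) (hf : Integrable f) :
    (fourierX e he f : X → ℂ) =ᵐ[volume]
      fun ξ => ∫ x, Complex.exp (-2 * Real.pi * Complex.I * (inner ℝ (e x) (e ξ) : ℝ)) * f x := by
  set f' := compEquiv e.symm he.symm e he (ae_of_all _ e.apply_symm_apply) f with hf'
  have h0 : (f' : E → ℂ) =ᵐ[volume] fun x => f (e.symm x) := compEquiv_coeFn _ _ _ _ _ _
  have hi : Integrable f' := (he.symm.integrable_comp_of_integrable hf).congr h0.symm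
  have h1 := he.quasiMeasurePreserving.ae (fourier_coeFn_ae_eq f' hi)
  have h2 := compEquiv_coeFn e he e.symm he.symm (ae_of_all _ e.symm_apply_apply)
    (Lp.fourierTransformₗᵢ E ℂ f')
  filter_upwards [h1, h2] with ξ h1 h2
  refine h2.trans (h1.trans ?_)
  rw [Real.fourier_eq', ← he.integral_comp e.measurableEmbedding]
  refine integral_congr_ae ?_
  filter_upwards [he.quasiMeasurePreserving.ae h0] with x hx
  rw [hx, smul_eq_mul, e.symm_apply_apply]
  congr 2
  push_cast
  ring

theorem ae_eq_zero_of_integral_exp_eq_zero (e : X ≃ᵐ E) (he : MeasurePreserving e)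
    {f : X → ℂ} (hf : Integrable f)
    (h : ∀ ξ, ∫ x, Complex.exp (-2 * Real.pi * Complex.I * (inner ℝ (e x) (e ξ) : ℝ)) * f x = 0) :
    f =ᵐ[volume] 0 := by
  have hi : Integrable (fun x => f (e.symm x)) := he.symm.integrable_comp_of_integrable hf
  have h1 : (fun x => f (e.symm x)) =ᵐ[volume] 0 := by
    refine ae_eq_zero_of_fourier_eq_zero hi fun ξ => ?_
    rw [Real.fourier_eq', ← he.integral_comp e.measurableEmbedding, ← h (e.symm ξ)]
    congr with x
    rw [smul_eq_mul, e.symm_apply_apply, e.apply_symm_apply]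
    congr 2
    push_cast
    ring
  filter_upwards [he.quasiMeasurePreserving.ae h1] with x hx
  simpa using hx

end FourierX

/-! ### Measurability of Hilbert space valued maps -/

section Measurability

instance : Fact ((2 : ℝ≥0∞) ≠ ∞) := ⟨ENNReal.ofNat_ne_top⟩

/-- Distinct orthonormal vectors are at distance √2, so points of a dense sequence chosen within 1/2
of each of them are different. -/
theorem countable_of_orthonormal {H ι : Type*} [NormedAddCommGroup H] [InnerProductSpace ℂ H]
    [SecondCountableTopology H] {v : ι → H} (hv : Orthonormal ℂ v) : Countable ι := by
  have h : ∀ i, ∃ n, ‖v i - TopologicalSpace.denseSeq H n‖ < 1 / 2 := fun i => by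
    obtain ⟨n, hn⟩ := Metric.mem_closure_range_iff.1
      ((TopologicalSpace.denseRange_denseSeq H) (v i)) (1 / 2) (by norm_num)
    exact ⟨n, by rwa [dist_eq_norm] at hn⟩
  choose f hf using h
  refine Function.Injective.countable (f := f) fun i j hij => ?_
  by_contra hne
  have h1 : ‖v i - v j‖ < 1 := by
    have h2 := hf j
    rw [← hij] at h2
    calc ‖v i - v j‖ = ‖(v i - TopologicalSpace.denseSeq H (f i)) -
          (v j - TopologicalSpace.denseSeq H (f i))‖ := by congr 1; abel
      _ ≤ _ := norm_sub_le _ _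
      _ < 1 := by linarith [hf i]
  have h2 : ‖v i - v j‖ ^ 2 = 2 := by
    rw [@norm_sub_sq ℂ, hv.2 hne, hv.1, hv.1]
    norm_num
  nlinarith [norm_nonneg (v i - v j)]

variable {X : Type*} [MeasurableSpace X]

/-- Weakly measurable maps into a separable Hilbert space are strongly measurable. -/
theorem stronglyMeasurable_of_inner {H : Type*} [NormedAddCommGroup H] [InnerProductSpace ℂ H]
    [CompleteSpace H] [SecondCountableTopology H] {F : X → H}
    (hF : ∀ u, Measurable fun x => inner ℂ u (F x)) : StronglyMeasurable F := by
  obtain ⟨w, b, -⟩ := exists_hilbertBasis ℂ H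
  have : Countable w := countable_of_orthonormal b.orthonormal
  refine stronglyMeasurable_of_tendsto (atTop : Filter (Finset w))
    (f := fun s x => ∑ i ∈ s, inner ℂ (b i) (F x) • b i) (fun s => ?_) ?_
  · exact Finset.stronglyMeasurable_fun_sum _ fun i _ =>
      ((hF (b i)).stronglyMeasurable).smul_const (b i)
  · refine tendsto_pi_nhds.2 fun x => ?_
    have := b.hasSum_repr (F x)
    simp only [b.repr_apply_apply] at this
    exact this

variable {Y : Type*} [MeasurableSpace Y] {ν : Measure Y}

/-- A measurable family of elements of `L²(Y)` has a jointly measurable representative. -/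
theorem exists_measurable_joint_representative [SecondCountableTopology (Lp ℂ 2 ν)]
    {F : X → Lp ℂ 2 ν} (hF : StronglyMeasurable F) :
    ∃ g : X × Y → ℂ, Measurable g ∧ ∀ x, (F x : Y → ℂ) =ᵐ[ν] fun y => g (x, y) := by
  classical
  set D := TopologicalSpace.denseSeq (Lp ℂ 2 ν) with hD
  -- With approximation error below (1/4)(1/2)^n, any two approximants of index at least `M` differ
  -- by less than (1/2)^M. This summable rate gives convergence almost everywhere along the whole
  -- sequence, so no subsequence depending on `x` is needed.
  have hex : ∀ (n : ℕ) (x : X), ∃ k, ‖F x - D k‖ < (1 / 4) * (1 / 2) ^ n := fun n x => by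
    obtain ⟨k, hk⟩ := Metric.mem_closure_range_iff.1
      ((TopologicalSpace.denseRange_denseSeq (Lp ℂ 2 ν)) (F x)) ((1 / 4) * (1 / 2) ^ n)
        (by positivity)
    exact ⟨k, by rwa [dist_eq_norm] at hk⟩
  -- Taking the first admissible index makes the choice measurable in `x`.
  set N : ℕ → X → ℕ := fun n x => Nat.find (hex n x) with hN
  have hNm : ∀ n, Measurable (N n) := fun n => measurable_find (hex n) fun k =>
    measurableSet_lt (hF.sub stronglyMeasurable_const).norm.measurable measurable_const
  have hNs : ∀ n x, ‖F x - D (N n x)‖ < (1 / 4) * (1 / 2) ^ n := fun n x => Nat.find_spec (hex n x)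
  set G : ℕ → X × Y → ℂ := fun n p => D (N n p.1) p.2 with hG
  have hGm : ∀ n, StronglyMeasurable (G n) := fun n => by
    have h1 : Measurable fun q : ℕ × Y => (D q.1 : Y → ℂ) q.2 :=
      measurable_from_prod_countable_right fun k => (Lp.stronglyMeasurable (D k)).measurable
    exact (h1.comp (((hNm n).comp measurable_fst).prodMk measurable_snd)).stronglyMeasurable
  refine ⟨fun p => atTop.limUnder fun n => G n p, (StronglyMeasurable.limUnder hGm).measurable,
    fun x => ?_⟩
  set f : ℕ → Y → ℂ := fun n => D (N n x) with hf
  have hfm : ∀ n, AEStronglyMeasurable (f n) ν := fun n => Lp.aestronglyMeasurable _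
  have hB : ∑' n : ℕ, ENNReal.ofReal ((1 / 2) ^ n) ≠ ∞ := by
    rw [← ENNReal.ofReal_tsum_of_nonneg (fun n => by positivity) summable_geometric_two]
    exact ENNReal.ofReal_ne_top
  have hpow : ∀ M n : ℕ, M ≤ n → ((1 : ℝ) / 2) ^ n ≤ (1 / 2) ^ M := fun M n h =>
    pow_le_pow_of_le_one (by norm_num) (by norm_num) h
  have hc : ∀ M n m : ℕ, M ≤ n → M ≤ m →
      eLpNorm (f n - f m) 2 ν < ENNReal.ofReal ((1 / 2) ^ M) := fun M n m hn hm => by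
    have h1 : eLpNorm (f n - f m) 2 ν = ‖D (N n x) - D (N m x)‖ₑ := by
      rw [Lp.enorm_def]
      exact eLpNorm_congr_ae (Lp.coeFn_sub _ _).symm
    rw [h1, ← ofReal_norm, ENNReal.ofReal_lt_ofReal_iff (by positivity)]
    calc ‖D (N n x) - D (N m x)‖ = ‖(F x - D (N m x)) - (F x - D (N n x))‖ := by congr 1; abel
      _ ≤ ‖F x - D (N m x)‖ + ‖F x - D (N n x)‖ := norm_sub_le _ _
      _ < _ := by
        have := hNs m x
        have := hNs n x
        have := hpow M n hn
        have := hpow M m hm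
        have : (0 : ℝ) < (1 / 2) ^ M := by positivity
        linarith
  have hlim := Lp.ae_tendsto_of_cauchy_eLpNorm hfm one_le_two hB hc
  have hto : Tendsto (fun n => eLpNorm (f n - (F x : Y → ℂ)) 2 ν) atTop (𝓝 0) := by
    have h1 : ∀ n, eLpNorm (f n - (F x : Y → ℂ)) 2 ν = ‖D (N n x) - F x‖ₑ := fun n => by
      rw [Lp.enorm_def]
      exact eLpNorm_congr_ae (Lp.coeFn_sub _ _).symm
    simp only [h1]
    have h2 : Tendsto (fun n : ℕ => ENNReal.ofReal ((1 / 4) * (1 / 2) ^ n)) atTop (𝓝 0) := by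
      have := (tendsto_pow_atTop_nhds_zero_of_lt_one (r := (1 : ℝ) / 2) (by norm_num)
        (by norm_num)).const_mul (1 / 4)
      rw [mul_zero] at this
      simpa using ENNReal.tendsto_ofReal this
    refine tendsto_of_tendsto_of_tendsto_of_le_of_le tendsto_const_nhds h2 (fun _ => zero_le)
      fun n => ?_
    rw [← ofReal_norm, norm_sub_rev]
    exact ENNReal.ofReal_le_ofReal (hNs n x).le
  -- A subsequence converges almost everywhere to `F x`, which identifies the pointwise limit of the
  -- full sequence.
  obtain ⟨ns, hns, hsub⟩ := (tendstoInMeasure_of_tendsto_eLpNorm two_ne_zero hfm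
    (Lp.aestronglyMeasurable _) hto).exists_seq_tendsto_ae
  filter_upwards [hlim, hsub] with y h1 h2
  obtain ⟨l, hl⟩ := h1
  have h3 : (F x : Y → ℂ) y = l := tendsto_nhds_unique h2 (hl.comp hns.tendsto_atTop)
  rw [h3]
  exact hl.limUnder_eq.symm

end Measurability

/-! ### Square integrable functions and Parseval's identity in `ℝ≥0∞` -/

section SquareIntegrable

variable {X Y : Type*} [MeasurableSpace X] [MeasurableSpace Y] {μ : Measure X} {ν : Measure Y}

theorem eLpNorm_two_sq (f : X → ℂ) : eLpNorm f 2 μ ^ 2 = ∫⁻ x, ‖f x‖ₑ ^ 2 ∂μ := by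
  rw [eLpNorm_eq_lintegral_rpow_enorm_toReal two_ne_zero ENNReal.ofNat_ne_top,
    ← ENNReal.rpow_natCast, ← ENNReal.rpow_mul]
  simp

theorem enorm_sq_eq_lintegral (f : Lp ℂ 2 μ) : ‖f‖ₑ ^ 2 = ∫⁻ x, ‖f x‖ₑ ^ 2 ∂μ := by
  rw [Lp.enorm_def, eLpNorm_two_sq]

theorem memLp_two_iff {f : X → ℂ} (hf : AEStronglyMeasurable f μ) :
    MemLp f 2 μ ↔ ∫⁻ x, ‖f x‖ₑ ^ 2 ∂μ < ∞ := by
  rw [← eLpNorm_two_sq, ENNReal.pow_lt_top_iff]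
  simp [MemLp, hf]

theorem enorm_toLp_sq {f : X → ℂ} (hf : MemLp f 2 μ) :
    ‖hf.toLp f‖ₑ ^ 2 = ∫⁻ x, ‖f x‖ₑ ^ 2 ∂μ := by
  rw [Lp.enorm_toLp, eLpNorm_two_sq]

theorem inner_eq_integral (f g : Lp ℂ 2 μ) : inner ℂ f g = ∫ x, star (f x) * g x ∂μ := by
  rw [L2.inner_def]
  simp only [RCLike.inner_apply', RCLike.star_def]

theorem integral_mul_eq_inner {g : X → ℂ} (hg : MemLp g 2 μ) (u : Lp ℂ 2 μ) :
    ∫ x, g x * u x ∂μ = inner ℂ (hg.star.toLp (star g)) u := by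
  rw [inner_eq_integral]
  refine integral_congr_ae ?_
  filter_upwards [hg.star.coeFn_toLp] with x hx
  rw [hx, Pi.star_apply, star_star]

theorem enorm_integral_mul_sq_le {g : X → ℂ} (hg : MemLp g 2 μ) (u : Lp ℂ 2 μ) :
    ‖∫ x, g x * u x ∂μ‖ₑ ^ 2 ≤ (∫⁻ x, ‖g x‖ₑ ^ 2 ∂μ) * ‖u‖ₑ ^ 2 := by
  have h : ∫⁻ x, ‖g x‖ₑ ^ 2 ∂μ = ‖hg.star.toLp (star g)‖ₑ ^ 2 := by
    rw [enorm_toLp_sq]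
    simp
  rw [integral_mul_eq_inner hg, h, ← mul_pow]
  gcongr
  simp only [enorm_eq_nnnorm]
  exact_mod_cast nnnorm_inner_le_nnnorm _ _

theorem _root_.HilbertBasis.tsum_enorm_inner_sq {H ι : Type*} [NormedAddCommGroup H]
    [InnerProductSpace ℂ H] (b : HilbertBasis ι ℂ H) (u : H) :
    ∑' i, ‖inner ℂ u (b i)‖ₑ ^ 2 = ‖u‖ₑ ^ 2 := by
  have h := b.hasSum_inner_mul_inner u u
  have h1 : HasSum (fun i => ‖inner ℂ u (b i)‖ ^ 2) (‖u‖ ^ 2) := by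
    have := RCLike.hasSum_re ℂ h
    rw [inner_self_eq_norm_sq] at this
    convert! this using 2 with i
    rw [← inner_conj_symm (b i) u, RCLike.mul_conj]
    norm_cast
  have h2 := ENNReal.ofReal_tsum_of_nonneg (fun i => by positivity) h1.summable
  rw [h1.tsum_eq] at h2
  simp only [← ofReal_norm, ENNReal.ofReal_pow (norm_nonneg _)] at h2 ⊢
  exact h2.symm

end SquareIntegrable

/-! ### Integral operators with square integrable kernels -/

section Kernel

variable {X Y : Type*} [MeasurableSpace X] [MeasurableSpace Y] {μ : Measure X} {ν : Measure Y}
  [SFinite μ] [SFinite ν]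

theorem lintegral_enorm_sq_prod {κ : X × Y → ℂ} (hκ : AEStronglyMeasurable κ (μ.prod ν)) :
    ∫⁻ p, ‖κ p‖ₑ ^ 2 ∂(μ.prod ν) = ∫⁻ x, ∫⁻ y, ‖κ (x, y)‖ₑ ^ 2 ∂ν ∂μ :=
  lintegral_prod _ (hκ.enorm.pow_const 2)

theorem memLp_two_slice {κ : X × Y → ℂ} (hκ : MemLp κ 2 (μ.prod ν)) :
    ∀ᵐ x ∂μ, MemLp (fun y => κ (x, y)) 2 ν := by
  have h1 := (memLp_two_iff hκ.1).1 hκ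
  rw [lintegral_enorm_sq_prod hκ.1] at h1
  have h2 := ae_lt_top' (hκ.1.enorm.pow_const 2).lintegral_prod_right' h1.ne
  filter_upwards [h2, hκ.1.prodMk_left] with x hx hx'
  exact (memLp_two_iff hx').2 hx

theorem aestronglyMeasurable_kernel_integral {κ : X × Y → ℂ} (hκ : MemLp κ 2 (μ.prod ν))
    (u : Lp ℂ 2 ν) : AEStronglyMeasurable (fun x => ∫ y, κ (x, y) * u y ∂ν) μ := by
  have h : AEStronglyMeasurable (fun p : X × Y => κ p * u p.2) (μ.prod ν) :=
    hκ.1.mul (Lp.aestronglyMeasurable u).comp_snd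
  exact h.integral_prod_right'

/-- Cauchy–Schwarz in `y` for almost every fixed `x`, then integration in `x`. -/
theorem lintegral_kernel_sq_le {κ : X × Y → ℂ} (hκ : MemLp κ 2 (μ.prod ν))
    (u : Lp ℂ 2 ν) : ∫⁻ x, ‖∫ y, κ (x, y) * u y ∂ν‖ₑ ^ 2 ∂μ ≤
      (∫⁻ p, ‖κ p‖ₑ ^ 2 ∂(μ.prod ν)) * ‖u‖ₑ ^ 2 := by
  rw [lintegral_enorm_sq_prod hκ.1, ← lintegral_mul_const' _ _ (by simp)]
  refine lintegral_mono_ae ?_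
  filter_upwards [memLp_two_slice hκ] with x hx
  exact enorm_integral_mul_sq_le hx u

theorem memLp_kernel_integral {κ : X × Y → ℂ} (hκ : MemLp κ 2 (μ.prod ν))
    (u : Lp ℂ 2 ν) : MemLp (fun x => ∫ y, κ (x, y) * u y ∂ν) 2 μ := by
  refine (memLp_two_iff (aestronglyMeasurable_kernel_integral hκ u)).2 ?_
  refine (lintegral_kernel_sq_le hκ u).trans_lt (ENNReal.mul_lt_top ?_ (by simp))
  exact (memLp_two_iff hκ.1).1 hκ

theorem integrable_mul_coeFn {g : Y → ℂ} (hg : MemLp g 2 ν) (u : Lp ℂ 2 ν) :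
    Integrable (fun y => g y * u y) ν :=
  hg.integrable_mul (Lp.memLp u)

open Classical in
/-- The integral operator with kernel `κ`, if `κ` is square integrable. -/
def kerOp (μ : Measure X) (ν : Measure Y) [SFinite μ] [SFinite ν] (κ : X × Y → ℂ) :
    Lp ℂ 2 ν →L[ℂ] Lp ℂ 2 μ :=
  if hκ : MemLp κ 2 (μ.prod ν) then
    LinearMap.mkContinuous
      { toFun := fun u => (memLp_kernel_integral hκ u).toLp _
        map_add' := fun u v => by
          refine Lp.ext ?_
          filter_upwards [(memLp_kernel_integral hκ (u + v)).coeFn_toLp,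
            (memLp_kernel_integral hκ u).coeFn_toLp, (memLp_kernel_integral hκ v).coeFn_toLp,
            Lp.coeFn_add ((memLp_kernel_integral hκ u).toLp _)
              ((memLp_kernel_integral hκ v).toLp _), memLp_two_slice hκ] with x h1 h2 h3 h4 h5
          rw [h1, h4, Pi.add_apply, h2, h3,
            ← integral_add (integrable_mul_coeFn h5 u) (integrable_mul_coeFn h5 v)]
          refine integral_congr_ae ?_
          filter_upwards [Lp.coeFn_add u v] with y hy
          rw [hy, Pi.add_apply, mul_add]
        map_smul' := fun c u => by
          refine Lp.ext ?_
          filter_upwards [(memLp_kernel_integral hκ (c • u)).coeFn_toLp,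
            (memLp_kernel_integral hκ u).coeFn_toLp,
            Lp.coeFn_smul c ((memLp_kernel_integral hκ u).toLp _)] with x h1 h2 h4
          rw [h1, RingHom.id_apply, h4, Pi.smul_apply, h2, ← integral_smul]
          refine integral_congr_ae ?_
          filter_upwards [Lp.coeFn_smul c u] with y hy
          rw [hy, Pi.smul_apply, smul_eq_mul, smul_eq_mul]
          ring }
      (eLpNorm κ 2 (μ.prod ν)).toReal fun u => by
        change ‖(memLp_kernel_integral hκ u).toLp _‖ ≤ _
        rw [Lp.norm_toLp, Lp.norm_def, ← ENNReal.toReal_mul]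
        refine ENNReal.toReal_mono (ENNReal.mul_ne_top hκ.2.ne (Lp.memLp u).2.ne) ?_
        have h := lintegral_kernel_sq_le hκ u
        rw [← eLpNorm_two_sq, ← eLpNorm_two_sq, Lp.enorm_def, ← mul_pow] at h
        exact (ENNReal.pow_le_pow_left_iff two_ne_zero).1 h
  -- The default value makes the operator meaningful at every parameter of a measurable family of
  -- kernels, including the exceptional ones whose slice is not square integrable.
  else 0

theorem kerOp_coeFn {κ : X × Y → ℂ} (hκ : MemLp κ 2 (μ.prod ν)) (u : Lp ℂ 2 ν) :
    (kerOp μ ν κ u : X → ℂ) =ᵐ[μ] fun x => ∫ y, κ (x, y) * u y ∂ν := by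
  unfold kerOp
  rw [dif_pos hκ]
  exact (memLp_kernel_integral hκ u).coeFn_toLp

theorem enorm_kerOp_sq_le {κ : X × Y → ℂ} (hκ : MemLp κ 2 (μ.prod ν)) (u : Lp ℂ 2 ν) :
    ‖kerOp μ ν κ u‖ₑ ^ 2 ≤ (∫⁻ p, ‖κ p‖ₑ ^ 2 ∂(μ.prod ν)) * ‖u‖ₑ ^ 2 := by
  rw [enorm_sq_eq_lintegral]
  refine le_trans (le_of_eq (lintegral_congr_ae ?_)) (lintegral_kernel_sq_le hκ u)
  filter_upwards [kerOp_coeFn hκ u] with x hx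
  rw [hx]

theorem kerOp_of_not_memLp {κ : X × Y → ℂ} (hκ : ¬MemLp κ 2 (μ.prod ν)) : kerOp μ ν κ = 0 := by
  unfold kerOp
  rw [dif_neg hκ]

theorem kerOp_congr {κ κ' : X × Y → ℂ} (h : κ =ᵐ[μ.prod ν] κ') :
    kerOp μ ν κ = kerOp μ ν κ' := by
  by_cases hκ : MemLp κ 2 (μ.prod ν)
  · have hκ' : MemLp κ' 2 (μ.prod ν) := (memLp_congr_ae h).1 hκ
    refine ContinuousLinearMap.ext fun u => Lp.ext ?_
    filter_upwards [kerOp_coeFn hκ u, kerOp_coeFn hκ' u, Measure.ae_ae_of_ae_prod h]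
      with x h1 h2 h3
    rw [h1, h2]
    refine integral_congr_ae ?_
    filter_upwards [h3] with y hy
    rw [hy]
  · rw [kerOp_of_not_memLp hκ, kerOp_of_not_memLp fun h' => hκ ((memLp_congr_ae h).2 h')]

theorem kerOp_sub {κ κ' : X × Y → ℂ} (hκ : MemLp κ 2 (μ.prod ν)) (hκ' : MemLp κ' 2 (μ.prod ν)) :
    kerOp μ ν (κ - κ') = kerOp μ ν κ - kerOp μ ν κ' := by
  refine ContinuousLinearMap.ext fun u => Lp.ext ?_
  filter_upwards [kerOp_coeFn hκ u, kerOp_coeFn hκ' u, kerOp_coeFn (hκ.sub hκ') u,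
    Lp.coeFn_sub (kerOp μ ν κ u) (kerOp μ ν κ' u), memLp_two_slice hκ, memLp_two_slice hκ']
    with x h1 h2 h3 h4 h5 h6
  rw [h3, sub_apply, h4, Pi.sub_apply, h1, h2,
    ← integral_sub (integrable_mul_coeFn h5 u) (integrable_mul_coeFn h6 u)]
  simp only [Pi.sub_apply, sub_mul]

theorem inner_kerOp {κ : X × Y → ℂ} (hκ : MemLp κ 2 (μ.prod ν)) (u : Lp ℂ 2 ν) (v : Lp ℂ 2 μ) :
    inner ℂ v (kerOp μ ν κ u) = ∫ x, star (v x) * ∫ y, κ (x, y) * u y ∂ν ∂μ := by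
  rw [inner_eq_integral]
  refine integral_congr_ae ?_
  filter_upwards [kerOp_coeFn hκ u] with x hx
  rw [hx]

/-- The Hilbert–Schmidt norm of an integral operator is the `L²` norm of its kernel. -/
theorem tsum_enorm_kerOp_sq {ι : Type*} [Countable ι] (b : HilbertBasis ι ℂ (Lp ℂ 2 ν))
    {κ : X × Y → ℂ} (hκ : MemLp κ 2 (μ.prod ν)) :
    ∑' i, ‖kerOp μ ν κ (b i)‖ₑ ^ 2 = ∫⁻ p, ‖κ p‖ₑ ^ 2 ∂(μ.prod ν) := by
  have h1 : ∀ i, ‖kerOp μ ν κ (b i)‖ₑ ^ 2 = ∫⁻ x, ‖∫ y, κ (x, y) * b i y ∂ν‖ₑ ^ 2 ∂μ :=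
    fun i => by
      rw [enorm_sq_eq_lintegral]
      refine lintegral_congr_ae ?_
      filter_upwards [kerOp_coeFn hκ (b i)] with x hx
      rw [hx]
  simp only [h1]
  -- Tonelli exchanges the sum over the basis with the integral over `x`; for fixed `x` the inner
  -- sum is Parseval's identity for the conjugated slice `κ(x, ·)`.
  rw [← lintegral_tsum fun i =>
    (aestronglyMeasurable_kernel_integral hκ (b i)).enorm.pow_const 2, lintegral_enorm_sq_prod hκ.1]
  refine lintegral_congr_ae ?_
  filter_upwards [memLp_two_slice hκ] with x hx
  simp only [integral_mul_eq_inner hx]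
  rw [b.tsum_enorm_inner_sq, enorm_toLp_sq]
  simp

end Kernel

/-! ### Fourier series on boxes -/

section FourierSeries

variable {ι : Type*} [Fintype ι]

/-- The half-open box with lower corner `c` and side lengths `s`. -/
def box (c s : ι → ℝ) : Set (ι → ℝ) := {x | ∀ i, x i ∈ Set.Ioc (c i) (c i + s i)}

theorem measurableSet_box (c s : ι → ℝ) : MeasurableSet (box c s) :=
  MeasurableSet.univ_pi' fun _ => measurableSet_Ioc

theorem volume_box (c s : ι → ℝ) : volume (box c s) = ∏ i, ENNReal.ofReal (s i) := by
  have : box c s = Set.univ.pi fun i => Set.Ioc (c i) (c i + s i) := by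
    ext x
    simp [box]
  rw [this, volume_pi_pi]
  simp

attribute [local instance] instMeasureSpaceUnitAddCircle

/-- A function supported in a unit box is a function on the torus, where the monomials
`UnitAddTorus.mFourierBasis` form a Hilbert basis. The lower corner `c` is arbitrary because any
unit box is a fundamental domain. -/
theorem tsum_enorm_integral_unit_box (c : ι → ℝ) {G : (ι → ℝ) → ℂ} (hG : Measurable G)
    (hG2 : ∫⁻ x, ‖G x‖ₑ ^ 2 < ∞) (hs : ∀ x, x ∉ box c 1 → G x = 0) :
    ∑' m : ι → ℤ, ‖∫ x, Complex.exp (-2 * Real.pi * Complex.I * ((∑ i, m i * x i : ℝ) : ℂ)) *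
      G x‖ₑ ^ 2 = ∫⁻ x, ‖G x‖ₑ ^ 2 := by
  set lift : UnitAddTorus ι → (ι → ℝ) := fun τ => (UnitAddTorus.measurableEquivPiIoc c τ).1
    with hlift
  have hliftm : Measurable lift :=
    measurable_subtype_coe.comp (UnitAddTorus.measurableEquivPiIoc c).measurable
  have hbox : {x : ι → ℝ | ∀ i, x i ∈ Set.Ioc (c i) (c i + 1)} = box c 1 := rfl
  have hl : ∀ x ∈ box c 1, lift (fun i => x i) = x := fun x hx =>
    congrArg Subtype.val ((UnitAddTorus.measurableEquivPiIoc c).apply_symm_apply ⟨x, hx⟩)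
  set f : UnitAddTorus ι → ℂ := fun τ => G (lift τ) with hf
  have hfm : AEStronglyMeasurable f volume := (hG.comp hliftm).aestronglyMeasurable
  have hf2 : ∫⁻ τ, ‖f τ‖ₑ ^ 2 = ∫⁻ x, ‖G x‖ₑ ^ 2 := by
    rw [UnitAddTorus.lintegral_preimage _ c, hbox, ← lintegral_indicator (measurableSet_box _ _)]
    congr with x
    by_cases hx : x ∈ box c 1
    · rw [Set.indicator_of_mem hx, hf]
      simp only [hl x hx]
    · rw [Set.indicator_of_notMem hx, hs x hx]
      simp
  have hfL : MemLp f 2 volume := (memLp_two_iff hfm).2 (hf2 ▸ hG2)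
  have h := UnitAddTorus.mFourierBasis.tsum_enorm_inner_sq (hfL.toLp f)
  rw [enorm_toLp_sq, hf2] at h
  rw [← h]
  refine tsum_congr fun m => ?_
  congr 1
  rw [← inner_conj_symm, ← HilbertBasis.repr_apply_apply, UnitAddTorus.mFourierBasis_repr]
  rw [← ofReal_norm, ← ofReal_norm, RCLike.norm_conj]
  congr 2
  have h1 : UnitAddTorus.mFourierCoeff (hfL.toLp f) m = UnitAddTorus.mFourierCoeff f m := by
    refine integral_congr_ae ?_
    filter_upwards [hfL.coeFn_toLp] with τ hτ
    rw [hτ]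
  rw [h1, UnitAddTorus.mFourierCoeff_eq_integral f m c, hbox,
    ← integral_indicator (measurableSet_box _ _)]
  congr with x
  by_cases hx : x ∈ box c 1
  · rw [Set.indicator_of_mem hx, hf]
    simp only [hl x hx, smul_eq_mul]
    congr 1
    simp only [UnitAddTorus.mFourier, ContinuousMap.coe_mk, fourier_coe_apply, Pi.neg_apply]
    rw [← Complex.exp_sum]
    congr 1
    push_cast
    rw [Finset.mul_sum]
    refine Finset.sum_congr rfl fun i _ => ?_
    ring
  · rw [Set.indicator_of_notMem hx, hs x hx, mul_zero]

/-- Dilation of the coordinates scales Lebesgue measure. -/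
theorem map_dilation_volume {s : ι → ℝ} (hs : ∀ i, 0 < s i) :
    Measure.map (fun (x : ι → ℝ) i => s i * x i) volume =
      (∏ i, ENNReal.ofReal (s i))⁻¹ • volume := by
  classical
  have hdet : (Matrix.diagonal s).det ≠ 0 := by
    rw [Matrix.det_diagonal]
    exact (Finset.prod_pos fun i _ => hs i).ne'
  have h := Real.map_matrix_volume_pi_eq_smul_volume_pi hdet
  have h1 : ⇑(Matrix.toLin' (Matrix.diagonal s)) = fun (x : ι → ℝ) i => s i * x i := by
    ext x i
    simp [Matrix.mulVec_diagonal]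
  rw [h1] at h
  rw [h, Matrix.det_diagonal, abs_of_pos (inv_pos.2 (Finset.prod_pos fun i _ => hs i)),
    ENNReal.ofReal_inv_of_pos (Finset.prod_pos fun i _ => hs i),
    ENNReal.ofReal_prod_of_nonneg fun i _ => (hs i).le]

/-- Parseval's identity for Fourier series on a box. -/
theorem tsum_enorm_integral_box (c : ι → ℝ) {s : ι → ℝ} (hs : ∀ i, 0 < s i) {G : (ι → ℝ) → ℂ}
    (hG : Measurable G) (hG2 : ∫⁻ x, ‖G x‖ₑ ^ 2 < ∞) (h0 : ∀ x, x ∉ box c s → G x = 0) :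
    ∑' m : ι → ℤ, ‖∫ x, Complex.exp (-2 * Real.pi * Complex.I *
      ((∑ i, m i / s i * x i : ℝ) : ℂ)) * G x‖ₑ ^ 2 =
        (∏ i, ENNReal.ofReal (s i)) * ∫⁻ x, ‖G x‖ₑ ^ 2 := by
  set δ : (ι → ℝ) → (ι → ℝ) := fun x i => s i * x i with hδ
  have hδm : Measurable δ := by fun_prop
  have hδe : MeasurableEmbedding δ := by
    refine (Measurable.measurableEmbedding hδm) fun x y hxy => ?_
    ext i
    exact mul_left_cancel₀ (hs i).ne' (congrFun hxy i)
  set A := ∏ i, ENNReal.ofReal (s i) with hA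
  have hA0 : A ≠ 0 := Finset.prod_ne_zero_iff.2 fun i _ => by simpa using hs i
  have hAt : A ≠ ∞ := ENNReal.prod_ne_top fun i _ => by simp
  have hmap : Measure.map δ volume = A⁻¹ • volume := map_dilation_volume hs
  have hvol : (volume : Measure (ι → ℝ)) = A • Measure.map δ volume := by
    rw [hmap, smul_smul, ENNReal.mul_inv_cancel hA0 hAt, one_smul]
  have hL : ∀ f : (ι → ℝ) → ℝ≥0∞, ∫⁻ x, f x = A * ∫⁻ x, f (δ x) := fun f => by
    conv_lhs => rw [hvol]
    rw [lintegral_smul_measure, hδe.lintegral_map, smul_eq_mul]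
  have hI : ∀ f : (ι → ℝ) → ℂ, ∫ x, f x = A.toReal • ∫ x, f (δ x) := fun f => by
    conv_lhs => rw [hvol]
    rw [integral_smul_measure, hδe.integral_map]
  have hk := tsum_enorm_integral_unit_box (fun i => c i / s i) (hG.comp hδm) (by
      rw [hL] at hG2
      exact (ENNReal.mul_lt_top_iff.1 hG2).elim (fun h => h.2) fun h => h.elim
        (fun h => absurd h hA0) fun h => h ▸ ENNReal.zero_lt_top) fun x hx => by
    refine h0 _ fun hx' => hx fun i => ?_
    have h1 := hx' i
    simp only [hδ, Set.mem_Ioc] at h1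
    simp only [Set.mem_Ioc, Pi.one_apply]
    rw [div_lt_iff₀ (hs i), div_add_one (hs i).ne', le_div_iff₀ (hs i)]
    constructor <;> linarith [h1.1, h1.2, mul_comm (s i) (x i)]
  -- After rescaling, each squared coefficient carries A² from the two factors of the integral. The
  -- right side carries one A from the statement and one from the rescaled norm.
  rw [hL fun x => ‖G x‖ₑ ^ 2]
  change _ = A * (A * ∫⁻ x, ‖(G ∘ δ) x‖ₑ ^ 2)
  rw [← hk, ← mul_assoc, ← ENNReal.tsum_mul_left]
  refine tsum_congr fun m => ?_
  rw [hI, enorm_smul, mul_pow]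
  have h2 : ‖A.toReal‖ₑ = A := by
    rw [Real.enorm_eq_ofReal ENNReal.toReal_nonneg, ENNReal.ofReal_toReal hAt]
  rw [h2, sq A]
  have h3 : ∀ x : ι → ℝ, ∑ i, (m i : ℝ) / s i * δ x i = ∑ i, m i * x i := fun x =>
    Finset.sum_congr rfl fun i _ => by
      have := (hs i).ne'
      simp only [hδ]
      field_simp
  simp only [Function.comp_apply, h3]

end FourierSeries

/-! ### Tilings by boxes -/

section Tiling

variable {ι : Type*} [Fintype ι] {s : ι → ℝ}

/-- The box of the tiling with side lengths `s` that has index `n`. -/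
def cell (s : ι → ℝ) (n : ι → ℤ) : Set (ι → ℝ) := box (fun i => n i * s i) s

theorem existsUnique_mem_cell (hs : ∀ i, 0 < s i) (x : ι → ℝ) : ∃! n, x ∈ cell s n := by
  have h : ∀ i, ∃! k : ℤ, x i ∈ Set.Ioc (k * s i) (k * s i + s i) := fun i => by
    obtain ⟨k, hk, hu⟩ := existsUnique_sub_zsmul_mem_Ioc (hs i) (x i) 0
    simp only [zsmul_eq_mul, Set.mem_Ioc] at hk hu
    refine ⟨k, ⟨by linarith [hk.1], by linarith [hk.2]⟩, fun m hm => hu m ⟨?_, ?_⟩⟩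
    · linarith [hm.1]
    · linarith [hm.2]
  choose k hk hu using fun i => (h i)
  exact ⟨k, hk, fun n hn => funext fun i => hu i _ (hn i)⟩

theorem tsum_indicator_cell (hs : ∀ i, 0 < s i) (x : ι → ℝ) (a : ℝ≥0∞) :
    ∑' n, (cell s n).indicator (fun _ => a) x = a := by
  obtain ⟨n, hn, hu⟩ := existsUnique_mem_cell hs x
  rw [tsum_eq_single n fun m hm => Set.indicator_of_notMem (fun h => hm (hu m h)) _,
    Set.indicator_of_mem hn]

/-- Moving the translation from the function to the domain turns the terms into integrals of `F`
over the cells of the tiling. -/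
theorem tsum_lintegral_cell_translate (hs : ∀ i, 0 < s i) {F : (ι → ℝ) → ℝ≥0∞}
    (hF : Measurable F) :
    ∑' n : ι → ℤ, ∫⁻ t in cell s 0, F (t - fun i => n i * s i) = ∫⁻ t, F t := by
  have h1 : ∀ n : ι → ℤ, ∫⁻ t in cell s 0, F (t - fun i => n i * s i) =
      ∫⁻ t, (cell s (-n)).indicator (fun _ => F t) t := fun n => by
    rw [cell, ← lintegral_indicator (measurableSet_box _ _), ← cell,
      ← lintegral_sub_right_eq_self (fun t => (cell s (-n)).indicator (fun _ => F t) t)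
        (fun i => n i * s i)]
    congr with t
    have : t ∈ cell s 0 ↔ (t - fun i => n i * s i) ∈ cell s (-n) := by
      refine forall_congr' fun i => ?_
      simp only [Pi.zero_apply, Int.cast_zero, zero_mul, zero_add, Set.mem_Ioc, Pi.sub_apply,
        Pi.neg_apply, Int.cast_neg]
      constructor <;> rintro ⟨h1, h2⟩ <;> constructor <;> linarith
    by_cases ht : t ∈ cell s 0
    · rw [Set.indicator_of_mem ht, Set.indicator_of_mem (this.1 ht)]
    · rw [Set.indicator_of_notMem ht, Set.indicator_of_notMem (mt this.2 ht)]
  simp only [h1]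
  rw [← lintegral_tsum]
  · congr with t
    rw [← Equiv.tsum_eq (Equiv.neg (ι → ℤ))]
    simp only [Equiv.neg_apply, neg_neg]
    exact tsum_indicator_cell hs t (F t)
  · intro n
    exact (hF.indicator (measurableSet_box _ _)).aemeasurable

end Tiling

section Structure

variable {r d : ℕ} {𝔫 : Type*} [LieRing 𝔫] [LieAlgebra ℝ 𝔫]
  {β : Module.Basis (Fin r ⊕ Fin d ⊕ Fin d) ℝ 𝔫}

/-! ### The matrix `B(l)` -/

theorem functional_apply (l : Fin r → ℝ) (u : 𝔫) :
    functional β l u = ∑ k, l k * β.repr u (Sum.inl k) := by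
  rw [functional, Module.Basis.constr_apply_fintype, Fintype.sum_sum_type]
  simp [Module.Basis.equivFun_apply, mul_comm]

theorem matB_apply (l : Fin r → ℝ) (i j : Fin d) :
    matB β l i j = -∑ k, l k * β.repr ⁅vecX β i, vecY β j⁆ (Sum.inl k) := by
  rw [matB, Matrix.of_apply, functional_apply]

theorem matB_add (l l' : Fin r → ℝ) : matB β (l + l') = matB β l + matB β l' := by
  ext i j
  simp [matB_apply, add_mul, Finset.sum_add_distrib]
  ring

theorem matB_smul (c : ℝ) (l : Fin r → ℝ) : matB β (c • l) = c • matB β l := by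
  ext i j
  simp [matB_apply, mul_assoc, Finset.mul_sum]

theorem continuous_matB_apply (i j : Fin d) : Continuous fun l => matB β l i j := by
  simp only [matB_apply]
  fun_prop

theorem continuous_matB : Continuous (matB β) :=
  continuous_matrix continuous_matB_apply

theorem continuous_det_matB : Continuous fun l => (matB β l).det :=
  continuous_matB.matrix_det

/-- The only place where the commutators meet the representation: this cocycle term of the group law
matches the shift of `t` in the phase of `π_l`. -/
theorem dotProduct_bracketXY (l : Fin r → ℝ) (x y : Fin d → ℝ) :
    l ⬝ᵥ bracketXY β x y = -(x ⬝ᵥ (matB β l *ᵥ y)) := by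
  simp only [dotProduct, bracketXY, Matrix.mulVec, matB_apply, Finset.mul_sum, neg_mul,
    Finset.sum_mul, mul_neg, Finset.sum_neg_distrib, neg_neg]
  rw [Finset.sum_comm]
  refine Finset.sum_congr rfl fun i _ => ?_
  rw [Finset.sum_comm]
  refine Finset.sum_congr rfl fun j _ => Finset.sum_congr rfl fun k _ => ?_
  ring

/-- Take the restriction to the centre of a functional whose radical is central. If `B` were
singular there, a null vector `y` would give u = ∑ yⱼYⱼ with f([u, ·]) = 0: on the `X_i` by B y = 0,
on the `Y_j` because they commute, on the `Z_k` because they are central. Then `u` would be central,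
hence in the span of the `Z_k`, which forces y = 0. -/
theorem exists_det_matB_ne_zero (hβ : IsAdmissibleBasis β) : ∃ l, (matB β l).det ≠ 0 := by
  obtain ⟨f, hf⟩ := hβ.exists_radical_eq_center
  refine ⟨fun k => f (vecZ β k), fun hdet => ?_⟩
  set l : Fin r → ℝ := fun k => f (vecZ β k) with hl
  have hcen : ∀ u ∈ LieAlgebra.center ℝ 𝔫, u ∈ Submodule.span ℝ (Set.range (vecZ β)) :=
    fun u hu => by
      rw [← hβ.center_eq]
      exact hu
  have hfl : ∀ u ∈ Submodule.span ℝ (Set.range (vecZ β)), f u = functional β l u := by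
    intro u hu
    induction hu using Submodule.span_induction with
    | mem u hu =>
      obtain ⟨k, rfl⟩ := hu
      rw [functional, vecZ, Module.Basis.constr_basis]
      rfl
    | zero => simp
    | add u v _ _ h1 h2 => rw [map_add, map_add, h1, h2]
    | smul c u _ h => rw [map_smul, map_smul, h]
  obtain ⟨y, hy0, hy⟩ := Matrix.exists_mulVec_eq_zero_iff.2 hdet
  set u : 𝔫 := ∑ j, y j • vecY β j with hu
  have hfX : ∀ i, f ⁅u, vecX β i⁆ = 0 := fun i => by
    have h1 := congrFun hy i
    simp only [Matrix.mulVec, dotProduct, matB, Matrix.of_apply, Pi.zero_apply] at h1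
    rw [← lie_skew, map_neg, hu, lie_sum, map_sum, ← h1, ← Finset.sum_neg_distrib]
    refine Finset.sum_congr rfl fun j _ => ?_
    rw [lie_smul, map_smul, smul_eq_mul, hfl _ (hcen _ (hβ.lie_mem_center _ _))]
    ring
  have hfY : ∀ i, f ⁅u, vecY β i⁆ = 0 := fun i => by
    rw [← lie_skew, map_neg, hu, lie_sum, map_sum, Finset.sum_eq_zero, neg_zero]
    intro j _
    rw [lie_smul, hβ.lie_Y_Y, smul_zero, map_zero]
  have hfZ : ∀ k, f ⁅u, vecZ β k⁆ = 0 := fun k => by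
    have h1 : vecZ β k ∈ LieAlgebra.center ℝ 𝔫 := by
      have : vecZ β k ∈ (LieAlgebra.center ℝ 𝔫).toSubmodule := by
        rw [hβ.center_eq]
        exact Submodule.subset_span ⟨k, rfl⟩
      exact this
    rw [(LieModule.mem_maxTrivSubmodule ℝ 𝔫 𝔫 _).1 h1 u, map_zero]
  have hfu : ∀ v, f ⁅u, v⁆ = 0 := by
    have h1 : f ∘ₗ (LieAlgebra.ad ℝ 𝔫 u : 𝔫 →ₗ[ℝ] 𝔫) = 0 := by
      refine β.ext fun s => ?_
      rcases s with k | j | i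
      · exact hfZ k
      · exact hfY j
      · exact hfX i
    exact fun v => LinearMap.congr_fun h1 v
  have hmem := hcen u (hf u hfu)
  refine hy0 (funext fun j => ?_)
  have h1 : ∀ w ∈ Submodule.span ℝ (Set.range (vecZ β)),
      β.repr w (Sum.inr (Sum.inl j)) = 0 := by
    intro w hw
    induction hw using Submodule.span_induction with
    | mem w hw =>
      obtain ⟨k, rfl⟩ := hw
      simp [vecZ]
    | zero => simp
    | add v w _ _ h1 h2 => simp [h1, h2]
    | smul c w _ h => simp [h]
  have h2 := h1 u hmem
  simp only [hu, map_sum, map_smul, vecY, Module.Basis.repr_self, Finsupp.smul_single,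
    Finsupp.finsetSum_apply, Finsupp.single_apply] at h2
  simpa using h2

/-- The set where `det B(l) = 0` is a proper algebraic subset, hence a null set. -/
theorem ae_det_matB_ne_zero (hβ : IsAdmissibleBasis β) : ∀ᵐ l, (matB β l).det ≠ 0 := by
  obtain ⟨l₀, h0⟩ := exists_det_matB_ne_zero hβ
  -- It suffices to look at lines in a direction `l₀` where the determinant is nonzero. On each of
  -- them det B(l + s l₀) is a polynomial in `s` whose coefficient of degree `d` is det B(l₀), so it
  -- has finitely many zeros.
  have hm : MeasurableSet {l : Fin r → ℝ | (matB β l).det ≠ 0} :=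
    (measurableSet_eq_fun continuous_det_matB.measurable measurable_const).compl
  refine ae_mem_of_ae_add_linearMap_mem (LinearMap.toSpanSingleton ℝ (Fin r → ℝ) l₀)
    volume volume hm fun l => ?_
  set p : Polynomial ℝ := ((Polynomial.X : Polynomial ℝ) • (matB β l₀).map Polynomial.C +
    (matB β l).map Polynomial.C).det with hp
  have hp0 : p ≠ 0 := fun h => h0 <| by
    rw [← Polynomial.coeff_det_X_add_C_card (matB β l₀) (matB β l), ← hp, h, Polynomial.coeff_zero]
  have hev : ∀ s, (matB β (l + s • l₀)).det = p.eval s := fun s => by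
    rw [hp, ← Polynomial.coe_evalRingHom, RingHom.map_det]
    congr 1
    ext i j
    simp only [matB_add, matB_smul, Matrix.add_apply, Matrix.smul_apply, smul_eq_mul,
      Polynomial.coe_evalRingHom, RingHom.mapMatrix_apply, Matrix.map_apply, Polynomial.eval_add,
      Polynomial.eval_mul, Polynomial.eval_X, Polynomial.eval_C]
    ring
  refine measure_mono_null (t := {s | p.IsRoot s}) ?_
    (Set.Finite.measure_zero (Polynomial.finite_setOfPred_isRoot hp0) _)
  intro s hs
  have hs' : (matB β (l + s • l₀)).det = 0 := not_not.1 hs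
  rw [hev] at hs'
  exact hs'

/-! ### The Plancherel measure -/

instance : SigmaFinite (plancherelMeasure β) := by
  unfold plancherelMeasure
  exact SigmaFinite.withDensity_of_ne_top (ae_of_all _ fun _ => ENNReal.ofReal_ne_top)

theorem measurable_density : Measurable fun l => ENNReal.ofReal |(matB β l).det| :=
  continuous_det_matB.measurable.abs.ennreal_ofReal

theorem lintegral_plancherelMeasure {f : (Fin r → ℝ) → ℝ≥0∞} (hf : Measurable f) :
    ∫⁻ l, f l ∂(plancherelMeasure β) = ∫⁻ l, ENNReal.ofReal |(matB β l).det| * f l :=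
  lintegral_withDensity_eq_lintegral_mul _ measurable_density hf

/-- The density |det B| vanishes only on a null set, so the Plancherel and Lebesgue measures have
the same null sets. -/
theorem ae_plancherelMeasure_iff (hβ : IsAdmissibleBasis β) {p : (Fin r → ℝ) → Prop} :
    (∀ᵐ l ∂(plancherelMeasure β), p l) ↔ ∀ᵐ l, p l := by
  rw [plancherelMeasure, ae_withDensity_iff measurable_density]
  refine ⟨fun h => ?_, fun h => h.mono fun _ hl _ => hl⟩
  filter_upwards [h, ae_det_matB_ne_zero hβ] with l h1 h2
  exact h1 (by simpa using h2)

/-! ### The parametrization of the coadjoint orbits -/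

/-- The map `(l, t) ↦ (-l, -B(l)ᵀ t)`. -/
def orbitMap (β : Module.Basis (Fin r ⊕ Fin d ⊕ Fin d) ℝ 𝔫) (p : (Fin r → ℝ) × (Fin d → ℝ)) :
    (Fin r → ℝ) × (Fin d → ℝ) :=
  (-p.1, -((matB β p.1)ᵀ *ᵥ p.2))

/-- The almost everywhere inverse of `orbitMap`. -/
def orbitMapInv (β : Module.Basis (Fin r ⊕ Fin d ⊕ Fin d) ℝ 𝔫) (p : (Fin r → ℝ) × (Fin d → ℝ)) :
    (Fin r → ℝ) × (Fin d → ℝ) :=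
  (-p.1, -(((matB β (-p.1))ᵀ)⁻¹ *ᵥ p.2))

theorem measurable_matrix_mulVec {X : Type*} [MeasurableSpace X] {A : X → Matrix (Fin d) (Fin d) ℝ}
    (hA : ∀ i j, Measurable fun x => A x i j) {v : X → Fin d → ℝ} (hv : Measurable v) :
    Measurable fun x => A x *ᵥ v x := by
  refine measurable_pi_lambda _ fun i => ?_
  simp only [Matrix.mulVec, dotProduct]
  exact Finset.measurable_sum _ fun j _ => (hA i j).mul ((measurable_pi_apply j).comp hv)

theorem measurable_matB_apply (i j : Fin d) : Measurable fun l => matB β l i j :=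
  (continuous_matB_apply i j).measurable

theorem measurable_orbitMap : Measurable (orbitMap β) := by
  have h0 : ∀ i j, Measurable fun p : (Fin r → ℝ) × (Fin d → ℝ) => matB β p.1 j i := fun i j =>
    (measurable_matB_apply (β := β) j i).comp measurable_fst
  have h : Measurable fun p : (Fin r → ℝ) × (Fin d → ℝ) => (matB β p.1)ᵀ *ᵥ p.2 :=
    measurable_matrix_mulVec h0 measurable_snd
  exact measurable_fst.neg.prodMk h.neg

theorem measurable_orbitMapInv : Measurable (orbitMapInv β) := by
  have h1 : Continuous fun l : Fin r → ℝ => (matB β (-l))ᵀ :=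
    (continuous_matB.comp continuous_neg).matrix_transpose
  have h2 : ∀ i j, Measurable fun l : Fin r → ℝ => ((matB β (-l))ᵀ)⁻¹ i j := fun i j => by
    have h3 : Measurable fun l : Fin r → ℝ => ((matB β (-l))ᵀ.det)⁻¹ := h1.matrix_det.measurable.inv
    have h4 : Measurable fun l : Fin r → ℝ => ((matB β (-l))ᵀ).adjugate i j :=
      (h1.matrix_adjugate.matrix_elem i j).measurable
    simp only [Matrix.inv_def, Matrix.smul_apply, Ring.inverse_eq_inv', smul_eq_mul]
    exact h3.mul h4
  exact measurable_fst.neg.prodMk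
    (measurable_matrix_mulVec (fun i j => (h2 i j).comp measurable_fst) measurable_snd).neg

theorem orbitMapInv_orbitMap {p : (Fin r → ℝ) × (Fin d → ℝ)} (hp : (matB β p.1).det ≠ 0) :
    orbitMapInv β (orbitMap β p) = p := by
  have hu : IsUnit (matB β p.1)ᵀ.det := by
    rw [Matrix.det_transpose]
    exact hp.isUnit
  refine Prod.ext (neg_neg _) ?_
  simp only [orbitMapInv, orbitMap, neg_neg, Matrix.mulVec_neg, Matrix.mulVec_mulVec,
    Matrix.nonsing_inv_mul _ hu, Matrix.one_mulVec]

theorem orbitMap_orbitMapInv {p : (Fin r → ℝ) × (Fin d → ℝ)} (hp : (matB β (-p.1)).det ≠ 0) :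
    orbitMap β (orbitMapInv β p) = p := by
  have hu : IsUnit (matB β (-p.1))ᵀ.det := by
    rw [Matrix.det_transpose]
    exact hp.isUnit
  refine Prod.ext (neg_neg _) ?_
  simp only [orbitMapInv, orbitMap, neg_neg, Matrix.mulVec_neg, Matrix.mulVec_mulVec,
    Matrix.mul_nonsing_inv _ hu, Matrix.one_mulVec]

/-- The Jacobian of t ↦ -Aᵀt, which for A = B(l) cancels the Plancherel density exactly. -/
theorem volume_preimage_neg_mulVec {A : Matrix (Fin d) (Fin d) ℝ} (hA : A.det ≠ 0)
    {s : Set (Fin d → ℝ)} (hs : MeasurableSet s) :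
    ENNReal.ofReal |A.det| * volume ((fun t => -(Aᵀ *ᵥ t)) ⁻¹' s) = volume s := by
  have hdet : (-Aᵀ).det ≠ 0 := by
    rw [Matrix.det_neg, Matrix.det_transpose]
    exact mul_ne_zero (pow_ne_zero _ (by norm_num)) hA
  have habs : |(-Aᵀ).det| = |A.det| := by
    rw [Matrix.det_neg, Matrix.det_transpose, abs_mul, abs_pow, abs_neg, abs_one, one_pow, one_mul]
  have h := Real.map_matrix_volume_pi_eq_smul_volume_pi hdet
  have h1 : ⇑(Matrix.toLin' (-Aᵀ)) = fun t => -(Aᵀ *ᵥ t) := by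
    ext t
    simp
  rw [h1] at h
  have hm : Measurable fun t : Fin d → ℝ => -(Aᵀ *ᵥ t) :=
    (measurable_matrix_mulVec (A := fun _ => Aᵀ) (fun _ _ => measurable_const) measurable_id).neg
  rw [← Measure.map_apply hm hs, h, Measure.smul_apply, smul_eq_mul, abs_inv, habs, ← mul_assoc,
    ← ENNReal.ofReal_mul (abs_nonneg _), mul_inv_cancel₀ (abs_ne_zero.2 hA), ENNReal.ofReal_one,
    one_mul]

/-- Fibrewise in `l` this is the linear change of variables `volume_preimage_neg_mulVec`; the sign
of `l` does not affect Lebesgue measure. It is the measure-theoretic content of the Plancherel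
formula. -/
theorem measurePreserving_orbitMap (hβ : IsAdmissibleBasis β) :
    MeasurePreserving (orbitMap β) ((plancherelMeasure β).prod volume) volume := by
  refine ⟨measurable_orbitMap, Measure.ext fun s hs => ?_⟩
  rw [Measure.map_apply measurable_orbitMap hs, Measure.prod_apply (measurable_orbitMap hs),
    lintegral_plancherelMeasure (measurable_measure_prodMk_left (measurable_orbitMap hs)),
    Measure.volume_eq_prod, Measure.prod_apply hs,
    ← lintegral_neg_eq_self (fun l => volume (Prod.mk l ⁻¹' s))]
  refine lintegral_congr_ae ?_
  filter_upwards [ae_det_matB_ne_zero hβ] with l hl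
  exact volume_preimage_neg_mulVec hl (s := Prod.mk (-l) ⁻¹' s) (measurable_prodMk_left hs)

theorem ae_orbitMap_orbitMapInv (hβ : IsAdmissibleBasis β) :
    ∀ᵐ p, orbitMap β (orbitMapInv β p) = p := by
  have h1 : ∀ᵐ l : Fin r → ℝ, (matB β (-l)).det ≠ 0 :=
    (Measure.measurePreserving_neg volume).quasiMeasurePreserving.ae (ae_det_matB_ne_zero hβ)
  have h2 : ∀ᵐ p : (Fin r → ℝ) × (Fin d → ℝ), (matB β (-p.1)).det ≠ 0 :=
    Measure.quasiMeasurePreserving_fst.ae h1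
  filter_upwards [h2] with p hp
  exact orbitMap_orbitMapInv hp

theorem ae_orbitMapInv_orbitMap (hβ : IsAdmissibleBasis β) :
    ∀ᵐ p ∂((plancherelMeasure β).prod volume), orbitMapInv β (orbitMap β p) = p := by
  have h2 : ∀ᵐ p ∂((plancherelMeasure β).prod (volume : Measure (Fin d → ℝ))),
      (matB β p.1).det ≠ 0 :=
    Measure.quasiMeasurePreserving_fst.ae
      ((ae_plancherelMeasure_iff hβ).2 (ae_det_matB_ne_zero hβ))
  filter_upwards [h2] with p hp
  exact orbitMapInv_orbitMap hp

theorem measurePreserving_orbitMapInv (hβ : IsAdmissibleBasis β) :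
    MeasurePreserving (orbitMapInv β) volume ((plancherelMeasure β).prod volume) := by
  refine ⟨measurable_orbitMapInv, ?_⟩
  rw [← (measurePreserving_orbitMap hβ).map_eq,
    Measure.map_map measurable_orbitMapInv measurable_orbitMap,
    Measure.map_congr (f := orbitMapInv β ∘ orbitMap β) (g := id) (ae_orbitMapInv_orbitMap hβ),
    Measure.map_id]

end Structure

/-! ### Hilbert–Schmidt operators given by kernels -/

section HSOperators

variable {d : ℕ}

/-- The Fourier transform of `L²(ℝ^d)`. -/
def fourierV (d : ℕ) : L2R d ≃ₗᵢ[ℂ] L2R d :=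
  fourierX (MeasurableEquiv.toLp 2 (Fin d → ℝ))
    (EuclideanSpace.volume_preserving_symm_measurableEquiv_toLp (Fin d)).symm

theorem fourierV_coeFn (f : L2R d) (hf : Integrable f) :
    (fourierV d f : (Fin d → ℝ) → ℂ) =ᵐ[volume] fun t =>
      ∫ s, Complex.exp (-2 * Real.pi * Complex.I * ((t ⬝ᵥ s : ℝ) : ℂ)) * f s := by
  refine (fourierX_coeFn _ _ f hf).trans (ae_of_all _ fun t => ?_)
  simp [EuclideanSpace.inner_toLp_toLp]

/-- The operator on `L²(ℝ^d)` whose composition with the Fourier transform has kernel `κ`. -/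
def hsOp (κ : (Fin d → ℝ) × (Fin d → ℝ) → ℂ) : L2R d →L[ℂ] L2R d :=
  kerOp volume volume κ ∘L ((fourierV d).symm : L2R d →L[ℂ] L2R d)

theorem hsOp_apply (κ : (Fin d → ℝ) × (Fin d → ℝ) → ℂ) (u : L2R d) :
    hsOp κ u = kerOp volume volume κ ((fourierV d).symm u) := rfl

theorem hsOp_coeFn {κ : (Fin d → ℝ) × (Fin d → ℝ) → ℂ} (hκ : MemLp κ 2 volume) (u : L2R d) :
    (hsOp κ u : (Fin d → ℝ) → ℂ) =ᵐ[volume]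
      fun t => ∫ s, κ (t, s) * (fourierV d).symm u s :=
  kerOp_coeFn hκ _

theorem hsOp_congr {κ κ' : (Fin d → ℝ) × (Fin d → ℝ) → ℂ} (h : κ =ᵐ[volume] κ') :
    hsOp κ = hsOp κ' := by
  rw [hsOp, hsOp, kerOp_congr h]

theorem hsOp_sub {κ κ' : (Fin d → ℝ) × (Fin d → ℝ) → ℂ} (hκ : MemLp κ 2 volume)
    (hκ' : MemLp κ' 2 volume) : hsOp (κ - κ') = hsOp κ - hsOp κ' := by
  rw [hsOp, kerOp_sub hκ hκ', ContinuousLinearMap.sub_comp]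
  rfl

theorem enorm_hsOp_sq_le {κ : (Fin d → ℝ) × (Fin d → ℝ) → ℂ} (hκ : MemLp κ 2 volume)
    (u : L2R d) : ‖hsOp κ u‖ₑ ^ 2 ≤ (∫⁻ p, ‖κ p‖ₑ ^ 2) * ‖u‖ₑ ^ 2 := by
  rw [hsOp_apply]
  refine (enorm_kerOp_sq_le hκ _).trans (le_of_eq ?_)
  have h : ‖(fourierV d).symm u‖ₑ = ‖u‖ₑ := by
    rw [← ofReal_norm, LinearIsometryEquiv.norm_map, ofReal_norm]
  rw [h]
  rfl

/-- The index set of the chosen Hilbert basis of `L²(ℝ^d)`. -/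
def BasisIndex (d : ℕ) : Type := ((exists_hilbertBasis ℂ (L2R d)).choose : Set (L2R d))

/-- The chosen Hilbert basis of `L²(ℝ^d)`. -/
def stdBasis (d : ℕ) : HilbertBasis (BasisIndex d) ℂ (L2R d) :=
  (exists_hilbertBasis ℂ (L2R d)).choose_spec.choose

instance : Countable (BasisIndex d) := countable_of_orthonormal (stdBasis d).orthonormal

theorem hsNormSq_eq (T : L2R d →L[ℂ] L2R d) : hsNormSq T = ∑' i, ‖T (stdBasis d i)‖ₑ ^ 2 := rfl

/-- The inverse Fourier transform carries the chosen Hilbert basis to another Hilbert basis, and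
`tsum_enorm_kerOp_sq` holds for every basis. -/
theorem hsNormSq_hsOp {κ : (Fin d → ℝ) × (Fin d → ℝ) → ℂ} (hκ : MemLp κ 2 volume) :
    hsNormSq (hsOp κ) = ∫⁻ p, ‖κ p‖ₑ ^ 2 := by
  set b : HilbertBasis (BasisIndex d) ℂ (L2R d) :=
    HilbertBasis.ofRepr ((fourierV d).trans (stdBasis d).repr) with hb
  have hbi : ∀ i, b i = (fourierV d).symm (stdBasis d i) := fun i => by
    classical
    rw [← b.repr_symm_single, ← (stdBasis d).repr_symm_single]
    rfl
  have h := tsum_enorm_kerOp_sq b (hκ : MemLp κ 2 (volume.prod volume))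
  simp only [hbi] at h
  exact h

theorem ext_stdBasis {T T' : L2R d →L[ℂ] L2R d} (h : ∀ i, T (stdBasis d i) = T' (stdBasis d i)) :
    T = T' := by
  refine ContinuousLinearMap.ext_on (s := Set.range (stdBasis d)) ?_ ?_
  · exact Submodule.dense_iff_topologicalClosure_eq_top.2 (stdBasis d).dense_span
  · rintro _ ⟨i, rfl⟩
    exact h i

theorem eq_zero_of_hsNormSq_eq_zero {T : L2R d →L[ℂ] L2R d} (h : hsNormSq T = 0) : T = 0 := by
  rw [hsNormSq_eq, ENNReal.tsum_eq_zero] at h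
  refine ext_stdBasis fun i => ?_
  simpa using h i

theorem hsNormSq_add_le (S T : L2R d →L[ℂ] L2R d) :
    hsNormSq (S + T) ≤ 2 * hsNormSq S + 2 * hsNormSq T := by
  rw [hsNormSq_eq, hsNormSq_eq, hsNormSq_eq, ← ENNReal.tsum_mul_left, ← ENNReal.tsum_mul_left,
    ← ENNReal.tsum_add]
  refine ENNReal.tsum_le_tsum fun i => ?_
  have h1 : ‖(S + T) (stdBasis d i)‖ₑ ≤ ‖S (stdBasis d i)‖ₑ + ‖T (stdBasis d i)‖ₑ :=
    enorm_add_le _ _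
  refine (pow_le_pow_left₀ zero_le h1 2).trans ?_
  have h2 := ENNReal.rpow_add_le_mul_rpow_add_rpow ‖S (stdBasis d i)‖ₑ ‖T (stdBasis d i)‖ₑ
    (p := 2) one_le_two
  have h3 : (2 : ℝ≥0∞) ^ ((2 : ℝ) - 1) = 2 := by norm_num
  rw [h3] at h2
  simpa [← mul_add] using h2

theorem hsNormSq_neg (T : L2R d →L[ℂ] L2R d) : hsNormSq (-T) = hsNormSq T := by
  simp [hsNormSq_eq]

end HSOperators

/-! ### Measurable fields of operators on `L²(ℝ^d)` -/

section MeasurableFields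

variable {r d : ℕ} {T : (Fin r → ℝ) → L2R d →L[ℂ] L2R d}

theorem IsMeasurableField.stronglyMeasurable (hT : IsMeasurableField T) (v : L2R d) :
    StronglyMeasurable fun l => T l v :=
  stronglyMeasurable_of_inner fun u => hT u v

theorem IsMeasurableField.measurable_enorm (hT : IsMeasurableField T) (v : L2R d) :
    Measurable fun l => ‖T l v‖ₑ :=
  (hT.stronglyMeasurable v).enorm

theorem IsMeasurableField.measurable_hsNormSq (hT : IsMeasurableField T) :
    Measurable fun l => hsNormSq (T l) := by
  simp only [hsNormSq_eq]
  exact Measurable.tsum fun i => (hT.measurable_enorm _).pow_const 2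

theorem IsMeasurableField.sub {T' : (Fin r → ℝ) → L2R d →L[ℂ] L2R d} (hT : IsMeasurableField T)
    (hT' : IsMeasurableField T') : IsMeasurableField fun l => T l - T' l := fun u v => by
  simp only [sub_apply, inner_sub_right]
  exact (hT u v).sub (hT' u v)

/-- A measurable function on `ℝ^r × ℝ^d × ℝ^d` defines a measurable field of operators. -/
theorem isMeasurableField_hsOp {k : (Fin r → ℝ) × ((Fin d → ℝ) × (Fin d → ℝ)) → ℂ}
    (hk : Measurable k) : IsMeasurableField fun l => hsOp fun p => k (l, p) := by
  classical
  intro u v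
  set w := (fourierV d).symm v with hw
  have hslice : ∀ l, Measurable fun p => k (l, p) := fun l => hk.comp measurable_prodMk_left
  -- The parameters with square integrable slice. On `S` the matrix coefficient is an iterated
  -- integral, off `S` the operator is zero by convention.
  set S : Set (Fin r → ℝ) := {l | ∫⁻ p, ‖k (l, p)‖ₑ ^ 2 < ∞} with hS
  have hSm : MeasurableSet S :=
    measurableSet_lt ((hk.enorm.pow_const 2).lintegral_prod_right') measurable_const
  have hmem : ∀ l, MemLp (fun p => k (l, p)) 2 volume ↔ l ∈ S := fun l =>
    memLp_two_iff (hslice l).aestronglyMeasurable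
  have heq : ∀ l, inner ℂ u (hsOp (fun p => k (l, p)) v) =
      S.indicator (fun l => ∫ t, star (u t) * ∫ s, k (l, (t, s)) * w s) l := fun l => by
    by_cases hl : l ∈ S
    · rw [Set.indicator_of_mem hl, hsOp_apply]
      exact inner_kerOp ((hmem l).2 hl) w u
    · rw [Set.indicator_of_notMem hl, hsOp_apply,
        kerOp_of_not_memLp (μ := volume) (ν := volume) (mt (hmem l).1 hl)]
      simp
  simp only [heq]
  refine Measurable.indicator ?_ hSm
  have h1 : StronglyMeasurable fun q : (Fin r → ℝ) × (Fin d → ℝ) =>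
      ∫ s, k (q.1, (q.2, s)) * w s := by
    refine StronglyMeasurable.integral_prod_right
      (f := fun (q : (Fin r → ℝ) × (Fin d → ℝ)) s => k (q.1, (q.2, s)) * w s) ?_
    refine Measurable.stronglyMeasurable ?_
    exact (hk.comp (by fun_prop : Measurable
      fun x : ((Fin r → ℝ) × (Fin d → ℝ)) × (Fin d → ℝ) => (x.1.1, (x.1.2, x.2)))).mul
        ((Lp.stronglyMeasurable w).measurable.comp measurable_snd)
  have h2 : StronglyMeasurable fun q : (Fin r → ℝ) × (Fin d → ℝ) =>
      star (u q.2) * ∫ s, k (q.1, (q.2, s)) * w s :=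
    (((Lp.stronglyMeasurable u).comp_measurable measurable_snd).star).mul h1
  exact (h2.integral_prod_right').measurable

end MeasurableFields

/-! ### The kernel transform and left translation -/

section Transform

variable {r d : ℕ} {𝔫 : Type*} [LieRing 𝔫] [LieAlgebra ℝ 𝔫]
  {β : Module.Basis (Fin r ⊕ Fin d ⊕ Fin d) ℝ 𝔫}

instance : SigmaFinite (volume : Measure (NilGroup β)) :=
  inferInstanceAs (SigmaFinite (volume : Measure ((Fin r → ℝ) × (Fin d → ℝ) × (Fin d → ℝ))))

theorem measurable_z : Measurable (NilGroup.z : NilGroup β → _) :=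
  (measurable_fst : Measurable (Prod.fst : (Fin r → ℝ) × (Fin d → ℝ) × (Fin d → ℝ) → _))

theorem measurable_y : Measurable (NilGroup.y : NilGroup β → _) :=
  (measurable_fst.comp measurable_snd : Measurable
    fun p : (Fin r → ℝ) × (Fin d → ℝ) × (Fin d → ℝ) => p.2.1)

theorem measurable_x : Measurable (NilGroup.x : NilGroup β → _) :=
  (measurable_snd.comp measurable_snd : Measurable
    fun p : (Fin r → ℝ) × (Fin d → ℝ) × (Fin d → ℝ) => p.2.2)

/-! ### The Plancherel transform as an isometry onto a space of kernels -/

/-- The group as a Euclidean space. -/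
def groupEquiv (β : Module.Basis (Fin r ⊕ Fin d ⊕ Fin d) ℝ 𝔫) : NilGroup β ≃ᵐ
    WithLp 2 (EuclideanSpace ℝ (Fin r) ×
      WithLp 2 (EuclideanSpace ℝ (Fin d) × EuclideanSpace ℝ (Fin d))) :=
  (MeasurableEquiv.prodCongr (MeasurableEquiv.toLp 2 (Fin r → ℝ))
    ((MeasurableEquiv.prodCongr (MeasurableEquiv.toLp 2 (Fin d → ℝ))
      (MeasurableEquiv.toLp 2 (Fin d → ℝ))).trans (MeasurableEquiv.toLp 2 _))).trans
        (MeasurableEquiv.toLp 2 _)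

theorem measurePreserving_groupEquiv : MeasurePreserving (groupEquiv β) := by
  have h : ∀ n, MeasurePreserving (MeasurableEquiv.toLp 2 (Fin n → ℝ)) := fun n =>
    (EuclideanSpace.volume_preserving_symm_measurableEquiv_toLp (Fin n)).symm
  exact (WithLp.volume_preserving_toLp _ _).comp
    ((h r).prod ((WithLp.volume_preserving_toLp _ _).comp ((h d).prod (h d))))

theorem inner_groupEquiv (g h : NilGroup β) : inner ℝ (groupEquiv β g) (groupEquiv β h) =
    g.z ⬝ᵥ h.z + g.y ⬝ᵥ h.y + g.x ⬝ᵥ h.x := by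
  change h.z ⬝ᵥ star g.z + (h.y ⬝ᵥ star g.y + h.x ⬝ᵥ star g.x) = _
  simp only [star_trivial, dotProduct_comm, add_assoc]

/-- The measure for the kernels of fields of Hilbert–Schmidt operators. -/
abbrev fieldMeasure (β : Module.Basis (Fin r ⊕ Fin d ⊕ Fin d) ℝ 𝔫) :
    Measure ((Fin r → ℝ) × ((Fin d → ℝ) × (Fin d → ℝ))) :=
  (plancherelMeasure β).prod volume

/-- The point of the dual of the Lie algebra corresponding to an entry of a kernel. -/
def kernelPoint (β : Module.Basis (Fin r ⊕ Fin d ⊕ Fin d) ℝ 𝔫)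
    (p : (Fin r → ℝ) × ((Fin d → ℝ) × (Fin d → ℝ))) : NilGroup β :=
  NilGroup.mk (orbitMap β (p.1, p.2.1)).1 (orbitMap β (p.1, p.2.1)).2 (-p.2.2)

/-- The almost everywhere inverse of `kernelPoint`. -/
def kernelPointInv (β : Module.Basis (Fin r ⊕ Fin d ⊕ Fin d) ℝ 𝔫) (g : NilGroup β) :
    (Fin r → ℝ) × ((Fin d → ℝ) × (Fin d → ℝ)) :=
  ((orbitMapInv β (g.z, g.y)).1, ((orbitMapInv β (g.z, g.y)).2, -g.x))

theorem measurePreserving_kernelPoint (hβ : IsAdmissibleBasis β) :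
    MeasurePreserving (kernelPoint β) (fieldMeasure β) volume :=
  (measurePreserving_prodAssoc volume volume volume).comp
    (((measurePreserving_orbitMap hβ).prod (Measure.measurePreserving_neg volume)).comp
      ((measurePreserving_prodAssoc (plancherelMeasure β) volume volume).symm
        MeasurableEquiv.prodAssoc))

theorem measurePreserving_kernelPointInv (hβ : IsAdmissibleBasis β) :
    MeasurePreserving (kernelPointInv β) volume (fieldMeasure β) :=
  (measurePreserving_prodAssoc (plancherelMeasure β) volume volume).comp
    (((measurePreserving_orbitMapInv hβ).prod (Measure.measurePreserving_neg volume)).comp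
      ((measurePreserving_prodAssoc volume volume volume).symm MeasurableEquiv.prodAssoc))

theorem ae_kernelPointInv_kernelPoint (hβ : IsAdmissibleBasis β) :
    ∀ᵐ p ∂(fieldMeasure β), kernelPointInv β (kernelPoint β p) = p := by
  have h2 : ∀ᵐ p ∂(fieldMeasure β), (matB β p.1).det ≠ 0 :=
    Measure.quasiMeasurePreserving_fst.ae
      ((ae_plancherelMeasure_iff hβ).2 (ae_det_matB_ne_zero hβ))
  filter_upwards [h2] with p hp
  have h := orbitMapInv_orbitMap (p := (p.1, p.2.1)) hp
  have h' : orbitMapInv β ((kernelPoint β p).z, (kernelPoint β p).y) = (p.1, p.2.1) := h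
  simp only [kernelPointInv, h']
  exact Prod.ext rfl (Prod.ext rfl (neg_neg _))

theorem norm_exp_two_pi_I (x : ℝ) : ‖Complex.exp (2 * Real.pi * Complex.I * (x : ℂ))‖ = 1 := by
  have : 2 * Real.pi * Complex.I * (x : ℂ) = ((2 * Real.pi * x : ℝ) : ℂ) * Complex.I := by
    push_cast
    ring
  rw [this, Complex.norm_exp_ofReal_mul_I]

theorem measurable_dotProduct {X : Type*} [MeasurableSpace X] {n : ℕ} {v w : X → Fin n → ℝ}
    (hv : Measurable v) (hw : Measurable w) : Measurable fun x => v x ⬝ᵥ w x := by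
  unfold dotProduct
  fun_prop

theorem measurable_exp_two_pi_I {X : Type*} [MeasurableSpace X] {f : X → ℝ} (hf : Measurable f) :
    Measurable fun x => Complex.exp (2 * Real.pi * Complex.I * (f x : ℂ)) := by
  fun_prop

theorem measurable_phase {X : Type*} [MeasurableSpace X] {l z : X → Fin r → ℝ}
    {t y : X → Fin d → ℝ} (hl : Measurable l) (ht : Measurable t) (hz : Measurable z)
    (hy : Measurable y) : Measurable fun x => l x ⬝ᵥ z x + t x ⬝ᵥ (matB β (l x) *ᵥ y x) := by
  have h : ∀ i j, Measurable fun x => matB β (l x) i j := fun i j =>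
    (measurable_matB_apply (β := β) i j).comp hl
  exact (measurable_dotProduct hl hz).add
    (measurable_dotProduct ht (measurable_matrix_mulVec h hy))

/-- The isometry of `L²(N)` onto the space of square integrable fields of kernels that implements
the Plancherel transform. -/
def kernelTransform (hβ : IsAdmissibleBasis β) : L2N β ≃ₗᵢ[ℂ] Lp ℂ 2 (fieldMeasure β) :=
  (fourierX (groupEquiv β) measurePreserving_groupEquiv).trans
    ((compEquiv (kernelPoint β) (measurePreserving_kernelPoint hβ) (kernelPointInv β)
      (measurePreserving_kernelPointInv hβ) (ae_kernelPointInv_kernelPoint hβ)).trans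
        (unimodularEquiv
          (fun p => Complex.exp (2 * Real.pi * Complex.I * ((-(p.2.1 ⬝ᵥ p.2.2) : ℝ) : ℂ)))
          (measurable_exp_two_pi_I (measurable_dotProduct (by fun_prop) (by fun_prop)).neg)
          fun _ => norm_exp_two_pi_I _))

/-- The signs in `kernelPoint` and the factor exp(-2πi t·σ) are chosen for this: the right side is
the phase of `π_l(g)` at `t` times exp(-2πi σ·(t - x)), which is what `π_l(g)` composed with the
Fourier transform produces. -/
theorem exp_mul_exp_inner_kernelPoint (p : (Fin r → ℝ) × ((Fin d → ℝ) × (Fin d → ℝ)))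
    (g : NilGroup β) :
    Complex.exp (2 * Real.pi * Complex.I * ((-(p.2.1 ⬝ᵥ p.2.2) : ℝ) : ℂ)) *
      Complex.exp (-2 * Real.pi * Complex.I *
        ((inner ℝ (groupEquiv β g) (groupEquiv β (kernelPoint β p)) : ℝ) : ℂ)) =
    Complex.exp (2 * Real.pi * Complex.I * ((p.1 ⬝ᵥ g.z + p.2.1 ⬝ᵥ (matB β p.1 *ᵥ g.y) +
      (g.x - p.2.1) ⬝ᵥ p.2.2 : ℝ) : ℂ)) := by
  rw [← Complex.exp_add, inner_groupEquiv]
  have hz : g.z ⬝ᵥ (kernelPoint β p).z = -(p.1 ⬝ᵥ g.z) := by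
    change g.z ⬝ᵥ (-p.1) = _
    rw [dotProduct_neg, dotProduct_comm]
  have hy : g.y ⬝ᵥ (kernelPoint β p).y = -(p.2.1 ⬝ᵥ (matB β p.1 *ᵥ g.y)) := by
    change g.y ⬝ᵥ (-((matB β p.1)ᵀ *ᵥ p.2.1)) = _
    rw [dotProduct_neg, Matrix.mulVec_transpose, dotProduct_comm, Matrix.dotProduct_mulVec]
  have hx : g.x ⬝ᵥ (kernelPoint β p).x = -(g.x ⬝ᵥ p.2.2) := by
    change g.x ⬝ᵥ (-p.2.2) = _
    rw [dotProduct_neg]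
  rw [hz, hy, hx, sub_dotProduct]
  congr 1
  push_cast
  ring

theorem kernelTransform_coeFn (hβ : IsAdmissibleBasis β) (f : L2N β) (hf : Integrable f) :
    (kernelTransform hβ f : _ → ℂ) =ᵐ[fieldMeasure β] fun p =>
      ∫ g : NilGroup β, Complex.exp (2 * Real.pi * Complex.I *
        ((p.1 ⬝ᵥ g.z + p.2.1 ⬝ᵥ (matB β p.1 *ᵥ g.y) + (g.x - p.2.1) ⬝ᵥ p.2.2 : ℝ) : ℂ)) *
          f g := by
  have h1 := (measurePreserving_kernelPoint hβ).quasiMeasurePreserving.ae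
    (fourierX_coeFn (groupEquiv β) measurePreserving_groupEquiv f hf)
  have h2 := compEquiv_coeFn (kernelPoint β) (measurePreserving_kernelPoint hβ) (kernelPointInv β)
    (measurePreserving_kernelPointInv hβ) (ae_kernelPointInv_kernelPoint hβ)
    (fourierX (groupEquiv β) measurePreserving_groupEquiv f)
  have h3 := unimodularEquiv_coeFn (μ := fieldMeasure β)
    (fun p => Complex.exp (2 * Real.pi * Complex.I * ((-(p.2.1 ⬝ᵥ p.2.2) : ℝ) : ℂ)))
    (measurable_exp_two_pi_I (measurable_dotProduct (by fun_prop) (by fun_prop)).neg)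
    (fun _ => norm_exp_two_pi_I _)
    (compEquiv (kernelPoint β) (measurePreserving_kernelPoint hβ) (kernelPointInv β)
      (measurePreserving_kernelPointInv hβ) (ae_kernelPointInv_kernelPoint hβ)
      (fourierX (groupEquiv β) measurePreserving_groupEquiv f))
  filter_upwards [h1, h2, h3] with p h1 h2 h3
  refine h3.trans ?_
  rw [h2, h1, ← integral_const_mul]
  simp only [← mul_assoc, exp_mul_exp_inner_kernelPoint]

/-! ### The left regular representation -/

theorem leftRegular_coeFn (g : NilGroup β) (f : L2N β) :
    (leftRegular g f : NilGroup β → ℂ) =ᵐ[volume] fun h => f (g⁻¹ * h) :=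
  Lp.coeFn_compMeasurePreserving f (measurePreserving_mul_left g⁻¹)

theorem measurable_mul_left (g : NilGroup β) : Measurable fun h : NilGroup β => g * h :=
  (measurePreserving_mul_left g).measurable

theorem measurableEmbedding_mul_left (g : NilGroup β) :
    MeasurableEmbedding fun h : NilGroup β => g * h :=
  (MeasurableEquiv.mk (Equiv.mulLeft g) (measurable_mul_left g)
    (measurable_mul_left g⁻¹)).measurableEmbedding

/-- The translation of the variable `t` of a kernel. -/
def translateKernel (x : Fin d → ℝ) (p : (Fin r → ℝ) × ((Fin d → ℝ) × (Fin d → ℝ))) :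
    (Fin r → ℝ) × ((Fin d → ℝ) × (Fin d → ℝ)) :=
  (p.1, (p.2.1 - x, p.2.2))

theorem measurePreserving_translateKernel (x : Fin d → ℝ) :
    MeasurePreserving (translateKernel x) (fieldMeasure β) (fieldMeasure β) :=
  (MeasurePreserving.id _).prod
    ((measurePreserving_sub_right volume x).prod (MeasurePreserving.id volume))

/-- The phase factor of the representation `π_l`. -/
def repPhase (g : NilGroup β) (l : Fin r → ℝ) (t : Fin d → ℝ) : ℂ :=
  Complex.exp (2 * Real.pi * Complex.I * ((l ⬝ᵥ g.z + t ⬝ᵥ (matB β l *ᵥ g.y) : ℝ) : ℂ))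

theorem norm_repPhase (g : NilGroup β) (l : Fin r → ℝ) (t : Fin d → ℝ) : ‖repPhase g l t‖ = 1 :=
  norm_exp_two_pi_I _

theorem measurable_repPhase {X : Type*} [MeasurableSpace X] {g : X → NilGroup β}
    {l : X → Fin r → ℝ} {t : X → Fin d → ℝ} (hg : Measurable g) (hl : Measurable l)
    (ht : Measurable t) : Measurable fun x => repPhase (g x) (l x) (t x) :=
  measurable_exp_two_pi_I (measurable_phase (β := β) (l := l) (t := t) (z := fun x => (g x).z)
    (y := fun x => (g x).y) hl ht (measurable_z.comp hg) (measurable_y.comp hg))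

theorem measurable_repPhase_kernel (g : NilGroup β) :
    Measurable fun p : (Fin r → ℝ) × ((Fin d → ℝ) × (Fin d → ℝ)) => repPhase g p.1 p.2.1 :=
  measurable_repPhase (g := fun _ => g) measurable_const measurable_fst measurable_snd.fst

/-- The representation `π_l` on kernels. -/
def repKernel (g : NilGroup β) : Lp ℂ 2 (fieldMeasure β) →ₗᵢ[ℂ] Lp ℂ 2 (fieldMeasure β) :=
  (unimodularMul (μ := fieldMeasure β) (fun p => repPhase g p.1 p.2.1)
    (measurable_repPhase_kernel g) fun _ => norm_repPhase g _ _).comp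
      (Lp.compMeasurePreservingₗᵢ ℂ (translateKernel g.x) (measurePreserving_translateKernel g.x))

theorem repKernel_coeFn (g : NilGroup β) (k : Lp ℂ 2 (fieldMeasure β)) :
    (repKernel g k : _ → ℂ) =ᵐ[fieldMeasure β] fun p =>
      repPhase g p.1 p.2.1 * k (translateKernel g.x p) := by
  have h1 := Lp.coeFn_compMeasurePreserving k (measurePreserving_translateKernel (β := β) g.x)
  have h2 := unimodularMul_coeFn (μ := fieldMeasure β) (fun p => repPhase g p.1 p.2.1)
    (measurable_repPhase_kernel g) (fun _ => norm_repPhase g _ _)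
    (Lp.compMeasurePreserving (translateKernel g.x) (measurePreserving_translateKernel g.x) k)
  filter_upwards [h1, h2] with p h1 h2
  refine h2.trans ?_
  rw [h1, Function.comp_apply]

theorem leftRegular_eq (g : NilGroup β) (f : L2N β) : leftRegular g f =
    Lp.compMeasurePreservingₗᵢ ℂ (fun h : NilGroup β => g⁻¹ * h)
      (measurePreserving_mul_left g⁻¹) f := rfl

/-- The bracket term in the central coordinate of `g * h` is absorbed by replacing `t` with `t -
g.x` in the phase of `h`. This is the homomorphism property of `π_l` at the level of kernels. -/
theorem exp_mul_left (p : (Fin r → ℝ) × ((Fin d → ℝ) × (Fin d → ℝ))) (g h : NilGroup β) :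
    Complex.exp (2 * Real.pi * Complex.I * ((p.1 ⬝ᵥ (g * h).z +
      p.2.1 ⬝ᵥ (matB β p.1 *ᵥ (g * h).y) + ((g * h).x - p.2.1) ⬝ᵥ p.2.2 : ℝ) : ℂ)) =
    repPhase g p.1 p.2.1 *
      Complex.exp (2 * Real.pi * Complex.I * ((p.1 ⬝ᵥ h.z +
        (p.2.1 - g.x) ⬝ᵥ (matB β p.1 *ᵥ h.y) + (h.x - (p.2.1 - g.x)) ⬝ᵥ p.2.2 : ℝ) : ℂ)) := by
  rw [repPhase, ← Complex.exp_add]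
  have hz : p.1 ⬝ᵥ (g * h).z = p.1 ⬝ᵥ g.z + p.1 ⬝ᵥ h.z - g.x ⬝ᵥ (matB β p.1 *ᵥ h.y) := by
    change p.1 ⬝ᵥ (g.z + h.z + bracketXY β g.x h.y) = _
    rw [dotProduct_add, dotProduct_add, dotProduct_bracketXY, sub_eq_add_neg]
  have hy : (g * h).y = g.y + h.y := rfl
  have hx : (g * h).x = g.x + h.x := rfl
  rw [hz, hy, hx, Matrix.mulVec_add, dotProduct_add]
  simp only [sub_dotProduct, add_dotProduct]
  congr 1
  push_cast
  ring

/-- The kernel transform intertwines the left regular representation with the representations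
`π_l`. -/
theorem kernelTransform_leftRegular (hβ : IsAdmissibleBasis β) (g : NilGroup β) (f : L2N β) :
    kernelTransform hβ (leftRegular g f) = repKernel g (kernelTransform hβ f) := by
  -- Both sides are continuous in `f`, so it is enough to treat integrable `f`, for which the kernel
  -- is an honest integral.
  have hclosed : IsClosed {f : L2N β |
      kernelTransform hβ (leftRegular g f) = repKernel g (kernelTransform hβ f)} := by
    simp only [leftRegular_eq]
    exact isClosed_eq ((kernelTransform hβ).continuous.comp (LinearIsometry.continuous _))
      ((repKernel g).continuous.comp (kernelTransform hβ).continuous)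
  refine hclosed.closure_subset_iff.2 ?_ (dense_integrable_Lp f)
  intro f hf
  have hf : Integrable f volume := hf
  have hgf : Integrable (leftRegular g f) volume :=
    ((measurePreserving_mul_left g⁻¹).integrable_comp_of_integrable hf).congr
      (leftRegular_coeFn g f).symm
  refine Lp.ext ?_
  have h1 := kernelTransform_coeFn hβ _ hgf
  have h2 := repKernel_coeFn g (kernelTransform hβ f)
  have h3 := (measurePreserving_translateKernel (β := β) g.x).quasiMeasurePreserving.ae
    (kernelTransform_coeFn hβ f hf)
  filter_upwards [h1, h2, h3] with p h1 h2 h3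
  rw [h1, h2, h3, ← integral_const_mul]
  rw [← (measurePreserving_mul_left g).integral_comp (measurableEmbedding_mul_left g)]
  refine integral_congr_ae ?_
  filter_upwards [(measurePreserving_mul_left g).quasiMeasurePreserving.ae (leftRegular_coeFn g f)]
    with h hh
  rw [hh, inv_mul_cancel_left, exp_mul_left, mul_assoc]
  rfl

end Transform

section Plancherel

variable {r d : ℕ} {𝔫 : Type*} [LieRing 𝔫] [LieAlgebra ℝ 𝔫]
  {β : Module.Basis (Fin r ⊕ Fin d ⊕ Fin d) ℝ 𝔫}

/-! ### The group Fourier transform of integrable functions -/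

theorem measurable_repPhase_fiber (l : Fin r → ℝ) (g : NilGroup β) :
    Measurable fun t : Fin d → ℝ => repPhase g l t :=
  measurable_repPhase (g := fun _ => g) (l := fun _ => l) measurable_const measurable_const
    measurable_id

/-- The operator `π_l(g)` as a linear isometry. -/
def repIsometry (l : Fin r → ℝ) (g : NilGroup β) : L2R d →ₗᵢ[ℂ] L2R d :=
  (unimodularMul (μ := volume) (fun t => repPhase g l t) (measurable_repPhase_fiber l g)
    fun _ => norm_repPhase g l _).comp
      (Lp.compMeasurePreservingₗᵢ ℂ (fun t => t - g.x) (measurePreserving_sub_right volume g.x))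

theorem rep_coeFn (l : Fin r → ℝ) (g : NilGroup β) (u : L2R d) :
    (rep l g u : (Fin d → ℝ) → ℂ) =ᵐ[volume] fun t => repPhase g l t * u (t - g.x) :=
  (memLp_repFun l g u).coeFn_toLp

theorem rep_eq (l : Fin r → ℝ) (g : NilGroup β) (u : L2R d) : rep l g u = repIsometry l g u := by
  refine Lp.ext ((rep_coeFn l g u).trans ?_)
  have h1 := Lp.coeFn_compMeasurePreserving u (measurePreserving_sub_right volume g.x)
  have h2 := unimodularMul_coeFn (μ := volume) (fun t => repPhase g l t)
    (measurable_repPhase_fiber l g) (fun _ => norm_repPhase g l _)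
    (Lp.compMeasurePreserving (fun t => t - g.x) (measurePreserving_sub_right volume g.x) u)
  filter_upwards [h1, h2] with t h1 h2
  refine Eq.trans ?_ h2.symm
  rw [h1, Function.comp_apply]

theorem stronglyMeasurable_rep (l : Fin r → ℝ) (u : L2R d) :
    StronglyMeasurable fun g : NilGroup β => rep l g u := by
  refine stronglyMeasurable_of_inner fun v => ?_
  have h : ∀ g : NilGroup β, inner ℂ v (rep l g u) =
      ∫ t, star (v t) * (repPhase g l t * u (t - g.x)) := fun g => by
    rw [inner_eq_integral]
    refine integral_congr_ae ?_
    filter_upwards [rep_coeFn l g u] with t ht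
    rw [ht]
  simp only [h]
  refine (StronglyMeasurable.integral_prod_right
    (f := fun (g : NilGroup β) t => star (v t) * (repPhase g l t * u (t - g.x))) ?_).measurable
  refine Measurable.stronglyMeasurable ?_
  have h1 : Measurable fun p : NilGroup β × (Fin d → ℝ) => star ((v : (Fin d → ℝ) → ℂ) p.2) :=
    continuous_star.measurable.comp ((Lp.stronglyMeasurable v).measurable.comp measurable_snd)
  have h2 : Measurable fun p : NilGroup β × (Fin d → ℝ) => repPhase p.1 l p.2 :=
    measurable_repPhase (l := fun _ => l) measurable_fst measurable_const measurable_snd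
  have h3 : Measurable fun p : NilGroup β × (Fin d → ℝ) => (u : (Fin d → ℝ) → ℂ) (p.2 - p.1.x) :=
    (Lp.stronglyMeasurable u).measurable.comp
      (measurable_snd.sub (measurable_x.comp measurable_fst))
  exact h1.mul (h2.mul h3)

theorem integrable_smul_rep {f : NilGroup β → ℂ} (hf : Integrable f) (l : Fin r → ℝ)
    (u : L2R d) : Integrable fun g => f g • rep l g u := by
  refine (hf.norm.mul_const ‖u‖).mono'
    (hf.aestronglyMeasurable.smul (stronglyMeasurable_rep l u).aestronglyMeasurable)
    (ae_of_all _ fun g => ?_)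
  rw [norm_smul, rep_eq, LinearIsometry.norm_map]

theorem exists_isFourierTransformAt {f : NilGroup β → ℂ} (hf : Integrable f) (l : Fin r → ℝ) :
    ∃ T : L2R d →L[ℂ] L2R d, IsFourierTransformAt f l T := by
  refine ⟨LinearMap.mkContinuous
    { toFun := fun u => ∫ g, f g • rep l g u
      map_add' := fun u v => ?_
      map_smul' := fun c u => ?_ } (∫ g, ‖f g‖) fun u => ?_, fun u => rfl⟩
  · rw [← integral_add (integrable_smul_rep hf l u) (integrable_smul_rep hf l v)]
    simp only [rep_eq, map_add, smul_add]
  · rw [RingHom.id_apply, ← integral_smul]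
    simp only [rep_eq, map_smul, smul_comm c]
  · change ‖∫ g, f g • rep l g u‖ ≤ _
    refine (norm_integral_le_integral_norm _).trans (le_of_eq ?_)
    rw [← integral_mul_const]
    simp only [norm_smul, rep_eq, LinearIsometry.norm_map]

/-! ### The Plancherel transform in terms of kernels -/

/-- The field of Hilbert–Schmidt operators corresponding to `f ∈ L²(N)`. -/
def planOp (hβ : IsAdmissibleBasis β) (f : L2N β) (l : Fin r → ℝ) : L2R d →L[ℂ] L2R d :=
  hsOp fun p => kernelTransform hβ f (l, p)

theorem isMeasurableField_planOp (hβ : IsAdmissibleBasis β) (f : L2N β) :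
    IsMeasurableField (planOp hβ f) :=
  isMeasurableField_hsOp (Lp.stronglyMeasurable (kernelTransform hβ f)).measurable

theorem ae_memLp_kernel (hβ : IsAdmissibleBasis β) (f : L2N β) :
    ∀ᵐ l ∂(plancherelMeasure β), MemLp (fun p => kernelTransform hβ f (l, p)) 2 volume :=
  memLp_two_slice (Lp.memLp (kernelTransform hβ f))

/-- Fubini for f(g) conj(v(t)) s(σ) times a unimodular phase, absolutely integrable because all
three functions are. It exchanges the integral over the group with those over `t` and `σ`, and so
exhibits the kernel of the group Fourier transform. -/
theorem integral_exp_fourier_kernel {f : NilGroup β → ℂ} (hf : Integrable f) {s v : (Fin d → ℝ) → ℂ}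
    (hs : Integrable s) (hv : Integrable v) (l : Fin r → ℝ) :
    Integrable (fun p : (Fin d → ℝ) × (Fin d → ℝ) => star (v p.1) *
      ((∫ g : NilGroup β, Complex.exp (2 * Real.pi * Complex.I * ((l ⬝ᵥ g.z +
        p.1 ⬝ᵥ (matB β l *ᵥ g.y) + (g.x - p.1) ⬝ᵥ p.2 : ℝ) : ℂ)) * f g) * s p.2)) ∧
    ∫ g, f g * ∫ t, star (v t) * (repPhase g l t *
        ∫ σ, Complex.exp (-2 * Real.pi * Complex.I * ((σ ⬝ᵥ (t - g.x) : ℝ) : ℂ)) * s σ) =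
    ∫ p : (Fin d → ℝ) × (Fin d → ℝ), star (v p.1) *
      ((∫ g : NilGroup β, Complex.exp (2 * Real.pi * Complex.I * ((l ⬝ᵥ g.z +
        p.1 ⬝ᵥ (matB β l *ᵥ g.y) + (g.x - p.1) ⬝ᵥ p.2 : ℝ) : ℂ)) * f g) * s p.2) := by
  set E : NilGroup β → (Fin d → ℝ) × (Fin d → ℝ) → ℂ := fun g p =>
    Complex.exp (2 * Real.pi * Complex.I * ((l ⬝ᵥ g.z +
        p.1 ⬝ᵥ (matB β l *ᵥ g.y) + (g.x - p.1) ⬝ᵥ p.2 : ℝ) : ℂ)) with hE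
  have hEm : Measurable fun q : NilGroup β × ((Fin d → ℝ) × (Fin d → ℝ)) => E q.1 q.2 := by
    have h1 : Measurable fun q : NilGroup β × ((Fin d → ℝ) × (Fin d → ℝ)) =>
        l ⬝ᵥ q.1.z + q.2.1 ⬝ᵥ (matB β l *ᵥ q.1.y) :=
      measurable_phase (β := β) (X := NilGroup β × ((Fin d → ℝ) × (Fin d → ℝ))) (l := fun _ => l)
        (t := fun q => q.2.1) (z := fun q => q.1.z) (y := fun q => q.1.y)
        measurable_const (measurable_fst.comp measurable_snd)
        (measurable_z.comp measurable_fst) (measurable_y.comp measurable_fst)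
    have h2 : Measurable fun q : NilGroup β × ((Fin d → ℝ) × (Fin d → ℝ)) =>
        (q.1.x - q.2.1) ⬝ᵥ q.2.2 :=
      measurable_dotProduct ((measurable_x.comp measurable_fst).sub
        (measurable_fst.comp measurable_snd)) (measurable_snd.comp measurable_snd)
    exact measurable_exp_two_pi_I (h1.add h2)
  have hEn : ∀ g p, ‖E g p‖ = 1 := fun g p => norm_exp_two_pi_I _
  set H : NilGroup β → (Fin d → ℝ) × (Fin d → ℝ) → ℂ := fun g p =>
    E g p * (f g * (star (v p.1) * s p.2)) with hH
  have hv' : Integrable fun t => star (v t) :=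
    hv.mono (continuous_star.comp_aestronglyMeasurable hv.1) (ae_of_all _ fun t => by simp)
  have hHi : Integrable (Function.uncurry H) (volume.prod volume) := by
    have h1 : Integrable (fun q : NilGroup β × ((Fin d → ℝ) × (Fin d → ℝ)) =>
        f q.1 * (star (v q.2.1) * s q.2.2)) (volume.prod volume) :=
      hf.mul_prod (Integrable.mul_prod (f := fun t => star (v t)) hv' hs)
    exact h1.bdd_mul (c := 1) hEm.aestronglyMeasurable (ae_of_all _ fun q => (hEn _ _).le)
  have hswap := integral_integral_swap hHi
  have hrhs : ∀ p, ∫ g, H g p = star (v p.1) * ((∫ g, E g p * f g) * s p.2) := fun p => by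
    rw [← integral_mul_const, ← integral_const_mul]
    congr with g
    simp only [hH]
    ring
  refine ⟨hHi.integral_prod_right.congr (ae_of_all _ hrhs), ?_⟩
  calc _ = ∫ g, ∫ p, H g p := by
        refine integral_congr_ae ?_
        filter_upwards [hHi.prod_right_ae] with g hg
        have hg' : Integrable (H g) (volume.prod volume) := hg
        rw [Measure.volume_eq_prod, integral_prod _ hg', ← integral_const_mul]
        congr with t
        rw [← integral_const_mul, ← integral_const_mul, ← integral_const_mul]
        congr with σ
        have h3 : repPhase g l t *
            Complex.exp (-2 * Real.pi * Complex.I * ((σ ⬝ᵥ (t - g.x) : ℝ) : ℂ)) = E g (t, σ) := by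
          rw [repPhase, ← Complex.exp_add, hE]
          congr 1
          rw [dotProduct_comm σ, sub_dotProduct, sub_dotProduct]
          push_cast
          ring
        simp only [hH, ← h3]
        ring
    _ = ∫ p, ∫ g, H g p := hswap
    _ = _ := by simp only [hrhs, hE]

/-- Operators are compared weakly: against integrable `v`, and on vectors u = `F` s with `s`
integrable. Both families are dense, and on them the Fourier integral and Fubini's theorem apply. -/
theorem integral_smul_rep_eq_planOp (hβ : IsAdmissibleBasis β) (f : L2N β) (hf : Integrable f) :
    ∀ᵐ l ∂(plancherelMeasure β), ∀ S, IsFourierTransformAt f l S → S = planOp hβ f l := by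
  filter_upwards [ae_memLp_kernel hβ f, Measure.ae_ae_of_ae_prod (kernelTransform_coeFn hβ f hf)]
    with l hmem hker S hS
  have hdense : Dense ((fourierV d) '' {s : L2R d | Integrable s}) :=
    (fourierV d).surjective.denseRange.dense_image (fourierV d).continuous dense_integrable_Lp
  refine ContinuousLinearMap.ext fun u => ?_
  refine hdense.induction (P := fun u => S u = planOp hβ f l u) ?_
    (isClosed_eq S.continuous (planOp hβ f l).continuous) u
  rintro _ ⟨s, hs, rfl⟩
  have hs : Integrable s := hs
  set u := fourierV d s with hu
  refine Dense.eq_of_inner_right (𝕜 := ℂ)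
    (dense_integrable_Lp (μ := (volume : Measure (Fin d → ℝ)))) fun v hv => ?_
  have hv : Integrable v := hv
  obtain ⟨hint, heq⟩ := integral_exp_fourier_kernel hf hs hv l
  have hker' : ∀ᵐ p : (Fin d → ℝ) × (Fin d → ℝ), star (v p.1) *
      ((∫ g : NilGroup β, Complex.exp (2 * Real.pi * Complex.I * ((l ⬝ᵥ g.z +
        p.1 ⬝ᵥ (matB β l *ᵥ g.y) + (g.x - p.1) ⬝ᵥ p.2 : ℝ) : ℂ)) * f g) * s p.2) =
      star (v p.1) * (kernelTransform hβ f (l, p) * s p.2) := by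
    filter_upwards [hker] with p hp
    rw [hp]
  calc inner ℂ v (S u) = ∫ g, inner ℂ v (f g • rep l g u) := by
        rw [hS u]
        exact ((innerSL ℂ v).integral_comp_comm (integrable_smul_rep hf l u)).symm
    _ = ∫ g, f g * ∫ t, star (v t) * (repPhase g l t *
        ∫ σ, Complex.exp (-2 * Real.pi * Complex.I * ((σ ⬝ᵥ (t - g.x) : ℝ) : ℂ)) * s σ) := by
        congr with g
        rw [inner_smul_right, inner_eq_integral]
        congr 1
        refine integral_congr_ae ?_
        filter_upwards [rep_coeFn l g u, (measurePreserving_sub_right volume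
          g.x).quasiMeasurePreserving.ae (fourierV_coeFn s hs)] with t h1 h2
        rw [h1, hu, h2]
        simp only [dotProduct_comm (t - g.x)]
    _ = ∫ p : (Fin d → ℝ) × (Fin d → ℝ), star (v p.1) *
          (kernelTransform hβ f (l, p) * s p.2) := by
        rw [heq]
        exact integral_congr_ae hker'
    _ = inner ℂ v (planOp hβ f l u) := by
        rw [planOp, hsOp_apply, hu, LinearIsometryEquiv.symm_apply_apply]
        rw [inner_kerOp (μ := volume) (ν := volume) hmem, Measure.volume_eq_prod,
          integral_prod _ (hint.congr hker')]
        simp only [integral_const_mul]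

/-- The Plancherel formula: `kernelTransform` is isometric, and fibrewise the squared `L²` norm of
the kernel is the squared Hilbert–Schmidt norm of the operator. -/
theorem lintegral_hsNormSq_planOp_sub (hβ : IsAdmissibleBasis β) (f f' : L2N β) :
    ∫⁻ l, hsNormSq (planOp hβ f l - planOp hβ f' l) ∂(plancherelMeasure β) = ‖f - f'‖ₑ ^ 2 := by
  have h1 : ‖f - f'‖ₑ = ‖kernelTransform hβ (f - f')‖ₑ := by
    rw [← ofReal_norm, ← ofReal_norm, LinearIsometryEquiv.norm_map]
  rw [h1, enorm_sq_eq_lintegral,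
    lintegral_enorm_sq_prod (Lp.aestronglyMeasurable (kernelTransform hβ (f - f')))]
  refine lintegral_congr_ae ?_
  have h2 := Lp.coeFn_sub (kernelTransform hβ f) (kernelTransform hβ f')
  rw [← map_sub] at h2
  filter_upwards [ae_memLp_kernel hβ f, ae_memLp_kernel hβ f', Measure.ae_ae_of_ae_prod h2]
    with l h3 h4 h5
  rw [planOp, planOp, ← hsOp_sub h3 h4, hsNormSq_hsOp (h3.sub h4)]
  refine lintegral_congr_ae ?_
  filter_upwards [h5] with p hp
  rw [hp]
  rfl

theorem isPlancherelTransform_planOp (hβ : IsAdmissibleBasis β) (f : L2N β) :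
    IsPlancherelTransform f (planOp hβ f) := by
  obtain ⟨f', hf', hlim⟩ := mem_closure_iff_seq_limit.1 (dense_integrable_Lp f)
  choose S hS using fun k l => exists_isFourierTransformAt (hf' k) l
  refine ⟨isMeasurableField_planOp hβ f, f', S, hf', hlim, hS, ?_⟩
  have h1 : ∀ k, ∫⁻ l, hsNormSq (S k l - planOp hβ f l) ∂(plancherelMeasure β) =
      ‖f' k - f‖ₑ ^ 2 := fun k => by
    rw [← lintegral_hsNormSq_planOp_sub hβ]
    refine lintegral_congr_ae ?_
    filter_upwards [integral_smul_rep_eq_planOp hβ (f' k) (hf' k)] with l hl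
    rw [hl _ (hS k l)]
  simp only [h1]
  have h2 : Tendsto (fun k => ‖f' k - f‖ₑ) atTop (𝓝 0) := by
    simpa [edist_eq_enorm_sub] using tendsto_iff_edist_tendsto_0.1 hlim
  simpa using ENNReal.Tendsto.pow (n := 2) h2

/-- The approximating Fourier transforms converge both to `T` and, by the Plancherel formula, to
`planOp`. The squared distance between the two limits is therefore zero for almost every `l`. -/
theorem IsPlancherelTransform.ae_eq (hβ : IsAdmissibleBasis β) {f : L2N β}
    {T : (Fin r → ℝ) → L2R d →L[ℂ] L2R d} (hT : IsPlancherelTransform f T) :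
    ∀ᵐ l ∂(plancherelMeasure β), T l = planOp hβ f l := by
  obtain ⟨hTm, f', S, hf', hlim, hS, hTlim⟩ := hT
  have hm := (hTm.sub (isMeasurableField_planOp hβ f)).measurable_hsNormSq
  have hle : ∀ k, ∫⁻ l, hsNormSq (T l - planOp hβ f l) ∂(plancherelMeasure β) ≤
      2 * ∫⁻ l, hsNormSq (S k l - T l) ∂(plancherelMeasure β) + 2 * ‖f' k - f‖ₑ ^ 2 := fun k => by
    have h2 := ((isMeasurableField_planOp hβ (f' k)).sub
      (isMeasurableField_planOp hβ f)).measurable_hsNormSq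
    rw [← lintegral_hsNormSq_planOp_sub hβ, ← lintegral_const_mul' _ _ (by simp),
      ← lintegral_const_mul' _ _ (by simp), ← lintegral_add_right _ (h2.const_mul 2)]
    refine lintegral_mono_ae ?_
    filter_upwards [integral_smul_rep_eq_planOp hβ (f' k) (hf' k)] with l hl
    rw [← hl _ (hS k l)]
    have h3 : T l - planOp hβ f l = -(S k l - T l) + (S k l - planOp hβ f l) := by abel
    rw [h3]
    refine (hsNormSq_add_le _ _).trans ?_
    rw [hsNormSq_neg]
  have h2 : Tendsto (fun k => ‖f' k - f‖ₑ) atTop (𝓝 0) := by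
    simpa [edist_eq_enorm_sub] using tendsto_iff_edist_tendsto_0.1 hlim
  have h3 : Tendsto (fun k => 2 * ∫⁻ l, hsNormSq (S k l - T l) ∂(plancherelMeasure β) +
      2 * ‖f' k - f‖ₑ ^ 2) atTop (𝓝 0) := by
    have h4 := ENNReal.Tendsto.const_mul (a := 2) hTlim (Or.inr ENNReal.ofNat_ne_top)
    have h5 := ENNReal.Tendsto.const_mul (a := 2) (ENNReal.Tendsto.pow (n := 2) h2)
      (Or.inr ENNReal.ofNat_ne_top)
    simpa using h4.add h5
  have h0 : ∫⁻ l, hsNormSq (T l - planOp hβ f l) ∂(plancherelMeasure β) = 0 :=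
    le_antisymm (ge_of_tendsto' h3 hle) zero_le
  filter_upwards [(lintegral_eq_zero_iff hm).1 h0] with l hl
  exact sub_eq_zero.1 (eq_zero_of_hsNormSq_eq_zero hl)

/-- The space of all `f ∈ L²(N)` whose Plancherel transform `T` satisfies `T P = T`, in terms of
kernels. -/
theorem exists_isPlancherelTransform_iff (hβ : IsAdmissibleBasis β) (f : L2N β)
    (P : (Fin r → ℝ) → L2R d →L[ℂ] L2R d) :
    (∃ T, IsPlancherelTransform f T ∧ ∀ᵐ l ∂(plancherelMeasure β), T l ∘L P l = T l) ↔
      ∀ᵐ l ∂(plancherelMeasure β), planOp hβ f l ∘L P l = planOp hβ f l := by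
  refine ⟨?_, fun h => ⟨_, isPlancherelTransform_planOp hβ f, h⟩⟩
  rintro ⟨T, hT, h⟩
  filter_upwards [h, hT.ae_eq hβ] with l h1 h2
  rw [← h2, h1]

end Plancherel

/-! ### The projection onto the cokernel of an operator -/

section CokernelProjection

open ContinuousLinearMap

variable {d : ℕ}

/-- The orthogonal projection onto the orthogonal complement of the kernel of `T`. -/
def cokerProj (T : L2R d →L[ℂ] L2R d) : L2R d →L[ℂ] L2R d := (T.ker)ᗮ.starProjection

theorem isStarProjection_cokerProj (T : L2R d →L[ℂ] L2R d) : IsStarProjection (cokerProj T) :=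
  isStarProjection_starProjection

theorem comp_cokerProj (T : L2R d →L[ℂ] L2R d) : T ∘L cokerProj T = T := by
  have : CompleteSpace T.ker := T.isClosed_ker.completeSpace_coe
  ext1 u
  have h : u - cokerProj T u ∈ T.ker := by
    rw [← Submodule.orthogonal_orthogonal T.ker]
    exact Submodule.sub_starProjection_mem_orthogonal u
  have h' : T (u - cokerProj T u) = 0 := h
  rw [map_sub, sub_eq_zero] at h'
  exact h'.symm

theorem cokerProj_apply_eq_zero {T : L2R d →L[ℂ] L2R d} {u : L2R d} (hu : T u = 0) :
    cokerProj T u = 0 := by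
  have hu : u ∈ T.ker := hu
  exact (Submodule.starProjection_apply_eq_zero_iff _).2 (Submodule.le_orthogonal_orthogonal _ hu)

/-- The left side is the distance from `v` to (ker T)ᗮ, which is the closure of the range of the
adjoint. Writing it as a countable infimum is what makes the projection measurable in a parameter.
-/
theorem enorm_sub_cokerProj (T : L2R d →L[ℂ] L2R d) (v : L2R d) :
    ‖v - cokerProj T v‖ₑ = ⨅ i, ‖v - adjoint T (TopologicalSpace.denseSeq (L2R d) i)‖ₑ := by
  set D := TopologicalSpace.denseSeq (L2R d)
  have hmem : ∀ u, adjoint T u ∈ (T.ker)ᗮ := fun u => by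
    rw [ContinuousLinearMap.orthogonal_ker]
    exact Submodule.le_topologicalClosure _ ⟨u, rfl⟩
  refine le_antisymm (le_iInf fun i => ?_) ?_
  · have h1 : ‖v - cokerProj T v‖ ≤ ‖v - adjoint T (D i)‖ := by
      rw [cokerProj, Submodule.starProjection_minimal]
      exact ciInf_le ⟨0, by rintro _ ⟨x, rfl⟩; positivity⟩
        (⟨adjoint T (D i), hmem _⟩ : ((T.ker)ᗮ : Submodule ℂ (L2R d)))
    rw [← ofReal_norm, ← ofReal_norm]
    exact ENNReal.ofReal_le_ofReal h1
  · have h1 : cokerProj T v ∈ closure (Set.range fun i => adjoint T (D i)) := by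
      have h2 : cokerProj T v ∈ (T.ker)ᗮ := Submodule.starProjection_apply_mem _ _
      rw [ContinuousLinearMap.orthogonal_ker] at h2
      have h3 : cokerProj T v ∈ closure (Set.range (adjoint T)) := h2
      have h4 : Set.range (adjoint T) ⊆ closure (Set.range fun i => adjoint T (D i)) := by
        rintro _ ⟨u, rfl⟩
        have h5 := image_closure_subset_closure_image (s := Set.range D) (adjoint T).continuous
        rw [(TopologicalSpace.denseRange_denseSeq (L2R d)).closure_eq, ← Set.range_comp] at h5
        exact h5 ⟨u, trivial, rfl⟩
      exact closure_minimal h4 isClosed_closure h3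
    have h2 : Metric.infEDist v (Set.range fun i => adjoint T (D i)) ≤ edist v (cokerProj T v) := by
      rw [← Metric.infEDist_closure]
      exact Metric.infEDist_le_edist_of_mem h1
    rw [Metric.infEDist, iInf_range] at h2
    simpa only [edist_eq_enorm_sub] using h2

variable {r : ℕ} {T : (Fin r → ℝ) → L2R d →L[ℂ] L2R d}

theorem inner_apply_of_isStarProjection {P : L2R d →L[ℂ] L2R d} (hP : IsStarProjection P)
    (u v : L2R d) : inner ℂ (P u) (P v) = inner ℂ u (P v) := by
  have h1 : adjoint P = P := hP.isSelfAdjoint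
  have h2 : P (P v) = P v := congrArg (fun S : L2R d →L[ℂ] L2R d => S v) hP.isIdempotentElem
  nth_rewrite 1 [← h1]
  rw [adjoint_inner_left, h2]

/-- The distance to the range of the projection is measurable as a countable infimum, the norm of
the projected vector then by Pythagoras, and the matrix coefficients by polarization. -/
theorem IsMeasurableField.cokerProj (hT : IsMeasurableField T) :
    IsMeasurableField fun l => cokerProj (T l) := by
  have h1 : ∀ u, StronglyMeasurable fun l => adjoint (T l) u := fun u =>
    stronglyMeasurable_of_inner fun v => by
      have h : ∀ l, inner ℂ v (adjoint (T l) u) = star (inner ℂ u (T l v)) := fun l => by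
        rw [adjoint_inner_right]
        exact (inner_conj_symm _ _).symm
      simp only [h]
      exact continuous_star.measurable.comp (hT u v)
  have h2 : ∀ v, Measurable fun l => ‖v - NilpotentFrames.cokerProj (T l) v‖ₑ := fun v => by
    simp only [enorm_sub_cokerProj]
    exact Measurable.iInf fun i => (stronglyMeasurable_const.sub (h1 _)).enorm
  have h3 : ∀ v, Measurable fun l => ‖NilpotentFrames.cokerProj (T l) v‖ := fun v => by
    have h4 : ∀ l, ‖NilpotentFrames.cokerProj (T l) v‖ =
        Real.sqrt (‖v‖ ^ 2 - (‖v - NilpotentFrames.cokerProj (T l) v‖ₑ).toReal ^ 2) := fun l => by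
      rw [toReal_enorm]
      have h5 := Submodule.norm_sq_eq_add_norm_sq_starProjection v ((T l).ker)ᗮ
      have h6 : (((T l).ker)ᗮ)ᗮ.starProjection v = v - NilpotentFrames.cokerProj (T l) v := by
        rw [Submodule.starProjection_orthogonal']
        rfl
      rw [h6] at h5
      rw [h5, add_sub_cancel_right, Real.sqrt_sq (norm_nonneg _)]
      rfl
    simp only [h4]
    exact (measurable_const.sub ((h2 v).ennreal_toReal.pow_const 2)).sqrt
  intro u v
  have h4 : ∀ l, inner ℂ u (NilpotentFrames.cokerProj (T l) v) = _ := fun l =>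
    (inner_apply_of_isStarProjection (isStarProjection_cokerProj (T l)) u v).symm.trans
      (inner_eq_sum_norm_sq_div_four _ _)
  simp only [h4]
  simp only [← map_add, ← map_sub, ← map_smul]
  have h5 : ∀ w, Measurable fun l => ((‖NilpotentFrames.cokerProj (T l) w‖ : ℝ) : ℂ) := fun w =>
    Complex.measurable_ofReal.comp (h3 w)
  fun_prop

end CokernelProjection

section FieldSpace

variable {r d : ℕ} {𝔫 : Type*} [LieRing 𝔫] [LieAlgebra ℝ 𝔫]
  {β : Module.Basis (Fin r ⊕ Fin d ⊕ Fin d) ℝ 𝔫}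

/-! ### Algebra of the Plancherel transform -/

theorem ae_planOp_sub (hβ : IsAdmissibleBasis β) (f f' : L2N β) :
    ∀ᵐ l ∂(plancherelMeasure β), planOp hβ (f - f') l = planOp hβ f l - planOp hβ f' l := by
  have h2 := Lp.coeFn_sub (kernelTransform hβ f) (kernelTransform hβ f')
  rw [← map_sub] at h2
  filter_upwards [ae_memLp_kernel hβ f, ae_memLp_kernel hβ f', Measure.ae_ae_of_ae_prod h2]
    with l h3 h4 h5
  rw [planOp, planOp, planOp, ← hsOp_sub h3 h4]
  exact hsOp_congr h5

theorem hsOp_smul {κ : (Fin d → ℝ) × (Fin d → ℝ) → ℂ} (hκ : MemLp κ 2 volume) (c : ℂ) :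
    hsOp (c • κ) = c • hsOp κ := by
  refine ContinuousLinearMap.ext fun u => Lp.ext ?_
  have h0 : MemLp (c • κ) 2 volume := hκ.const_smul c
  filter_upwards [hsOp_coeFn hκ u, hsOp_coeFn h0 u, Lp.coeFn_smul c (hsOp κ u)] with t h1 h2 h3
  rw [h2, smul_apply, h3, Pi.smul_apply, h1, ← integral_smul]
  simp only [Pi.smul_apply, smul_eq_mul, mul_assoc]

theorem ae_planOp_smul (hβ : IsAdmissibleBasis β) (c : ℂ) (f : L2N β) :
    ∀ᵐ l ∂(plancherelMeasure β), planOp hβ (c • f) l = c • planOp hβ f l := by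
  have h2 := Lp.coeFn_smul c (kernelTransform hβ f)
  rw [← map_smul] at h2
  filter_upwards [ae_memLp_kernel hβ f, Measure.ae_ae_of_ae_prod h2] with l h3 h5
  rw [planOp, planOp, ← hsOp_smul h3]
  exact hsOp_congr h5

theorem lintegral_hsNormSq_planOp (hβ : IsAdmissibleBasis β) (f : L2N β) :
    ∫⁻ l, hsNormSq (planOp hβ f l) ∂(plancherelMeasure β) = ‖f‖ₑ ^ 2 := by
  have h := lintegral_hsNormSq_planOp_sub hβ f 0
  rw [sub_zero] at h
  rw [← h]
  refine lintegral_congr_ae ?_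
  filter_upwards [ae_planOp_sub hβ f 0] with l hl
  rw [← hl, sub_zero]

theorem ae_enorm_planOp_sq_le (hβ : IsAdmissibleBasis β) (f : L2N β) :
    ∀ᵐ l ∂(plancherelMeasure β), ∀ u,
      ‖planOp hβ f l u‖ₑ ^ 2 ≤ hsNormSq (planOp hβ f l) * ‖u‖ₑ ^ 2 := by
  filter_upwards [ae_memLp_kernel hβ f] with l hl u
  rw [planOp, hsNormSq_hsOp hl]
  exact enorm_hsOp_sq_le hl u

theorem ae_planOp_leftRegular (hβ : IsAdmissibleBasis β) (g : NilGroup β) (f : L2N β) :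
    ∀ᵐ l ∂(plancherelMeasure β), ∀ u,
      planOp hβ (leftRegular g f) l u = rep l g (planOp hβ f l u) := by
  have h0 := repKernel_coeFn g (kernelTransform hβ f)
  rw [← kernelTransform_leftRegular] at h0
  filter_upwards [ae_memLp_kernel hβ f, ae_memLp_kernel hβ (leftRegular g f),
    Measure.ae_ae_of_ae_prod h0] with l h1 h2 h3 u
  refine Lp.ext ?_
  filter_upwards [hsOp_coeFn h2 u, rep_coeFn l g (planOp hβ f l u),
    (measurePreserving_sub_right volume g.x).quasiMeasurePreserving.ae (hsOp_coeFn h1 u),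
    Measure.ae_ae_of_ae_prod h3] with t h4 h5 h6 h7
  rw [planOp, h4, h5, planOp, h6, ← integral_const_mul]
  refine integral_congr_ae ?_
  filter_upwards [h7] with s hs
  rw [hs]
  simp only [translateKernel]
  ring

/-! ### The space attached to a field of projections -/

/-- The space of all `f ∈ L²(N)` whose Plancherel transform `T` satisfies `T P = T`. -/
def fieldSpace (hβ : IsAdmissibleBasis β) (P : (Fin r → ℝ) → L2R d →L[ℂ] L2R d) :
    Submodule ℂ (L2N β) where
  carrier := {f | ∀ᵐ l ∂(plancherelMeasure β), planOp hβ f l ∘L P l = planOp hβ f l}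
  add_mem' := fun {f f'} hf hf' => by
    have h1 : f + f' = f - (-1 : ℂ) • f' := by simp
    filter_upwards [hf, hf', ae_planOp_sub hβ f ((-1 : ℂ) • f'), ae_planOp_smul hβ (-1) f']
      with l h2 h3 h4 h5
    rw [h1, h4, h5, ContinuousLinearMap.sub_comp, ContinuousLinearMap.smul_comp, h2, h3]
  zero_mem' := by
    have h1 : (0 : L2N β) = 0 - 0 := by simp
    filter_upwards [ae_planOp_sub hβ 0 0] with l h2
    rw [h1, h2, sub_self, ContinuousLinearMap.zero_comp]
  smul_mem' := fun c f hf => by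
    filter_upwards [hf, ae_planOp_smul hβ c f] with l h2 h5
    rw [h5, ContinuousLinearMap.smul_comp, h2]

theorem mem_fieldSpace {hβ : IsAdmissibleBasis β} {P : (Fin r → ℝ) → L2R d →L[ℂ] L2R d}
    {f : L2N β} : f ∈ fieldSpace hβ P ↔
      ∀ᵐ l ∂(plancherelMeasure β), planOp hβ f l ∘L P l = planOp hβ f l := Iff.rfl

/-- For a convergent sequence, the infimum over `k` of the squared Hilbert–Schmidt distances has
integral zero, hence vanishes almost everywhere. So the condition `T P = T` passes to the limit at
almost every `l`. -/
theorem isClosed_fieldSpace (hβ : IsAdmissibleBasis β)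
    (P : (Fin r → ℝ) → L2R d →L[ℂ] L2R d) : IsClosed (fieldSpace hβ P : Set (L2N β)) := by
  refine isClosed_of_closure_subset fun f hf => ?_
  obtain ⟨f', hf', hlim⟩ := mem_closure_iff_seq_limit.1 hf
  have hm : ∀ k, Measurable fun l => hsNormSq (planOp hβ (f - f' k) l) := fun k =>
    (isMeasurableField_planOp hβ _).measurable_hsNormSq
  have h0 : ∫⁻ l, ⨅ k, hsNormSq (planOp hβ (f - f' k) l) ∂(plancherelMeasure β) = 0 := by
    have h2 : Tendsto (fun k => ‖f - f' k‖ₑ) atTop (𝓝 0) := by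
      have h3 := tendsto_iff_edist_tendsto_0.1 hlim
      simpa only [edist_comm _ f, edist_eq_enorm_sub] using h3
    have h3 := ENNReal.Tendsto.pow (n := 2) h2
    rw [zero_pow two_ne_zero] at h3
    refine le_antisymm (ge_of_tendsto' h3 fun k => ?_) zero_le
    rw [← lintegral_hsNormSq_planOp hβ]
    exact lintegral_mono fun l => iInf_le _ k
  rw [lintegral_eq_zero_iff (Measurable.iInf hm)] at h0
  have h1 : ∀ᵐ l ∂(plancherelMeasure β), ∀ k, planOp hβ (f' k) l ∘L P l = planOp hβ (f' k) l :=
    ae_all_iff.2 hf'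
  filter_upwards [h0, h1, ae_all_iff.2 fun k => ae_planOp_sub hβ f (f' k),
    ae_all_iff.2 fun k => ae_enorm_planOp_sq_le hβ (f - f' k)] with l h2 h3 h4 h5
  ext1 w
  have h6 : ∀ k, ‖planOp hβ f l (P l w - w)‖ₑ ^ 2 ≤
      hsNormSq (planOp hβ (f - f' k) l) * ‖P l w - w‖ₑ ^ 2 := fun k => by
    have h7 : planOp hβ (f' k) l (P l w - w) = 0 := by
      rw [map_sub, sub_eq_zero, ← ContinuousLinearMap.comp_apply, h3 k]
    refine le_trans (le_of_eq ?_) (h5 k _)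
    rw [h4 k, sub_apply, h7, sub_zero]
  have h8 : ‖planOp hβ f l (P l w - w)‖ₑ ^ 2 ≤ 0 := by
    refine (le_iInf h6).trans ?_
    rw [← ENNReal.iInf_mul' (fun h => absurd h (by simp)) fun _ => inferInstance]
    have h9 : ⨅ k, hsNormSq (planOp hβ (f - f' k) l) = 0 := h2
    rw [h9, zero_mul]
  have h9 : planOp hβ f l (P l w - w) = 0 := by simpa using h8
  rw [map_sub, sub_eq_zero] at h9
  exact h9

/-- Translation multiplies the transform by `π_l(g)` from the left, while the projection acts from
the right. -/
theorem leftRegular_mem_fieldSpace {hβ : IsAdmissibleBasis β}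
    {P : (Fin r → ℝ) → L2R d →L[ℂ] L2R d} {f : L2N β} (hf : f ∈ fieldSpace hβ P)
    (g : NilGroup β) : leftRegular g f ∈ fieldSpace hβ P := by
  filter_upwards [mem_fieldSpace.1 hf, ae_planOp_leftRegular hβ g f] with l h1 h2
  ext1 u
  rw [ContinuousLinearMap.comp_apply, h2, h2, ← ContinuousLinearMap.comp_apply, h1]

theorem mem_fieldSpace_cokerProj (hβ : IsAdmissibleBasis β) (f : L2N β) :
    f ∈ fieldSpace hβ fun l => cokerProj (planOp hβ f l) :=
  ae_of_all _ fun _ => comp_cokerProj _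

/-- Uniqueness of the Plancherel transform allows the canonical representative `planOp` to replace
the existential quantifier. -/
theorem isProjectionField_iff (hβ : IsAdmissibleBasis β) {K : Submodule ℂ (L2N β)}
    {P : (Fin r → ℝ) → L2R d →L[ℂ] L2R d} :
    IsProjectionField K P ↔ (∀ l, IsStarProjection (P l)) ∧ IsMeasurableField P ∧
      K = fieldSpace hβ P := by
  refine ⟨fun h => ⟨h.1, h.2, ?_⟩, fun h => ⟨h.1, h.2.1, fun f => ?_⟩⟩
  · ext f
    rw [h.3, exists_isPlancherelTransform_iff hβ, mem_fieldSpace]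
  · rw [exists_isPlancherelTransform_iff hβ, h.2.2, mem_fieldSpace]

end FieldSpace

section Correlation

variable {r d : ℕ} {𝔫 : Type*} [LieRing 𝔫] [LieAlgebra ℝ 𝔫]
  {β : Module.Basis (Fin r ⊕ Fin d ⊕ Fin d) ℝ 𝔫}

/-! ### Matrix coefficients of the left regular representation -/

/-- The partial inner product of the kernels of `L(exp x) φ` and `f`. -/
def correlation (hβ : IsAdmissibleBasis β) (φ f : L2N β) (x : Fin d → ℝ)
    (p : (Fin r → ℝ) × (Fin d → ℝ)) : ℂ :=
  ∫ σ, star (kernelTransform hβ φ (p.1, (p.2 - x, σ))) * kernelTransform hβ f (p.1, (p.2, σ))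

theorem stronglyMeasurable_correlation (hβ : IsAdmissibleBasis β) (φ f : L2N β) :
    StronglyMeasurable fun w : (Fin d → ℝ) × ((Fin r → ℝ) × (Fin d → ℝ)) =>
      correlation hβ φ f w.1 w.2 := by
  have h1 := (Lp.stronglyMeasurable (kernelTransform hβ φ)).measurable
  have h2 := (Lp.stronglyMeasurable (kernelTransform hβ f)).measurable
  refine StronglyMeasurable.integral_prod_right (f := fun
    (w : (Fin d → ℝ) × ((Fin r → ℝ) × (Fin d → ℝ))) (σ : Fin d → ℝ) =>
      star (kernelTransform hβ φ (w.2.1, (w.2.2 - w.1, σ))) *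
        kernelTransform hβ f (w.2.1, (w.2.2, σ))) (Measurable.stronglyMeasurable ?_)
  exact (continuous_star.measurable.comp (h1.comp (by fun_prop : Measurable fun
    w : ((Fin d → ℝ) × ((Fin r → ℝ) × (Fin d → ℝ))) × (Fin d → ℝ) =>
      (w.1.2.1, (w.1.2.2 - w.1.1, w.2))))).mul (h2.comp (by fun_prop))

theorem integrable_correlation_integrand (hβ : IsAdmissibleBasis β) (φ f : L2N β)
    (x : Fin d → ℝ) : Integrable (fun p => star (kernelTransform hβ φ (translateKernel x p)) *
      kernelTransform hβ f p) (fieldMeasure β) := by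
  have h1 : MemLp (fun p => kernelTransform hβ φ (translateKernel x p)) 2 (fieldMeasure β) :=
    (Lp.memLp (kernelTransform hβ φ)).comp_measurePreserving (measurePreserving_translateKernel x)
  exact h1.star.integrable_mul (Lp.memLp (kernelTransform hβ f))

theorem integrable_correlation (hβ : IsAdmissibleBasis β) (φ f : L2N β) (x : Fin d → ℝ) :
    Integrable (correlation hβ φ f x) ((plancherelMeasure β).prod volume) := by
  have h := (measurePreserving_prodAssoc (plancherelMeasure β) (volume : Measure (Fin d → ℝ))
    (volume : Measure (Fin d → ℝ))).integrable_comp_of_integrable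
      (integrable_correlation_integrand hβ φ f x)
  exact h.integral_prod_left

/-- Translation does not touch `σ`, and the phase depends on (l, t) alone, so `σ` is integrated out
first. What remains depends on (z, y) only through the phase and on `x` only through the shift of
`t`. -/
theorem inner_leftRegular_eq_integral (hβ : IsAdmissibleBasis β) (φ f : L2N β) (g : NilGroup β) :
    inner ℂ (leftRegular g φ) f = ∫ p, star (repPhase g p.1 p.2) * correlation hβ φ f g.x p
      ∂((plancherelMeasure β).prod volume) := by
  have h0 := integrable_correlation_integrand hβ φ f g.x
  have h1 : Integrable (fun p : (Fin r → ℝ) × ((Fin d → ℝ) × (Fin d → ℝ)) =>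
      star (repPhase g p.1 p.2.1) * (star (kernelTransform hβ φ (translateKernel g.x p)) *
        kernelTransform hβ f p)) (fieldMeasure β) :=
    h0.bdd_mul (c := 1)
      (continuous_star.measurable.comp (measurable_repPhase_kernel g)).aestronglyMeasurable
      (ae_of_all _ fun p => by rw [norm_star, norm_repPhase])
  have hassoc := measurePreserving_prodAssoc (plancherelMeasure β) (volume : Measure (Fin d → ℝ))
    (volume : Measure (Fin d → ℝ))
  have h2 := hassoc.integrable_comp_of_integrable h1
  rw [← (kernelTransform hβ).inner_map_map, kernelTransform_leftRegular, inner_eq_integral]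
  calc _ = ∫ p, star (repPhase g p.1 p.2.1) * (star (kernelTransform hβ φ (translateKernel g.x p)) *
        kernelTransform hβ f p) ∂(fieldMeasure β) := by
        refine integral_congr_ae ?_
        filter_upwards [repKernel_coeFn g (kernelTransform hβ φ)] with p hp
        rw [hp, star_mul', mul_assoc]
    _ = _ := by
        refine (hassoc.integral_comp MeasurableEquiv.prodAssoc.measurableEmbedding _).symm.trans ?_
        refine (integral_prod _ h2).trans ?_
        refine integral_congr_ae (ae_of_all _ fun p => ?_)
        exact integral_const_mul (star (repPhase g p.1 p.2)) _

/-! ### Uniqueness of Fourier coefficients -/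

/-- `ℝ^r × ℝ^d` as a Euclidean space. -/
def sumEquiv (r d : ℕ) : (Fin r → ℝ) × (Fin d → ℝ) ≃ᵐ EuclideanSpace ℝ (Fin r ⊕ Fin d) :=
  (MeasurableEquiv.sumPiEquivProdPi fun _ => ℝ).symm.trans (MeasurableEquiv.toLp 2 _)

theorem measurePreserving_sumEquiv : MeasurePreserving (sumEquiv r d) :=
  (EuclideanSpace.volume_preserving_symm_measurableEquiv_toLp (Fin r ⊕ Fin d)).symm.comp
    (volume_measurePreserving_sumPiEquivProdPi_symm fun _ => ℝ)

theorem inner_sumEquiv (p p' : (Fin r → ℝ) × (Fin d → ℝ)) :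
    inner ℝ (sumEquiv r d p) (sumEquiv r d p') = p.1 ⬝ᵥ p'.1 + p.2 ⬝ᵥ p'.2 := by
  have h : inner ℝ (sumEquiv r d p) (sumEquiv r d p') =
    Sum.elim p'.1 p'.2 ⬝ᵥ Sum.elim p.1 p.2 := by
    change inner ℝ (WithLp.toLp 2 (Sum.elim p.1 p.2)) (WithLp.toLp 2 (Sum.elim p'.1 p'.2)) = _
    rw [EuclideanSpace.inner_toLp_toLp, star_trivial]
  rw [h]
  simp [dotProduct, Fintype.sum_sum_type, mul_comm]

/-- In the coordinates of `orbitMap` the conjugate phase is an ordinary character of ℝ^r × ℝ^d with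
frequency (-z, -y). Matrix coefficients thus become Euclidean Fourier coefficients. -/
theorem star_repPhase (z : Fin r → ℝ) (y x : Fin d → ℝ) (p : (Fin r → ℝ) × (Fin d → ℝ)) :
    star (repPhase (NilGroup.mk z y x : NilGroup β) p.1 p.2) =
      Complex.exp (-2 * Real.pi * Complex.I * (((orbitMap β p).1 ⬝ᵥ (-z) +
        (orbitMap β p).2 ⬝ᵥ (-y) : ℝ) : ℂ)) := by
  have hy : ((matB β p.1)ᵀ *ᵥ p.2) ⬝ᵥ y = p.2 ⬝ᵥ (matB β p.1 *ᵥ y) := by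
    rw [Matrix.mulVec_transpose, Matrix.dotProduct_mulVec]
  have h : (orbitMap β p).1 ⬝ᵥ (-z) + (orbitMap β p).2 ⬝ᵥ (-y) =
      p.1 ⬝ᵥ z + p.2 ⬝ᵥ (matB β p.1 *ᵥ y) := by
    rw [orbitMap, neg_dotProduct_neg, neg_dotProduct_neg, hy]
  rw [h, repPhase, RCLike.star_def, ← Complex.exp_conj]
  congr 1
  simp only [map_mul, Complex.conj_ofReal, Complex.conj_I, map_ofNat]
  change 2 * Real.pi * -Complex.I * ((p.1 ⬝ᵥ z + p.2 ⬝ᵥ (matB β p.1 *ᵥ y) : ℝ) : ℂ) = _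
  ring

/-- Integration over `ℝ^r × ℝ^d` in the coordinates given by the coadjoint orbits. -/
theorem integral_star_repPhase_mul (hβ : IsAdmissibleBasis β) {G : (Fin r → ℝ) × (Fin d → ℝ) → ℂ}
    (hG : AEStronglyMeasurable G ((plancherelMeasure β).prod volume))
    (z : Fin r → ℝ) (y x : Fin d → ℝ) :
    ∫ p, star (repPhase (NilGroup.mk z y x : NilGroup β) p.1 p.2) * G p
      ∂((plancherelMeasure β).prod volume) =
    ∫ ξ : (Fin r → ℝ) × (Fin d → ℝ), Complex.exp (-2 * Real.pi * Complex.I *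
      ((ξ.1 ⬝ᵥ (-z) + ξ.2 ⬝ᵥ (-y) : ℝ) : ℂ)) * G (orbitMapInv β ξ) := by
  have hm : Measurable fun p : (Fin r → ℝ) × (Fin d → ℝ) =>
      star (repPhase (NilGroup.mk z y x : NilGroup β) p.1 p.2) :=
    continuous_star.measurable.comp (measurable_repPhase (g := fun _ => NilGroup.mk z y x)
      measurable_const measurable_fst measurable_snd)
  have h1 := integral_map (measurePreserving_orbitMapInv hβ).measurable.aemeasurable
    (f := fun p => star (repPhase (NilGroup.mk z y x : NilGroup β) p.1 p.2) * G p)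
    (by rw [(measurePreserving_orbitMapInv hβ).map_eq]; exact hm.aestronglyMeasurable.mul hG)
  rw [(measurePreserving_orbitMapInv hβ).map_eq] at h1
  rw [h1]
  refine integral_congr_ae ?_
  filter_upwards [ae_orbitMap_orbitMapInv hβ] with ξ hξ
  rw [star_repPhase, hξ]

theorem ae_eq_zero_of_integral_repPhase (hβ : IsAdmissibleBasis β)
    {G : (Fin r → ℝ) × (Fin d → ℝ) → ℂ} (hG : Integrable G ((plancherelMeasure β).prod volume))
    (h : ∀ z y, ∫ p, star (repPhase (NilGroup.mk z y 0 : NilGroup β) p.1 p.2) * G p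
      ∂((plancherelMeasure β).prod volume) = 0) :
    G =ᵐ[(plancherelMeasure β).prod volume] 0 := by
  have h1 : (fun ξ => G (orbitMapInv β ξ)) =ᵐ[volume] 0 := by
    refine ae_eq_zero_of_integral_exp_eq_zero (sumEquiv r d) measurePreserving_sumEquiv
      ((measurePreserving_orbitMapInv hβ).integrable_comp_of_integrable hG) fun η => ?_
    have h2 := h (-η.1) (-η.2)
    rw [integral_star_repPhase_mul hβ hG.1] at h2
    simpa only [inner_sumEquiv, neg_neg] using h2
  filter_upwards [(measurePreserving_orbitMap hβ).quasiMeasurePreserving.ae h1,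
    ae_orbitMapInv_orbitMap hβ] with p h2 h3
  rwa [h3] at h2

theorem ae_correlation_eq_zero (hβ : IsAdmissibleBasis β) {φ f : L2N β}
    (h : ∀ g : NilGroup β, inner ℂ (leftRegular g φ) f = 0) :
    ∀ᵐ l ∂(plancherelMeasure β), ∀ᵐ t : Fin d → ℝ, ∀ᵐ s : Fin d → ℝ,
      ∫ σ, star (kernelTransform hβ φ (l, (s, σ))) * kernelTransform hβ f (l, (t, σ)) = 0 := by
  have h1 : ∀ x, ∀ᵐ p ∂((plancherelMeasure β).prod volume), correlation hβ φ f x p = 0 := by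
    intro x
    refine ae_eq_zero_of_integral_repPhase hβ (integrable_correlation hβ φ f x) fun z y => ?_
    have h2 := h (NilGroup.mk z y x)
    rw [inner_leftRegular_eq_integral hβ] at h2
    exact h2
  -- The null set of points `p` depends on `x`. Fubini exchanges the quantifiers, after which `s = t
  -- - x` runs over almost all of ℝ^d.
  have h2 : ∀ᵐ p ∂((plancherelMeasure β).prod (volume : Measure (Fin d → ℝ))),
      ∀ᵐ x : Fin d → ℝ, correlation hβ φ f x p = 0 :=
    (Measure.ae_ae_comm (p := fun x p => correlation hβ φ f x p = 0)
      ((stronglyMeasurable_correlation hβ φ f).measurable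
        (measurableSet_singleton 0))).1 (ae_of_all _ h1)
  filter_upwards [Measure.ae_ae_of_ae_prod h2] with l hl
  filter_upwards [hl] with t ht
  have h3 := (quasiMeasurePreserving_sub_left (volume : Measure (Fin d → ℝ)) t).ae ht
  filter_upwards [h3] with s hs
  simpa only [correlation, sub_sub_cancel] using hs

/-- The vanishing correlations say that for almost every `t` the conjugate of the row k_f(l, t, ·),
carried over by the Fourier transform, lies in the kernel of `planOp hβ φ l`. The projection
annihilates it, so the rows of `planOp hβ f l ∘ P l`, which is `planOp hβ f l` itself, are zero. -/
theorem eq_zero_of_inner_leftRegular_eq_zero (hβ : IsAdmissibleBasis β) {φ f : L2N β}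
    (hf : f ∈ fieldSpace hβ fun l => cokerProj (planOp hβ φ l))
    (h : ∀ g : NilGroup β, inner ℂ (leftRegular g φ) f = 0) : f = 0 := by
  have h0 : ∀ᵐ l ∂(plancherelMeasure β), hsNormSq (planOp hβ f l) = 0 := by
    filter_upwards [ae_correlation_eq_zero hβ h, ae_memLp_kernel hβ φ, ae_memLp_kernel hβ f,
      mem_fieldSpace.1 hf] with l h1 h2 h3 h4
    have h5 : planOp hβ f l = 0 := by
      ext1 u
      rw [← h4, ContinuousLinearMap.comp_apply]
      refine Lp.ext ?_
      filter_upwards [h1, hsOp_coeFn h3 (cokerProj (planOp hβ φ l) u), memLp_two_slice h3,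
        Lp.coeFn_zero ℂ 2 (volume : Measure (Fin d → ℝ))] with t h6 h7 h8 h9
      rw [planOp, h7, zero_apply, h9, integral_mul_eq_inner h8]
      set w := h8.star.toLp (star fun σ => kernelTransform hβ f (l, (t, σ))) with hw
      have h10 : planOp hβ φ l (fourierV d w) = 0 := by
        refine Lp.ext ?_
        filter_upwards [h6, hsOp_coeFn h2 (fourierV d w),
          Lp.coeFn_zero ℂ 2 (volume : Measure (Fin d → ℝ))] with s h11 h12 h13
        rw [planOp, h12, h13, LinearIsometryEquiv.symm_apply_apply, Pi.zero_apply]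
        have h14 : ∫ σ, kernelTransform hβ φ (l, (s, σ)) * w σ =
            star (∫ σ, star (kernelTransform hβ φ (l, (s, σ))) *
              kernelTransform hβ f (l, (t, σ))) := by
          rw [RCLike.star_def, ← integral_conj]
          refine integral_congr_ae ?_
          filter_upwards [h8.star.coeFn_toLp] with σ hσ
          rw [hw, hσ]
          simp
        rw [h14, h11, star_zero]
      have h11 : inner ℂ w ((fourierV d).symm (cokerProj (planOp hβ φ l) u)) =
          inner ℂ (cokerProj (planOp hβ φ l) (fourierV d w)) (cokerProj (planOp hβ φ l) u) := by
        rw [inner_apply_of_isStarProjection (isStarProjection_cokerProj _),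
          ← (fourierV d).inner_map_map, LinearIsometryEquiv.apply_symm_apply]
      rw [h11, cokerProj_apply_eq_zero h10, inner_zero_left]
      rfl
    rw [h5]
    simp [hsNormSq_eq]
  have h1 := lintegral_hsNormSq_planOp hβ f
  rw [lintegral_congr_ae h0] at h1
  simpa using h1.symm

/-! ### Existence of the field of projections -/

/-- Let `V` be the space of the projections. The frame identity gives `K ≤ V`, since no nonzero
vector of `K` is orthogonal to the orbit of `φ`. Conversely, the full group orbit of `φ` lies in `K`
and is total in `V`. -/
theorem exists_isProjectionField (hβ : IsAdmissibleBasis β) {K : Submodule ℂ (L2N β)}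
    (hK_closed : IsClosed (K : Set (L2N β)))
    (hK_inv : ∀ g : NilGroup β, ∀ f ∈ K, leftRegular g f ∈ K) {φ : L2N β} (hφ : φ ∈ K)
    {Γ : Set (NilGroup β)}
    (hframe : IsParsevalFrame K fun γ : Γ => leftRegular (γ : NilGroup β) φ) :
    IsProjectionField K fun l => cokerProj (planOp hβ φ l) := by
  refine (isProjectionField_iff hβ).2 ⟨fun l => isStarProjection_cokerProj _,
    (isMeasurableField_planOp hβ φ).cokerProj, ?_⟩
  set V := fieldSpace hβ fun l => cokerProj (planOp hβ φ l) with hV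
  have hVφ : ∀ g, leftRegular g φ ∈ V := leftRegular_mem_fieldSpace (mem_fieldSpace_cokerProj hβ φ)
  have hVc : IsClosed (V : Set (L2N β)) := isClosed_fieldSpace hβ _
  have hKV : K ≤ V := by
    intro f hf
    have hWc : IsClosed ((K ⊓ V : Submodule ℂ (L2N β)) : Set (L2N β)) := hK_closed.inter hVc
    have : CompleteSpace (K ⊓ V : Submodule ℂ (L2N β)) := hWc.completeSpace_coe
    -- The component `e` of `f` orthogonal to `K ⊓ V` stays in `K`, and every frame vector lies in
    -- `K ⊓ V`. The frame identity for `e` then reads 0 = ‖e‖².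
    obtain ⟨p, hp, e, he, rfl⟩ := (K ⊓ V).exists_add_mem_mem_orthogonal f
    have heK : e ∈ K := by simpa using K.sub_mem hf hp.1
    have h1 := hframe.2 e heK
    have h2 : ∀ γ : Γ, inner ℂ e (leftRegular (γ : NilGroup β) φ) = 0 := fun γ =>
      (Submodule.mem_orthogonal' _ _).1 he _ ⟨hK_inv γ φ hφ, hVφ γ⟩
    simp only [h2, norm_zero, zero_pow two_ne_zero] at h1
    have h3 : e = 0 := by simpa using h1.unique hasSum_zero
    rw [h3, add_zero]
    exact hp.2
  refine le_antisymm hKV fun f hf => ?_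
  have : CompleteSpace K := hK_closed.completeSpace_coe
  obtain ⟨p, hp, e, he, rfl⟩ := K.exists_add_mem_mem_orthogonal f
  have heV : e ∈ V := by simpa using V.sub_mem hf (hKV hp)
  have h1 : e = 0 := eq_zero_of_inner_leftRegular_eq_zero hβ heV fun g =>
    (Submodule.mem_orthogonal _ _).1 he _ (hK_inv g φ hφ)
  rw [h1, add_zero]
  exact hp

end Correlation

section QuasiLattice

variable {r d : ℕ} {𝔫 : Type*} [LieRing 𝔫] [LieAlgebra ℝ 𝔫]
  {β : Module.Basis (Fin r ⊕ Fin d ⊕ Fin d) ℝ 𝔫}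

/-! ### Fourier series on the coadjoint orbits -/

/-- The set of points that `orbitMap` maps into a given box. -/
def orbitBox (β : Module.Basis (Fin r ⊕ Fin d ⊕ Fin d) ℝ 𝔫) (c₁ a : Fin r → ℝ)
    (c₂ q : Fin d → ℝ) : Set ((Fin r → ℝ) × (Fin d → ℝ)) :=
  orbitMap β ⁻¹' (box c₁ a ×ˢ box c₂ q)

theorem measurableSet_orbitBox (c₁ a : Fin r → ℝ) (c₂ q : Fin d → ℝ) :
    MeasurableSet (orbitBox β c₁ a c₂ q) :=
  measurable_orbitMap ((measurableSet_box _ _).prod (measurableSet_box _ _))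

theorem measure_orbitBox_lt_top (hβ : IsAdmissibleBasis β) (c₁ a : Fin r → ℝ)
    (c₂ q : Fin d → ℝ) :
    ((plancherelMeasure β).prod volume) (orbitBox β c₁ a c₂ q) < ∞ := by
  rw [orbitBox, (measurePreserving_orbitMap hβ).measure_preimage
    ((measurableSet_box _ _).prod (measurableSet_box _ _)).nullMeasurableSet,
    Measure.volume_eq_prod, Measure.prod_prod, volume_box, volume_box]
  exact ENNReal.mul_lt_top (ENNReal.prod_lt_top fun i _ => ENNReal.ofReal_lt_top)
    (ENNReal.prod_lt_top fun i _ => ENNReal.ofReal_lt_top)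

/-- The point of the quasi-lattice with the coordinates `m`, `k`, `n`. -/
def latticePoint (β : Module.Basis (Fin r ⊕ Fin d ⊕ Fin d) ℝ 𝔫) (a : Fin r → ℝ)
    (q b : Fin d → ℝ) (w : ((Fin r → ℤ) × (Fin d → ℤ)) × (Fin d → ℤ)) : NilGroup β :=
  NilGroup.mk (fun i => w.1.1 i / a i) (fun i => w.1.2 i / q i) (fun i => w.2 i / b i)

/-- In orbit coordinates `H` lives on a box with side lengths (a, q), and the lattice frequencies
m/a, k/q are exactly those of its Fourier series. The index `n` plays no role, since the phase does
not see the `X`-coordinates. -/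
theorem tsum_enorm_integral_repPhase (hβ : IsAdmissibleBasis β) {a : Fin r → ℝ} {q b : Fin d → ℝ}
    (ha : ∀ i, 0 < a i) (hq : ∀ i, 0 < q i) (n : Fin d → ℤ) (c₁ : Fin r → ℝ) (c₂ : Fin d → ℝ)
    {H : (Fin r → ℝ) × (Fin d → ℝ) → ℂ} (hH : Measurable H)
    (hH2 : ∫⁻ p, ‖H p‖ₑ ^ 2 ∂((plancherelMeasure β).prod volume) < ∞)
    (h0 : ∀ p ∉ orbitBox β c₁ a c₂ q, H p = 0) :
    ∑' w : (Fin r → ℤ) × (Fin d → ℤ), ‖∫ p, star (repPhase (latticePoint β a q b (w, n)) p.1 p.2) *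
      H p ∂((plancherelMeasure β).prod volume)‖ₑ ^ 2 =
    (∏ i, ENNReal.ofReal (a i)) * (∏ i, ENNReal.ofReal (q i)) *
      ∫⁻ p, ‖H p‖ₑ ^ 2 ∂((plancherelMeasure β).prod volume) := by
  set e : (Fin r ⊕ Fin d → ℝ) ≃ᵐ (Fin r → ℝ) × (Fin d → ℝ) :=
    MeasurableEquiv.sumPiEquivProdPi fun _ => ℝ with he
  have hemp : MeasurePreserving e := volume_measurePreserving_sumPiEquivProdPi fun _ => ℝ
  set c : Fin r ⊕ Fin d → ℝ := Sum.elim c₁ c₂ with hc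
  set s : Fin r ⊕ Fin d → ℝ := Sum.elim a q with hs
  have hs0 : ∀ i, 0 < s i := by
    rintro (i | i)
    · exact ha i
    · exact hq i
  have hbox : ∀ v, v ∈ box c s ↔ e v ∈ box c₁ a ×ˢ box c₂ q := fun v => by
    simp only [box, Set.mem_ofPred_eq, Set.mem_prod, Sum.forall]
    rfl
  set G : (Fin r ⊕ Fin d → ℝ) → ℂ := (box c s).indicator fun v => H (orbitMapInv β (e v)) with hG
  have hGm : Measurable G :=
    (hH.comp (measurable_orbitMapInv.comp e.measurable)).indicator (measurableSet_box _ _)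
  have hGae : ∀ᵐ v, G v = H (orbitMapInv β (e v)) := by
    filter_upwards [hemp.quasiMeasurePreserving.ae (ae_orbitMap_orbitMapInv hβ)] with v hv
    by_cases hvb : v ∈ box c s
    · exact Set.indicator_of_mem hvb _
    · rw [hG, Set.indicator_of_notMem hvb, h0]
      rw [orbitBox, Set.mem_preimage, hv, ← hbox]
      exact hvb
  have hnorm : ∫⁻ v, ‖G v‖ₑ ^ 2 = ∫⁻ p, ‖H p‖ₑ ^ 2 ∂((plancherelMeasure β).prod volume) := by
    rw [← (measurePreserving_orbitMapInv hβ).lintegral_comp (hH.enorm.pow_const 2),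
      ← hemp.lintegral_comp (f := fun ξ => ‖H (orbitMapInv β ξ)‖ₑ ^ 2)
        ((hH.comp measurable_orbitMapInv).enorm.pow_const 2)]
    refine lintegral_congr_ae ?_
    filter_upwards [hGae] with v hv
    rw [hv]
  have hpars := tsum_enorm_integral_box c hs0 hGm (hnorm ▸ hH2)
    fun v hv => Set.indicator_of_notMem hv _
  rw [hnorm, Fintype.prod_sum_type] at hpars
  -- The characters have frequency (-z, -y), so the summation index is negated to match the Fourier
  -- series.
  rw [← ((Equiv.sumPiEquivProdPi fun _ : Fin r ⊕ Fin d => ℤ).trans (Equiv.neg _)).tsum_eq]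
  refine Eq.trans ?_ hpars
  refine tsum_congr fun m => ?_
  congr 2
  rw [latticePoint, integral_star_repPhase_mul hβ hH.aestronglyMeasurable,
    ← hemp.integral_comp e.measurableEmbedding]
  refine integral_congr_ae ?_
  filter_upwards [hGae] with v hv
  rw [hv]
  congr 4
  rw [Fintype.sum_sum_type]
  simp only [dotProduct]
  congr 1
  · refine Finset.sum_congr rfl fun i _ => ?_
    simp [e, s, Equiv.sumPiEquivProdPi, MeasurableEquiv.sumPiEquivProdPi]
    ring
  · refine Finset.sum_congr rfl fun i _ => ?_
    simp [e, s, Equiv.sumPiEquivProdPi, MeasurableEquiv.sumPiEquivProdPi]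
    ring

/-! ### The quasi-lattice -/

theorem bracketXY_zero_left (y : Fin d → ℝ) : bracketXY β 0 y = 0 := by
  funext k
  simp [bracketXY]

theorem nilExp_sum_vecZ (c : Fin r → ℝ) :
    nilExp β (∑ j, c j • vecZ β j) = NilGroup.mk c 0 0 := by
  have h1 : ∀ i, β.repr (∑ j, c j • vecZ β j) (Sum.inr i) = 0 := fun i => by
    simp [vecZ]
  have h2 : ∀ i, β.repr (∑ j, c j • vecZ β j) (Sum.inl i) = c i := fun i => by
    simp [vecZ, Finsupp.single_apply]
  simp only [nilExp, h1, h2]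
  have h3 := bracketXY_zero_left (β := β) 0
  refine NilGroup.ext' ?_ rfl rfl
  change c + (1 / 2 : ℝ) • bracketXY β 0 0 = c
  rw [h3, smul_zero, add_zero]

theorem nilExp_sum_vecY (c : Fin d → ℝ) :
    nilExp β (∑ j, c j • vecY β j) = NilGroup.mk 0 c 0 := by
  have h1 : ∀ i, β.repr (∑ j, c j • vecY β j) (Sum.inr (Sum.inr i)) = 0 := fun i => by
    simp [vecY]
  have h2 : ∀ i, β.repr (∑ j, c j • vecY β j) (Sum.inr (Sum.inl i)) = c i := fun i => by
    simp [vecY, Finsupp.single_apply]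
  have h3 : ∀ i, β.repr (∑ j, c j • vecY β j) (Sum.inl i) = 0 := fun i => by
    simp [vecY]
  simp only [nilExp, h1, h2, h3]
  refine NilGroup.ext' ?_ rfl rfl
  change 0 + (1 / 2 : ℝ) • bracketXY β 0 c = 0
  rw [bracketXY_zero_left, smul_zero, add_zero]

theorem nilExp_sum_vecX (c : Fin d → ℝ) :
    nilExp β (∑ j, c j • vecX β j) = NilGroup.mk 0 0 c := by
  have h1 : ∀ i, β.repr (∑ j, c j • vecX β j) (Sum.inr (Sum.inr i)) = c i := fun i => by
    simp [vecX, Finsupp.single_apply]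
  have h2 : ∀ i, β.repr (∑ j, c j • vecX β j) (Sum.inr (Sum.inl i)) = 0 := fun i => by
    simp [vecX]
  have h3 : ∀ i, β.repr (∑ j, c j • vecX β j) (Sum.inl i) = 0 := fun i => by
    simp [vecX]
  simp only [nilExp, h1, h2, h3]
  refine NilGroup.ext' ?_ rfl rfl
  change 0 + (1 / 2 : ℝ) • bracketXY β c 0 = 0
  have h4 : bracketXY β c 0 = 0 := by
    funext k
    simp [bracketXY]
  rw [h4, smul_zero, add_zero]

theorem latticePoint_eq (a : Fin r → ℝ) (q b : Fin d → ℝ)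
    (w : ((Fin r → ℤ) × (Fin d → ℤ)) × (Fin d → ℤ)) : latticePoint β a q b w =
      nilExp β (∑ j, ((w.1.1 j : ℝ) / a j) • vecZ β j) *
        nilExp β (∑ j, ((w.1.2 j : ℝ) / q j) • vecY β j) *
        nilExp β (∑ j, ((w.2 j : ℝ) / b j) • vecX β j) := by
  rw [nilExp_sum_vecZ, nilExp_sum_vecY, nilExp_sum_vecX, NilGroup.mul_def, NilGroup.mul_def]
  refine NilGroup.ext' ?_ ?_ ?_
  · change (fun i => (w.1.1 i : ℝ) / a i) = ((fun i => (w.1.1 i : ℝ) / a i) + (0 : Fin r → ℝ) +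
      bracketXY β 0 (fun i => (w.1.2 i : ℝ) / q i)) + 0 + bracketXY β (0 + 0) 0
    rw [zero_add, bracketXY_zero_left, bracketXY_zero_left, add_zero, add_zero, add_zero, add_zero]
  · change (fun i => (w.1.2 i : ℝ) / q i) = (0 + fun i => (w.1.2 i : ℝ) / q i) + 0
    rw [zero_add, add_zero]
  · change (fun i => (w.2 i : ℝ) / b i) = (0 + 0) + fun i => (w.2 i : ℝ) / b i
    rw [zero_add, zero_add]

theorem latticePoint_injective {a : Fin r → ℝ} {q b : Fin d → ℝ} (ha : ∀ i, 0 < a i)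
    (hq : ∀ i, 0 < q i) (hb : ∀ i, 0 < b i) : Function.Injective (latticePoint β a q b) := by
  have key : ∀ {m : ℕ} {s : Fin m → ℝ} (_ : ∀ i, 0 < s i) {k k' : Fin m → ℤ},
      (fun i => (k i : ℝ) / s i) = (fun i => (k' i : ℝ) / s i) → k = k' := by
    intro m s hs k k' h
    funext i
    have h1 := congrFun h i
    have h2 : (k i : ℝ) = k' i := (div_left_inj' (hs i).ne').1 h1
    exact_mod_cast h2
  rintro ⟨⟨m, k⟩, n⟩ ⟨⟨m', k'⟩, n'⟩ h
  have h1 : m = m' := key ha (congrArg NilGroup.z h)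
  have h2 : k = k' := key hq (congrArg NilGroup.y h)
  have h3 : n = n' := key hb (congrArg NilGroup.x h)
  rw [h1, h2, h3]

/-- The quasi-lattice is parametrized by integers. -/
def latticeEquiv (β : Module.Basis (Fin r ⊕ Fin d ⊕ Fin d) ℝ 𝔫) {a : Fin r → ℝ}
    {q b : Fin d → ℝ} (ha : ∀ i, 0 < a i) (hq : ∀ i, 0 < q i) (hb : ∀ i, 0 < b i) :
    ((Fin r → ℤ) × (Fin d → ℤ)) × (Fin d → ℤ) ≃ quasiLattice β a q b :=
  Equiv.ofBijective
    (fun w => ⟨latticePoint β a q b w, w.1.1, w.1.2, w.2, latticePoint_eq a q b w⟩)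
    ⟨fun _ _ h => latticePoint_injective ha hq hb (congrArg Subtype.val h),
      fun ⟨_, m, k, n, h⟩ =>
        ⟨((m, k), n), Subtype.ext ((latticePoint_eq a q b ((m, k), n)).trans h.symm)⟩⟩

theorem IsParsevalFrame.tsum_enorm_inner_sq {H : Type*} [NormedAddCommGroup H]
    [InnerProductSpace ℂ H] {ι : Type*} {K : Submodule ℂ H} {v : ι → H}
    (hv : IsParsevalFrame K v) {f : H} (hf : f ∈ K) :
    ∑' i, ‖inner ℂ (v i) f‖ₑ ^ 2 = ‖f‖ₑ ^ 2 := by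
  have h1 := hv.2 f hf
  have h2 : ∀ x : ℂ, ‖x‖ₑ ^ 2 = ENNReal.ofReal (‖x‖ ^ 2) := fun x => by
    rw [ENNReal.ofReal_pow (norm_nonneg _), ofReal_norm]
  have h3 : ‖f‖ₑ ^ 2 = ENNReal.ofReal (‖f‖ ^ 2) := by
    rw [ENNReal.ofReal_pow (norm_nonneg _), ofReal_norm]
  simp only [h2, norm_inner_symm _ f]
  rw [← ENNReal.ofReal_tsum_of_nonneg (fun _ => by positivity) h1.summable, h1.tsum_eq, h3]

theorem tsum_enorm_inner_latticePoint {a : Fin r → ℝ} {q b : Fin d → ℝ} (ha : ∀ i, 0 < a i)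
    (hq : ∀ i, 0 < q i) (hb : ∀ i, 0 < b i) {K : Submodule ℂ (L2N β)} {φ : L2N β}
    (hframe : IsParsevalFrame K fun γ : quasiLattice β a q b => leftRegular (γ : NilGroup β) φ)
    {f : L2N β} (hf : f ∈ K) :
    ∑' w, ‖inner ℂ (leftRegular (latticePoint β a q b w) φ) f‖ₑ ^ 2 = ‖f‖ₑ ^ 2 := by
  rw [← hframe.tsum_enorm_inner_sq hf, ← (latticeEquiv β ha hq hb).tsum_eq]
  rfl

end QuasiLattice

/-! ### The rank of a projection -/

section Rank

variable {d : ℕ}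

/-- Each fixed vector `v i` contributes ∑ⱼ |⟪v i, P eⱼ⟫|² = ‖v i‖² = 1, and Bessel's inequality for
each `P eⱼ` bounds the total. -/
theorem card_le_hsNormSq {P : L2R d →L[ℂ] L2R d} (hP : IsStarProjection P) {n : ℕ}
    {v : Fin n → L2R d} (hv : Orthonormal ℂ v) (hPv : ∀ i, P (v i) = v i) :
    (n : ℝ≥0∞) ≤ hsNormSq P := by
  have h1 : ∀ i, ∑' j, ‖inner ℂ (v i) (P (stdBasis d j))‖ₑ ^ 2 = 1 := fun i => by
    have h2 : ∀ j, inner ℂ (v i) (P (stdBasis d j)) = inner ℂ (v i) (stdBasis d j) := fun j => by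
      have h3 := inner_apply_of_isStarProjection hP (stdBasis d j) (v i)
      rw [hPv] at h3
      rw [← inner_conj_symm, h3, inner_conj_symm]
    simp only [h2]
    rw [(stdBasis d).tsum_enorm_inner_sq, ← ofReal_norm, hv.1]
    simp
  calc (n : ℝ≥0∞) = ∑ i, ∑' j, ‖inner ℂ (v i) (P (stdBasis d j))‖ₑ ^ 2 := by simp [h1]
    _ = ∑' j, ∑ i, ‖inner ℂ (v i) (P (stdBasis d j))‖ₑ ^ 2 :=
        (Summable.tsum_finsetSum fun i _ => ENNReal.summable).symm
    _ ≤ _ := by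
        rw [hsNormSq_eq]
        refine ENNReal.tsum_le_tsum fun j => ?_
        have h4 := hv.sum_inner_products_le (P (stdBasis d j)) (s := Finset.univ)
        have h5 := ENNReal.ofReal_le_ofReal h4
        rw [ENNReal.ofReal_sum_of_nonneg fun _ _ => by positivity] at h5
        simpa only [ENNReal.ofReal_pow (norm_nonneg _), ofReal_norm] using h5

/-- Gram–Schmidt in the range of `P` gives orthonormal systems fixed by `P`, of every finite size up
to the rank. For infinite rank, arbitrarily large systems make the norm infinite. -/
theorem toENat_rank_le_hsNormSq {P : L2R d →L[ℂ] L2R d} (hP : IsStarProjection P) :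
    ((Cardinal.toENat (LinearMap.rank (P : L2R d →ₗ[ℂ] L2R d)) : ℕ∞) : ℝ≥0∞) ≤ hsNormSq P := by
  have h1 : ∀ n : ℕ, (n : ℕ∞) ≤ Cardinal.toENat (LinearMap.rank (P : L2R d →ₗ[ℂ] L2R d)) →
      (n : ℝ≥0∞) ≤ hsNormSq P := fun n hn => by
    rw [Cardinal.natCast_le_toENat] at hn
    obtain ⟨w, hw⟩ := exists_linearIndependent_of_le_rank hn
    have h2 := InnerProductSpace.gramSchmidtNormed_orthonormal hw
    set w' := InnerProductSpace.gramSchmidtNormed ℂ w with hw'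
    refine card_le_hsNormSq hP (v := fun i => (w' i : L2R d)) ?_ fun i => ?_
    · exact h2.comp_linearIsometry (Submodule.subtypeₗᵢ _)
    · obtain ⟨u, hu⟩ := (w' i).2
      rw [← hu]
      exact congrArg (fun S : L2R d →L[ℂ] L2R d => S u) hP.isIdempotentElem
  generalize Cardinal.toENat (LinearMap.rank (P : L2R d →ₗ[ℂ] L2R d)) = m at h1
  induction m with
  | top =>
    have h2 : hsNormSq P = ∞ := ENNReal.eq_top_of_forall_nnreal_le fun x => by
      obtain ⟨n, hn⟩ := exists_nat_ge x
      refine le_trans ?_ (h1 n le_top)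
      exact_mod_cast hn
    rw [h2]
    exact le_top
  | coe n => exact h1 n le_rfl

end Rank

section Kernels

variable {r d : ℕ} {𝔫 : Type*} [LieRing 𝔫] [LieAlgebra ℝ 𝔫]
  {β : Module.Basis (Fin r ⊕ Fin d ⊕ Fin d) ℝ 𝔫}

/-! ### Functions with a given kernel -/

/-- The function in `L²(N)` whose Plancherel transform has the kernel `κ`. -/
def ofKernel (hβ : IsAdmissibleBasis β) {κ : (Fin r → ℝ) × ((Fin d → ℝ) × (Fin d → ℝ)) → ℂ}
    (hκ : MemLp κ 2 (fieldMeasure β)) : L2N β :=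
  (kernelTransform hβ).symm (hκ.toLp κ)

variable {κ : (Fin r → ℝ) × ((Fin d → ℝ) × (Fin d → ℝ)) → ℂ}

theorem kernelTransform_ofKernel (hβ : IsAdmissibleBasis β) (hκ : MemLp κ 2 (fieldMeasure β)) :
    kernelTransform hβ (ofKernel hβ hκ) =ᵐ[fieldMeasure β] κ := by
  rw [ofKernel, LinearIsometryEquiv.apply_symm_apply]
  exact hκ.coeFn_toLp

theorem ae_planOp_ofKernel (hβ : IsAdmissibleBasis β) (hκ : MemLp κ 2 (fieldMeasure β)) :
    ∀ᵐ l ∂(plancherelMeasure β), planOp hβ (ofKernel hβ hκ) l = hsOp fun p => κ (l, p) := by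
  filter_upwards [Measure.ae_ae_of_ae_prod (kernelTransform_ofKernel hβ hκ)] with l hl
  exact hsOp_congr hl

theorem enorm_ofKernel_sq (hβ : IsAdmissibleBasis β) (hκ : MemLp κ 2 (fieldMeasure β)) :
    ‖ofKernel hβ hκ‖ₑ ^ 2 = ∫⁻ p, ‖κ p‖ₑ ^ 2 ∂(fieldMeasure β) := by
  rw [← enorm_toLp_sq hκ, ofKernel, ← ofReal_norm, LinearIsometryEquiv.norm_map, ofReal_norm]

theorem hsOp_zero : hsOp (fun _ : (Fin d → ℝ) × (Fin d → ℝ) => (0 : ℂ)) = 0 := by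
  have h := hsOp_smul (d := d) (κ := 0) MemLp.zero 0
  rw [zero_smul, zero_smul] at h
  exact h

/-! ### The Hilbert–Schmidt norm of the Plancherel transform of the frame generator -/

theorem ae_hsNormSq_planOp_lt_top (hβ : IsAdmissibleBasis β) (f : L2N β) :
    ∀ᵐ l : Fin r → ℝ, hsNormSq (planOp hβ f l) < ∞ := by
  rw [← ae_plancherelMeasure_iff hβ]
  refine ae_lt_top (isMeasurableField_planOp hβ f).measurable_hsNormSq ?_
  rw [lintegral_hsNormSq_planOp]
  exact ENNReal.pow_ne_top enorm_ne_top

theorem integral_star_mul_self_kernel (hβ : IsAdmissibleBasis β) (f : L2N β) :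
    ∀ᵐ l ∂(plancherelMeasure β),
      ∫ p, star (kernelTransform hβ f (l, p)) * kernelTransform hβ f (l, p) =
        ((hsNormSq (planOp hβ f l)).toReal : ℂ) := by
  filter_upwards [ae_memLp_kernel hβ f] with l hl
  have h1 : ∀ p, star (kernelTransform hβ f (l, p)) * kernelTransform hβ f (l, p) =
      ((‖kernelTransform hβ f (l, p)‖ ^ 2 : ℝ) : ℂ) := fun p => by
    rw [RCLike.star_def, RCLike.conj_mul]
    norm_cast
  simp only [h1]
  have h2 := integral_eq_lintegral_of_nonneg_ae (μ := volume)
    (f := fun p => ‖kernelTransform hβ f (l, p)‖ ^ 2) (ae_of_all _ fun p => by positivity)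
    (hl.1.norm.pow 2)
  rw [integral_complex_ofReal, planOp, hsNormSq_hsOp hl, h2]
  simp only [ENNReal.ofReal_pow (norm_nonneg _), ofReal_norm]

/-- The matrix coefficients along the centre, for a function supported on `E` in the dual of the
centre. -/
theorem inner_leftRegular_ofKernel_indicator (hβ : IsAdmissibleBasis β) (φ : L2N β)
    {E : Set (Fin r → ℝ)}
    (hκ : MemLp ((Prod.fst ⁻¹' E).indicator (kernelTransform hβ φ)) 2 (fieldMeasure β))
    (z : Fin r → ℝ) :
    inner ℂ (leftRegular (NilGroup.mk z 0 0) φ) (ofKernel hβ hκ) =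
      ∫ l, Complex.exp (-2 * Real.pi * Complex.I * ((z ⬝ᵥ l : ℝ) : ℂ)) *
        E.indicator (fun l =>
          ((|(matB β l).det| * (hsNormSq (planOp hβ φ l)).toReal : ℝ) : ℂ)) l := by
  set k := kernelTransform hβ φ with hk
  set ph : (Fin r → ℝ) → ℂ := fun l => Complex.exp (-2 * Real.pi * Complex.I * ((z ⬝ᵥ l : ℝ) : ℂ))
    with hph
  have hphm : Measurable ph := by
    have : Measurable fun l : Fin r → ℝ => z ⬝ᵥ l :=
      measurable_dotProduct measurable_const measurable_id
    fun_prop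
  have hstar : ∀ l t, star (repPhase (NilGroup.mk z 0 0 : NilGroup β) l t) = ph l := fun l t => by
    have h := star_repPhase (β := β) z 0 0 (l, t)
    refine h.trans ?_
    simp [hph, orbitMap, dotProduct_comm]
  have hint : Integrable (fun p => ph p.1 * (star (k p) *
      (Prod.fst ⁻¹' E).indicator k p)) (fieldMeasure β) := by
    refine ((Lp.memLp k).star.integrable_mul hκ).bdd_mul (c := 1)
      (hphm.comp measurable_fst).aestronglyMeasurable (ae_of_all _ fun p => ?_)
    rw [← hstar p.1 0, norm_star, norm_repPhase]
  rw [← (kernelTransform hβ).inner_map_map, kernelTransform_leftRegular, inner_eq_integral]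
  calc _ = ∫ p, ph p.1 * (star (k p) * (Prod.fst ⁻¹' E).indicator k p) ∂(fieldMeasure β) := by
        refine integral_congr_ae ?_
        filter_upwards [repKernel_coeFn (NilGroup.mk z 0 0 : NilGroup β) k,
          kernelTransform_ofKernel hβ hκ] with p h1 h2
        have h3 : translateKernel (NilGroup.mk z 0 0 : NilGroup β).x p = p :=
          Prod.ext rfl (Prod.ext (sub_zero _) rfl)
        rw [h1, h2, h3, star_mul', hstar, mul_assoc]
    _ = ∫ l, ph l * E.indicator (fun l => ((hsNormSq (planOp hβ φ l)).toReal : ℂ)) l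
          ∂(plancherelMeasure β) := by
        refine (integral_prod _ hint).trans ?_
        refine integral_congr_ae ?_
        filter_upwards [integral_star_mul_self_kernel hβ φ] with l hl
        refine (integral_const_mul (ph l) _).trans ?_
        congr 1
        by_cases hlE : l ∈ E
        · rw [Set.indicator_of_mem hlE, ← hl]
          congr with p
          rw [Set.indicator_of_mem (s := Prod.fst ⁻¹' E) hlE]
        · rw [Set.indicator_of_notMem hlE]
          refine (integral_congr_ae (ae_of_all _ fun p => ?_)).trans (integral_zero' _ _)
          change _ * (Prod.fst ⁻¹' E).indicator k (l, p) = 0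
          rw [Set.indicator_of_notMem (s := Prod.fst ⁻¹' E) hlE, mul_zero]
    _ = _ := by
        rw [plancherelMeasure, integral_withDensity_eq_integral_toReal_smul measurable_density
          (ae_of_all _ fun _ => ENNReal.ofReal_lt_top)]
        congr with l
        rw [ENNReal.toReal_ofReal (abs_nonneg _), Complex.real_smul]
        by_cases hlE : l ∈ E
        · rw [Set.indicator_of_mem hlE, Set.indicator_of_mem hlE]
          push_cast
          ring
        · rw [Set.indicator_of_notMem hlE, Set.indicator_of_notMem hlE]
          simp

/-- Cutting off in `l` multiplies each fibre by 0 or 1 and so preserves the fibrewise condition.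
This supplies the test functions for the bound on the generator. -/
theorem ofKernel_indicator_mem_fieldSpace (hβ : IsAdmissibleBasis β) {φ : L2N β}
    {P : (Fin r → ℝ) → L2R d →L[ℂ] L2R d} (hφ : φ ∈ fieldSpace hβ P) {E : Set (Fin r → ℝ)}
    (hκ : MemLp ((Prod.fst ⁻¹' E).indicator (kernelTransform hβ φ)) 2 (fieldMeasure β)) :
    ofKernel hβ hκ ∈ fieldSpace hβ P := by
  filter_upwards [mem_fieldSpace.1 hφ, ae_planOp_ofKernel hβ hκ] with l h1 h2
  rw [h2]
  by_cases hlE : l ∈ E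
  · have h3 : (fun p => (Prod.fst ⁻¹' E).indicator (kernelTransform hβ φ) (l, p)) =
        fun p => kernelTransform hβ φ (l, p) :=
      funext fun p => Set.indicator_of_mem (s := Prod.fst ⁻¹' E) hlE _
    rw [h3]
    exact h1
  · have h3 : (fun p => (Prod.fst ⁻¹' E).indicator (kernelTransform hβ φ) (l, p)) = fun _ => 0 :=
      funext fun p => Set.indicator_of_notMem (s := Prod.fst ⁻¹' E) hlE _
    rw [h3, hsOp_zero, ContinuousLinearMap.zero_comp]

end Kernels

/-! ### The bound on the generator over the central box -/

section GeneratorBound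

variable {r d : ℕ} {𝔫 : Type*} [LieRing 𝔫] [LieAlgebra ℝ 𝔫]
  {β : Module.Basis (Fin r ⊕ Fin d ⊕ Fin d) ℝ 𝔫}

theorem lintegral_enorm_indicator_kernel (hβ : IsAdmissibleBasis β) (φ : L2N β)
    {E : Set (Fin r → ℝ)} (hE : MeasurableSet E) :
    ∫⁻ p, ‖(Prod.fst ⁻¹' E).indicator (kernelTransform hβ φ) p‖ₑ ^ 2 ∂(fieldMeasure β) =
      ∫⁻ l in E, ENNReal.ofReal |(matB β l).det| * hsNormSq (planOp hβ φ l) := by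
  rw [lintegral_enorm_sq_prod (((Lp.stronglyMeasurable (kernelTransform hβ φ)).indicator
    (measurable_fst hE)).aestronglyMeasurable), ← lintegral_indicator hE]
  have h1 : ∀ᵐ l ∂(plancherelMeasure β),
      ∫⁻ p, ‖(Prod.fst ⁻¹' E).indicator (kernelTransform hβ φ) (l, p)‖ₑ ^ 2 =
        E.indicator (fun l => hsNormSq (planOp hβ φ l)) l := by
    filter_upwards [ae_memLp_kernel hβ φ] with l hl
    by_cases hlE : l ∈ E
    · rw [Set.indicator_of_mem hlE, planOp, hsNormSq_hsOp hl]
      congr with p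
      rw [Set.indicator_of_mem (s := Prod.fst ⁻¹' E) hlE]
    · rw [Set.indicator_of_notMem hlE]
      refine lintegral_eq_zero_of_ae_eq_zero (ae_of_all _ fun p => ?_)
      change ‖(Prod.fst ⁻¹' E).indicator (kernelTransform hβ φ) (l, p)‖ₑ ^ 2 = 0
      rw [Set.indicator_of_notMem (s := Prod.fst ⁻¹' E) hlE]
      simp
  rw [lintegral_congr_ae h1, lintegral_plancherelMeasure
    ((isMeasurableField_planOp hβ φ).measurable_hsNormSq.indicator hE)]
  congr with l
  by_cases hlE : l ∈ E
  · rw [Set.indicator_of_mem hlE, Set.indicator_of_mem hlE]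
  · rw [Set.indicator_of_notMem hlE, Set.indicator_of_notMem hlE, mul_zero]

/-- The frame identity is applied to `φ` cut off to `E`. Its coefficients at central lattice points
are the Fourier coefficients of h = |det B| ‖𝓟φ‖²_HS restricted to `E`, so Parseval on the box sums
them to A ∫_E h². The squared norm of the test function is ∫_E h. -/
theorem setLIntegral_sq_le (hβ : IsAdmissibleBasis β) {a : Fin r → ℝ} {q b : Fin d → ℝ}
    (ha : ∀ i, 0 < a i) (hq : ∀ i, 0 < q i) (hb : ∀ i, 0 < b i)
    {P : (Fin r → ℝ) → L2R d →L[ℂ] L2R d} {φ : L2N β} (hφ : φ ∈ fieldSpace hβ P)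
    (hframe : IsParsevalFrame (fieldSpace hβ P)
      fun γ : quasiLattice β a q b => leftRegular (γ : NilGroup β) φ)
    {E : Set (Fin r → ℝ)} (hE : MeasurableSet E) (hEa : E ⊆ box 0 a) {M : ℝ≥0∞} (hM : M ≠ ∞)
    (hEM : ∀ l ∈ E, ENNReal.ofReal |(matB β l).det| * hsNormSq (planOp hβ φ l) ≤ M)
    (hfin : ∀ l ∈ E, hsNormSq (planOp hβ φ l) < ∞) :
    (∏ i, ENNReal.ofReal (a i)) *
      ∫⁻ l in E, (ENNReal.ofReal |(matB β l).det| * hsNormSq (planOp hβ φ l)) ^ 2 ≤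
      ∫⁻ l in E, ENNReal.ofReal |(matB β l).det| * hsNormSq (planOp hβ φ l) := by
  have hκ : MemLp ((Prod.fst ⁻¹' E).indicator (kernelTransform hβ φ)) 2 (fieldMeasure β) :=
    (Lp.memLp (kernelTransform hβ φ)).indicator (measurable_fst hE)
  have h1 := tsum_enorm_inner_latticePoint ha hq hb hframe
    (ofKernel_indicator_mem_fieldSpace hβ hφ hκ)
  rw [enorm_ofKernel_sq, lintegral_enorm_indicator_kernel hβ φ hE] at h1
  rw [← h1]
  set G : (Fin r → ℝ) → ℂ := E.indicator fun l =>
    ((|(matB β l).det| * (hsNormSq (planOp hβ φ l)).toReal : ℝ) : ℂ) with hG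
  have hhs := (isMeasurableField_planOp hβ φ).measurable_hsNormSq
  have hGm : Measurable G :=
    (Complex.measurable_ofReal.comp ((continuous_det_matB.abs.measurable).mul
      hhs.ennreal_toReal)).indicator hE
  have hGn : ∫⁻ l, ‖G l‖ₑ ^ 2 =
      ∫⁻ l in E, (ENNReal.ofReal |(matB β l).det| * hsNormSq (planOp hβ φ l)) ^ 2 := by
    rw [← lintegral_indicator hE]
    congr with l
    by_cases hlE : l ∈ E
    · rw [hG, Set.indicator_of_mem hlE, Set.indicator_of_mem hlE, ← ofReal_norm,
        Complex.norm_real, Real.norm_of_nonneg (by positivity),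
        ENNReal.ofReal_mul (abs_nonneg _), ENNReal.ofReal_toReal (hfin l hlE).ne]
    · rw [hG, Set.indicator_of_notMem hlE, Set.indicator_of_notMem hlE]
      simp
  have hG2 : ∫⁻ l, ‖G l‖ₑ ^ 2 < ∞ := by
    rw [hGn]
    refine (setLIntegral_mono measurable_const fun l hl =>
      pow_le_pow_left₀ zero_le (hEM l hl) 2).trans_lt ?_
    rw [setLIntegral_const]
    refine ENNReal.mul_lt_top (ENNReal.pow_lt_top hM.lt_top) ((measure_mono hEa).trans_lt ?_)
    rw [volume_box]
    exact ENNReal.prod_lt_top fun i _ => ENNReal.ofReal_lt_top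
  have h2 := tsum_enorm_integral_box 0 ha hGm hG2 fun l hl =>
    Set.indicator_of_notMem (fun h => hl (hEa h)) _
  rw [hGn] at h2
  rw [← h2]
  -- The terms with k = n = 0 alone; discarding the others turns the frame identity into an
  -- inequality.
  have hinj : Function.Injective fun m : Fin r → ℤ =>
      (((m, 0), 0) : ((Fin r → ℤ) × (Fin d → ℤ)) × (Fin d → ℤ)) := fun m m' h =>
    congrArg (fun w => w.1.1) h
  refine le_trans (le_of_eq (tsum_congr fun m => ?_))
    (ENNReal.tsum_comp_le_tsum_of_injective hinj _)
  have h3 : latticePoint β a q b ((m, 0), 0) = NilGroup.mk (fun i => m i / a i) 0 0 :=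
    NilGroup.ext' rfl (funext fun i => by simp [latticePoint, NilGroup.mk, NilGroup.y])
      (funext fun i => by simp [latticePoint, NilGroup.mk, NilGroup.x])
  simp only [h3]
  rw [inner_leftRegular_ofKernel_indicator]
  rfl

/-- The field of Hilbert–Schmidt norms of the generator of a Parseval frame is bounded by the
inverse of the volume of the central part of the lattice. -/
theorem ae_hsNormSq_planOp_le (hβ : IsAdmissibleBasis β) {a : Fin r → ℝ} {q b : Fin d → ℝ}
    (ha : ∀ i, 0 < a i) (hq : ∀ i, 0 < q i) (hb : ∀ i, 0 < b i)
    {P : (Fin r → ℝ) → L2R d →L[ℂ] L2R d} {φ : L2N β} (hφ : φ ∈ fieldSpace hβ P)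
    (hframe : IsParsevalFrame (fieldSpace hβ P)
      fun γ : quasiLattice β a q b => leftRegular (γ : NilGroup β) φ) :
    ∀ᵐ l : Fin r → ℝ, l ∈ box 0 a → (∏ i, ENNReal.ofReal (a i)) *
      (ENNReal.ofReal |(matB β l).det| * hsNormSq (planOp hβ φ l)) ≤ 1 := by
  set A := ∏ i, ENNReal.ofReal (a i) with hA
  set F : (Fin r → ℝ) → ℝ≥0∞ := fun l =>
    ENNReal.ofReal |(matB β l).det| * hsNormSq (planOp hβ φ l) with hF
  have hhs := (isMeasurableField_planOp hβ φ).measurable_hsNormSq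
  have hFm : Measurable F := measurable_density.mul hhs
  -- The part of the box where the bound fails, truncated at height `M` so that all integrals are
  -- finite. On it F < A F², which contradicts `setLIntegral_sq_le` unless the set is null.
  set E : ℕ → Set (Fin r → ℝ) := fun M =>
    box 0 a ∩ {l | hsNormSq (planOp hβ φ l) < ∞} ∩ {l | F l ≤ M} ∩ {l | 1 < A * F l} with hE
  have hEm : ∀ M, MeasurableSet (E M) := fun M =>
    (((measurableSet_box _ _).inter (measurableSet_lt hhs measurable_const)).inter
      (measurableSet_le hFm measurable_const)).inter
        (measurableSet_lt measurable_const (hFm.const_mul A))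
  have hE0 : ∀ M, volume (E M) = 0 := fun M => by
    by_contra hne
    have hle := setLIntegral_sq_le hβ ha hq hb hφ hframe (hEm M) (fun l hl => hl.1.1.1)
      (ENNReal.natCast_ne_top M) (fun l hl => hl.1.2) fun l hl => hl.1.1.2
    have hfin : ∫⁻ l in E M, F l ≠ ∞ := by
      refine ((setLIntegral_mono measurable_const fun l (hl : l ∈ E M) => hl.1.2).trans_lt ?_).ne
      rw [setLIntegral_const]
      refine ENNReal.mul_lt_top (ENNReal.natCast_lt_top M)
        ((measure_mono fun l hl => hl.1.1.1).trans_lt (?_ : volume (box 0 a) < ∞))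
      rw [volume_box]
      exact ENNReal.prod_lt_top fun i _ => ENNReal.ofReal_lt_top
    have hlt : ∫⁻ l in E M, F l < ∫⁻ l in E M, A * F l ^ 2 := by
      refine setLIntegral_strict_mono (hEm M) hne ((hFm.pow_const 2).const_mul A) hfin
        (ae_of_all _ fun l hl => ?_)
      have h1 : 1 < A * F l := hl.2
      have h2 : F l ≠ 0 := fun h => by simp [h] at h1
      have h3 : F l ≠ ∞ := (lt_of_le_of_lt hl.1.2 (ENNReal.natCast_lt_top M)).ne
      calc F l = 1 * F l := (one_mul _).symm
        _ < (A * F l) * F l := (ENNReal.mul_lt_mul_iff_left h2 h3).2 h1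
        _ = A * F l ^ 2 := by ring
    rw [lintegral_const_mul _ (hFm.pow_const 2)] at hlt
    exact absurd hle hlt.not_ge
  filter_upwards [ae_hsNormSq_planOp_lt_top hβ φ,
    ae_all_iff.2 fun M => measure_eq_zero_iff_ae_notMem.1 (hE0 M)] with l h1 h2 hl
  by_contra! h3
  have h4 : F l < ∞ := ENNReal.mul_lt_top ENNReal.ofReal_lt_top h1
  obtain ⟨M, hM⟩ := ENNReal.exists_nat_gt h4.ne
  exact h2 M ⟨⟨⟨hl, h1⟩, hM.le⟩, h3⟩

end GeneratorBound

section Multiplicity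

variable {r d : ℕ} {𝔫 : Type*} [LieRing 𝔫] [LieAlgebra ℝ 𝔫]
  {β : Module.Basis (Fin r ⊕ Fin d ⊕ Fin d) ℝ 𝔫}

/-! ### Fields of operators of rank one -/

/-- The kernel of the field of operators `u ↦ ⟪w_l, u⟫ 1_E(l, ·)`. -/
def rankOneKernel (E : Set ((Fin r → ℝ) × (Fin d → ℝ))) (w : (Fin r → ℝ) × (Fin d → ℝ) → ℂ)
    (p : (Fin r → ℝ) × ((Fin d → ℝ) × (Fin d → ℝ))) : ℂ :=
  E.indicator (fun _ => star (w (p.1, p.2.2))) (p.1, p.2.1)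

variable {E : Set ((Fin r → ℝ) × (Fin d → ℝ))} {w : (Fin r → ℝ) × (Fin d → ℝ) → ℂ}

theorem measurable_rankOneKernel (hE : MeasurableSet E) (hw : Measurable w) :
    Measurable (rankOneKernel E w) := by
  have h1 : Measurable fun p : (Fin r → ℝ) × ((Fin d → ℝ) × (Fin d → ℝ)) =>
      star (w (p.1, p.2.2)) := continuous_star.measurable.comp (hw.comp (by fun_prop))
  have h2 : MeasurableSet {p : (Fin r → ℝ) × ((Fin d → ℝ) × (Fin d → ℝ)) | (p.1, p.2.1) ∈ E} :=
    (by fun_prop : Measurable fun p : (Fin r → ℝ) × ((Fin d → ℝ) × (Fin d → ℝ)) =>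
      (p.1, p.2.1)) hE
  exact h1.indicator h2

theorem lintegral_rankOneKernel (hE : MeasurableSet E) (hw : Measurable w) :
    ∫⁻ p, ‖rankOneKernel E w p‖ₑ ^ 2 ∂(fieldMeasure β) =
      ∫⁻ p in E, (∫⁻ σ, ‖w (p.1, σ)‖ₑ ^ 2) ∂((plancherelMeasure β).prod volume) := by
  have hm := ((measurable_rankOneKernel hE hw).enorm.pow_const 2)
  refine ((measurePreserving_prodAssoc (plancherelMeasure β) (volume : Measure (Fin d → ℝ))
    (volume : Measure (Fin d → ℝ))).lintegral_comp hm).symm.trans ?_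
  have hm' : Measurable fun p : ((Fin r → ℝ) × (Fin d → ℝ)) × (Fin d → ℝ) =>
      ‖rankOneKernel E w (MeasurableEquiv.prodAssoc p)‖ₑ ^ 2 :=
    hm.comp MeasurableEquiv.prodAssoc.measurable
  rw [lintegral_prod _ hm'.aemeasurable, ← lintegral_indicator hE]
  congr with p
  by_cases hp : p ∈ E
  · rw [Set.indicator_of_mem hp]
    congr with σ
    change ‖E.indicator (fun _ => star (w (p.1, σ))) p‖ₑ ^ 2 = _
    rw [Set.indicator_of_mem hp]
    simp
  · rw [Set.indicator_of_notMem hp]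
    refine lintegral_eq_zero_of_ae_eq_zero (ae_of_all _ fun σ => ?_)
    change ‖E.indicator (fun _ => star (w (p.1, σ))) p‖ₑ ^ 2 = 0
    rw [Set.indicator_of_notMem hp]
    simp

/-- The vector `w` is given on the Fourier side because kernels represent operators composed with
the Fourier transform; since the latter is unitary, the pairing with `w` becomes the inner product
with `v`. -/
theorem hsOp_rankOneKernel_coeFn {l : Fin r → ℝ}
    (hκ : MemLp (fun p => rankOneKernel E w (l, p)) 2 volume) {v : L2R d}
    (hv : ((fourierV d).symm v : (Fin d → ℝ) → ℂ) =ᵐ[volume] fun σ => w (l, σ)) (u : L2R d) :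
    (hsOp (fun p => rankOneKernel E w (l, p)) u : (Fin d → ℝ) → ℂ) =ᵐ[volume]
      fun t => E.indicator (fun _ => inner ℂ v u) (l, t) := by
  filter_upwards [hsOp_coeFn hκ u] with t ht
  rw [ht]
  by_cases hp : (l, t) ∈ E
  · rw [Set.indicator_of_mem hp, ← (fourierV d).symm.inner_map_map, inner_eq_integral]
    refine integral_congr_ae ?_
    filter_upwards [hv] with σ hσ
    rw [hσ, rankOneKernel, Set.indicator_of_mem hp]
  · rw [Set.indicator_of_notMem hp]
    refine (integral_congr_ae (ae_of_all _ fun σ => ?_)).trans (integral_zero' _ _)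
    change rankOneKernel E w (l, (t, σ)) * _ = 0
    rw [rankOneKernel, Set.indicator_of_notMem hp, zero_mul]

/-- The operator sends `u` to a multiple of an indicator by ⟪P v, u⟫, and this pairing does not
change when `u` is replaced by `P u`. -/
theorem ofKernel_rankOneKernel_mem_fieldSpace (hβ : IsAdmissibleBasis β)
    {P : (Fin r → ℝ) → L2R d →L[ℂ] L2R d} (hP : ∀ l, IsStarProjection (P l)) {v : L2R d}
    (hv : ∀ l, ((fourierV d).symm (P l v) : (Fin d → ℝ) → ℂ) =ᵐ[volume] fun σ => w (l, σ))
    (hκ : MemLp (rankOneKernel E w) 2 (fieldMeasure β)) :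
    ofKernel hβ hκ ∈ fieldSpace hβ P := by
  filter_upwards [ae_planOp_ofKernel hβ hκ, memLp_two_slice hκ] with l h1 h2
  rw [h1]
  ext1 u
  rw [ContinuousLinearMap.comp_apply]
  refine Lp.ext ?_
  filter_upwards [hsOp_rankOneKernel_coeFn h2 (hv l) u,
    hsOp_rankOneKernel_coeFn h2 (hv l) (P l u)] with t h3 h4
  have h5 : inner ℂ (P l v) (P l u) = inner ℂ (P l v) u := by
    rw [← inner_conj_symm, inner_apply_of_isStarProjection (hP l), inner_conj_symm]
  rw [h3, h4, h5]

theorem correlation_ofKernel_rankOneKernel (hβ : IsAdmissibleBasis β) (φ : L2N β)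
    (hκ : MemLp (rankOneKernel E w) 2 (fieldMeasure β)) (x : Fin d → ℝ) :
    correlation hβ φ (ofKernel hβ hκ) x =ᵐ[(plancherelMeasure β).prod volume]
      E.indicator fun p => star (∫ σ, kernelTransform hβ φ (p.1, (p.2 - x, σ)) * w (p.1, σ)) := by
  have h1 := (measurePreserving_prodAssoc (plancherelMeasure β) (volume : Measure (Fin d → ℝ))
    (volume : Measure (Fin d → ℝ))).quasiMeasurePreserving.ae (kernelTransform_ofKernel hβ hκ)
  filter_upwards [Measure.ae_ae_of_ae_prod h1] with p hp
  have h2 : correlation hβ φ (ofKernel hβ hκ) x p =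
      ∫ σ, star (kernelTransform hβ φ (p.1, (p.2 - x, σ))) *
        rankOneKernel E w (p.1, (p.2, σ)) := by
    refine integral_congr_ae ?_
    filter_upwards [hp] with σ hσ
    exact congrArg (star (kernelTransform hβ φ (p.1, (p.2 - x, σ))) * ·) hσ
  rw [h2]
  by_cases hpE : p ∈ E
  · rw [Set.indicator_of_mem hpE, RCLike.star_def, ← integral_conj]
    congr with σ
    rw [rankOneKernel, Set.indicator_of_mem hpE, map_mul]
    rfl
  · rw [Set.indicator_of_notMem hpE]
    refine (integral_congr_ae (ae_of_all _ fun σ => ?_)).trans (integral_zero' _ _)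
    change _ * rankOneKernel E w (p.1, (p.2, σ)) = 0
    rw [rankOneKernel, Set.indicator_of_notMem hpE, mul_zero]

theorem enorm_apply_le_of_isStarProjection {P : L2R d →L[ℂ] L2R d} (hP : IsStarProjection P)
    (v : L2R d) : ‖P v‖ₑ ≤ ‖v‖ₑ := by
  rw [← ofReal_norm, ← ofReal_norm]
  refine ENNReal.ofReal_le_ofReal ((P.le_opNorm v).trans ?_)
  exact mul_le_of_le_one_left (norm_nonneg _) hP.norm_le

/-! ### The frame condition for fields of operators of rank one -/

theorem measurable_kernel_integral (hβ : IsAdmissibleBasis β) (φ : L2N β) (hw : Measurable w) :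
    Measurable fun p : (Fin r → ℝ) × (Fin d → ℝ) =>
      ∫ σ, kernelTransform hβ φ (p.1, (p.2, σ)) * w (p.1, σ) := by
  have hk := (Lp.stronglyMeasurable (kernelTransform hβ φ)).measurable
  refine (StronglyMeasurable.integral_prod_right
    (f := fun (p : (Fin r → ℝ) × (Fin d → ℝ)) (σ : Fin d → ℝ) =>
      kernelTransform hβ φ (p.1, (p.2, σ)) * w (p.1, σ))
    (Measurable.stronglyMeasurable ?_)).measurable
  exact (hk.comp (by fun_prop : Measurable fun q : ((Fin r → ℝ) × (Fin d → ℝ)) × (Fin d → ℝ) =>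
    (q.1.1, (q.1.2, q.2)))).mul (hw.comp (by fun_prop))

theorem ae_lintegral_kernel_integral (hβ : IsAdmissibleBasis β) (φ : L2N β)
    {P : (Fin r → ℝ) → L2R d →L[ℂ] L2R d} {v : L2R d}
    (hv : ∀ l, ((fourierV d).symm (P l v) : (Fin d → ℝ) → ℂ) =ᵐ[volume] fun σ => w (l, σ)) :
    ∀ᵐ l ∂(plancherelMeasure β),
      ∫⁻ t, ‖∫ σ, kernelTransform hβ φ (l, (t, σ)) * w (l, σ)‖ₑ ^ 2 =
        ‖planOp hβ φ l (P l v)‖ₑ ^ 2 := by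
  filter_upwards [ae_memLp_kernel hβ φ] with l hl
  rw [enorm_sq_eq_lintegral]
  refine lintegral_congr_ae ?_
  filter_upwards [hsOp_coeFn hl (P l v)] with t ht
  rw [planOp, ht]
  congr 2
  refine integral_congr_ae ?_
  filter_upwards [hv l] with σ hσ
  rw [hσ]

variable {a : Fin r → ℝ} {q b : Fin d → ℝ}

/-- The frame identity for the rank one field. The left side is its squared norm. For fixed `n` the
correlation with `φ` is supported in one orbit box, so the sum over the (z, y) lattice is evaluated
by `tsum_enorm_integral_repPhase`. -/
theorem setLIntegral_orbitBox_eq_tsum (hβ : IsAdmissibleBasis β)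
    (ha : ∀ i, 0 < a i) (hq : ∀ i, 0 < q i) (hb : ∀ i, 0 < b i)
    {P : (Fin r → ℝ) → L2R d →L[ℂ] L2R d} (hP : ∀ l, IsStarProjection (P l)) {φ : L2N β}
    (hframe : IsParsevalFrame (fieldSpace hβ P)
      fun γ : quasiLattice β a q b => leftRegular (γ : NilGroup β) φ)
    {v : L2R d} (hw : Measurable w)
    (hv : ∀ l, ((fourierV d).symm (P l v) : (Fin d → ℝ) → ℂ) =ᵐ[volume] fun σ => w (l, σ))
    {c₁ : Fin r → ℝ} {c₂ : Fin d → ℝ} (hE : MeasurableSet E) (hEc : E ⊆ orbitBox β c₁ a c₂ q) :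
    ∫⁻ p in E, ‖P p.1 v‖ₑ ^ 2 ∂((plancherelMeasure β).prod volume) =
      (∏ i, ENNReal.ofReal (a i)) * (∏ i, ENNReal.ofReal (q i)) *
        ∑' n : Fin d → ℤ, ∫⁻ p in E, ‖∫ σ, kernelTransform hβ φ
          (p.1, (p.2 - (fun i => n i / b i), σ)) * w (p.1, σ)‖ₑ ^ 2
            ∂((plancherelMeasure β).prod volume) := by
  set W : (Fin r → ℝ) × (Fin d → ℝ) → ℂ := fun p =>
    ∫ σ, kernelTransform hβ φ (p.1, (p.2, σ)) * w (p.1, σ) with hW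
  have hWm : Measurable W := measurable_kernel_integral hβ φ hw
  have hnorm : ∀ l, ∫⁻ σ, ‖w (l, σ)‖ₑ ^ 2 = ‖P l v‖ₑ ^ 2 := fun l => by
    rw [← ofReal_norm (P l v), ← (fourierV d).symm.norm_map, ofReal_norm, enorm_sq_eq_lintegral]
    refine lintegral_congr_ae ?_
    filter_upwards [hv l] with σ hσ
    rw [hσ]
  have hPle : ∀ l, ‖P l v‖ₑ ≤ ‖v‖ₑ := fun l => enorm_apply_le_of_isStarProjection (hP l) v
  have hl := lintegral_rankOneKernel (β := β) hE hw
  simp only [hnorm] at hl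
  have hκ : MemLp (rankOneKernel E w) 2 (fieldMeasure β) := by
    rw [memLp_two_iff (measurable_rankOneKernel hE hw).aestronglyMeasurable, hl]
    refine (setLIntegral_mono measurable_const fun p _ =>
      pow_le_pow_left₀ zero_le (hPle p.1) 2).trans_lt ?_
    rw [setLIntegral_const]
    exact ENNReal.mul_lt_top (ENNReal.pow_lt_top enorm_lt_top)
      ((measure_mono hEc).trans_lt (measure_orbitBox_lt_top hβ _ _ _ _))
  have h1 := tsum_enorm_inner_latticePoint ha hq hb hframe
    (ofKernel_rankOneKernel_mem_fieldSpace hβ hP hv hκ)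
  rw [enorm_ofKernel_sq, hl, ENNReal.tsum_prod', ENNReal.tsum_comm] at h1
  rw [← h1, ← ENNReal.tsum_mul_left]
  refine tsum_congr fun n => ?_
  set x : Fin d → ℝ := fun i => n i / b i with hx
  set H : (Fin r → ℝ) × (Fin d → ℝ) → ℂ := E.indicator fun p => star (W (p.1, p.2 - x)) with hH
  have hHm : Measurable H :=
    (continuous_star.measurable.comp (hWm.comp (by fun_prop))).indicator hE
  have hHn : ∫⁻ p, ‖H p‖ₑ ^ 2 ∂((plancherelMeasure β).prod volume) =
      ∫⁻ p in E, ‖W (p.1, p.2 - x)‖ₑ ^ 2 ∂((plancherelMeasure β).prod volume) := by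
    rw [← lintegral_indicator hE]
    congr with p
    by_cases hp : p ∈ E
    · rw [hH, Set.indicator_of_mem hp, Set.indicator_of_mem hp]
      simp
    · rw [hH, Set.indicator_of_notMem hp, Set.indicator_of_notMem hp]
      simp
  have hH2 : ∫⁻ p, ‖H p‖ₑ ^ 2 ∂((plancherelMeasure β).prod volume) < ∞ := by
    rw [hHn]
    refine (setLIntegral_le_lintegral _ _).trans_lt ?_
    have hWx : Measurable fun p : (Fin r → ℝ) × (Fin d → ℝ) => ‖W (p.1, p.2 - x)‖ₑ ^ 2 :=
      (hWm.comp (by fun_prop)).enorm.pow_const 2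
    rw [lintegral_prod _ hWx.aemeasurable]
    have h2 : ∀ l, ∫⁻ t, ‖W (l, t - x)‖ₑ ^ 2 = ∫⁻ t, ‖W (l, t)‖ₑ ^ 2 := fun l =>
      lintegral_sub_right_eq_self (fun t => ‖W (l, t)‖ₑ ^ 2) x
    simp only [h2]
    -- The square integrability that Parseval needs comes from bounding the operator norm by the
    -- Hilbert–Schmidt norm, whose square has integral ‖φ‖².
    have h3 : ∫⁻ l, hsNormSq (planOp hβ φ l) * ‖v‖ₑ ^ 2 ∂(plancherelMeasure β) < ∞ := by
      rw [lintegral_mul_const' _ _ (ENNReal.pow_ne_top enorm_ne_top), lintegral_hsNormSq_planOp]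
      exact ENNReal.mul_lt_top (ENNReal.pow_lt_top enorm_lt_top)
        (ENNReal.pow_lt_top enorm_lt_top)
    refine (lintegral_mono_ae ?_).trans_lt h3
    filter_upwards [ae_lintegral_kernel_integral hβ φ hv, ae_enorm_planOp_sq_le hβ φ] with l h4 h5
    rw [h4]
    refine (h5 _).trans ?_
    gcongr
    exact hPle l
  have h2 := tsum_enorm_integral_repPhase hβ (b := b) ha hq n c₁ c₂ hHm hH2 fun p hp =>
    Set.indicator_of_notMem (fun h => hp (hEc h)) _
  rw [hHn] at h2
  refine Eq.trans ?_ h2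
  refine tsum_congr fun mk => ?_
  rw [inner_leftRegular_eq_integral hβ]
  congr 2
  refine integral_congr_ae ?_
  filter_upwards [correlation_ofKernel_rankOneKernel hβ φ hκ x] with p hp
  congr 1

/-- Preimages under `orbitMap` of the boxes of a tiling partition the space, which removes the
support restriction on `E`. -/
theorem setLIntegral_eq_tsum_orbitBox (ha : ∀ i, 0 < a i) (hq : ∀ i, 0 < q i)
    (hE : MeasurableSet E) (F : (Fin r → ℝ) × (Fin d → ℝ) → ℝ≥0∞) :
    ∫⁻ p in E, F p ∂((plancherelMeasure β).prod volume) = ∑' c : (Fin r → ℤ) × (Fin d → ℤ),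
      ∫⁻ p in E ∩ orbitBox β (fun i => c.1 i * a i) a (fun i => c.2 i * q i) q, F p
        ∂((plancherelMeasure β).prod volume) := by
  have hmem : ∀ (c : (Fin r → ℤ) × (Fin d → ℤ)) p,
      p ∈ orbitBox β (fun i => c.1 i * a i) a (fun i => c.2 i * q i) q ↔
        (orbitMap β p).1 ∈ cell a c.1 ∧ (orbitMap β p).2 ∈ cell q c.2 := fun c p => Iff.rfl
  rw [← lintegral_iUnion fun c => hE.inter (measurableSet_orbitBox _ _ _ _)]
  · rw [← Set.inter_iUnion, Set.iUnion_eq_univ_iff.2, Set.inter_univ]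
    intro p
    obtain ⟨m, hm, -⟩ := existsUnique_mem_cell ha (orbitMap β p).1
    obtain ⟨k, hk, -⟩ := existsUnique_mem_cell hq (orbitMap β p).2
    exact ⟨(m, k), hm, hk⟩
  · intro c c' hcc
    refine Set.disjoint_left.2 fun p hp hp' => hcc ?_
    have h := (hmem c p).1 hp.2
    have h' := (hmem c' p).1 hp'.2
    exact Prod.ext ((existsUnique_mem_cell ha _).unique h.1 h'.1)
      ((existsUnique_mem_cell hq _).unique h.2 h'.2)

/-- Choosing E = S × cell with side lengths 1/b_i, the translates by n/b tile ℝ^d. The sum over `n`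
thus unfolds to ‖𝓟φ(l) P_l v‖², while the left side gains the volume ∏ b_i⁻¹ of the cell. Since `S`
is arbitrary, the integrands agree almost everywhere. -/
theorem ae_enorm_projection_sq_eq (hβ : IsAdmissibleBasis β)
    (ha : ∀ i, 0 < a i) (hq : ∀ i, 0 < q i) (hb : ∀ i, 0 < b i)
    {P : (Fin r → ℝ) → L2R d →L[ℂ] L2R d} (hP : ∀ l, IsStarProjection (P l))
    (hPm : IsMeasurableField P) {φ : L2N β}
    (hframe : IsParsevalFrame (fieldSpace hβ P)
      fun γ : quasiLattice β a q b => leftRegular (γ : NilGroup β) φ) (v : L2R d) :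
    ∀ᵐ l ∂(plancherelMeasure β), (∏ i, ENNReal.ofReal (b i)⁻¹) * ‖P l v‖ₑ ^ 2 =
      (∏ i, ENNReal.ofReal (a i)) * (∏ i, ENNReal.ofReal (q i)) *
        ‖planOp hβ φ l (P l v)‖ₑ ^ 2 := by
  obtain ⟨w, hw, hw'⟩ := exists_measurable_joint_representative (ν := volume)
    ((fourierV d).symm.continuous.comp_stronglyMeasurable (hPm.stronglyMeasurable v))
  have hv : ∀ l, ((fourierV d).symm (P l v) : (Fin d → ℝ) → ℂ) =ᵐ[volume] fun σ => w (l, σ) := hw'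
  set s : Fin d → ℝ := fun i => (b i)⁻¹ with hs
  have hs0 : ∀ i, 0 < s i := fun i => inv_pos.2 (hb i)
  set A := (∏ i, ENNReal.ofReal (a i)) * (∏ i, ENNReal.ofReal (q i)) with hA
  set W : (Fin r → ℝ) × (Fin d → ℝ) → ℂ := fun p =>
    ∫ σ, kernelTransform hβ φ (p.1, (p.2, σ)) * w (p.1, σ) with hW
  have hWm : Measurable W := measurable_kernel_integral hβ φ hw
  set U : (Fin r → ℝ) → ℝ≥0∞ := fun l => ∫⁻ t, ‖W (l, t)‖ₑ ^ 2 with hU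
  have hUm : Measurable U := (hWm.enorm.pow_const 2).lintegral_prod_right'
  have hPv : Measurable fun l => ‖P l v‖ₑ ^ 2 := (hPm.measurable_enorm v).pow_const 2
  have key : ∀ E : Set ((Fin r → ℝ) × (Fin d → ℝ)), MeasurableSet E →
      ∫⁻ p in E, ‖P p.1 v‖ₑ ^ 2 ∂((plancherelMeasure β).prod volume) =
        A * ∑' n : Fin d → ℤ, ∫⁻ p in E, ‖W (p.1, p.2 - fun i => n i * s i)‖ₑ ^ 2
          ∂((plancherelMeasure β).prod volume) := fun E hE => by
    have h1 : ∀ n : Fin d → ℤ, (fun i => n i * s i) = fun i => (n i : ℝ) / b i := fun n =>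
      funext fun i => (div_eq_mul_inv _ _).symm
    simp only [h1]
    rw [setLIntegral_eq_tsum_orbitBox ha hq hE]
    simp only [fun F => setLIntegral_eq_tsum_orbitBox (β := β) ha hq hE F]
    rw [ENNReal.tsum_comm, ← ENNReal.tsum_mul_left]
    refine tsum_congr fun c => ?_
    exact setLIntegral_orbitBox_eq_tsum hβ ha hq hb hP hframe hw hv
      (hE.inter (measurableSet_orbitBox _ _ _ _)) Set.inter_subset_right
  have h1 : (fun l => (∏ i, ENNReal.ofReal (b i)⁻¹) * ‖P l v‖ₑ ^ 2) =ᵐ[plancherelMeasure β]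
      fun l => A * U l := by
    refine ae_eq_of_forall_setLIntegral_eq_of_sigmaFinite (hPv.const_mul _) (hUm.const_mul _)
      fun S hS _ => ?_
    -- The factor in `t` is a fundamental domain for the translations by n/b.
    have h2 := key (S ×ˢ cell s 0) (hS.prod (measurableSet_box _ _))
    simp only [← Measure.prod_restrict] at h2
    have hPv' : Measurable fun p : (Fin r → ℝ) × (Fin d → ℝ) => ‖P p.1 v‖ₑ ^ 2 :=
      hPv.comp measurable_fst
    rw [lintegral_prod _ hPv'.aemeasurable] at h2
    have h3 : ∀ n : Fin d → ℤ, Measurable fun p : (Fin r → ℝ) × (Fin d → ℝ) =>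
        ‖W (p.1, p.2 - fun i => n i * s i)‖ₑ ^ 2 := fun n =>
      (hWm.comp (by fun_prop)).enorm.pow_const 2
    simp only [fun n => lintegral_prod (μ := (plancherelMeasure β).restrict S)
      (ν := volume.restrict (cell s 0)) _ (h3 n).aemeasurable] at h2
    rw [← lintegral_tsum fun n => (h3 n).lintegral_prod_right'.aemeasurable] at h2
    have h4 : ∀ l, ∑' n : Fin d → ℤ, ∫⁻ t in cell s 0, ‖W (l, t - fun i => n i * s i)‖ₑ ^ 2 =
        U l := fun l => tsum_lintegral_cell_translate hs0 (F := fun t => ‖W (l, t)‖ₑ ^ 2)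
      ((hWm.comp measurable_prodMk_left).enorm.pow_const 2)
    have h5 : volume (cell s 0) = ∏ i, ENNReal.ofReal (s i) := volume_box _ _
    simp only [h4, setLIntegral_const, h5] at h2
    rw [lintegral_const_mul _ hUm, ← h2]
    simp only [mul_comm, hs]
  filter_upwards [h1, ae_lintegral_kernel_integral hβ φ hv] with l h2 h3
  rw [h2, ← h3]

/-- Summing the identity for ‖P_l v‖² over a Hilbert basis, and using 𝓟φ(l) P_l = 𝓟φ(l), expresses
‖P_l‖²_HS through the Hilbert–Schmidt norm of the generator, which is bounded on the central box. -/
theorem ae_mul_hsNormSq_projection_le (hβ : IsAdmissibleBasis β)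
    (ha : ∀ i, 0 < a i) (hq : ∀ i, 0 < q i) (hb : ∀ i, 0 < b i)
    {P : (Fin r → ℝ) → L2R d →L[ℂ] L2R d} (hP : ∀ l, IsStarProjection (P l))
    (hPm : IsMeasurableField P) {φ : L2N β} (hφ : φ ∈ fieldSpace hβ P)
    (hframe : IsParsevalFrame (fieldSpace hβ P)
      fun γ : quasiLattice β a q b => leftRegular (γ : NilGroup β) φ) :
    ∀ᵐ l : Fin r → ℝ, l ∈ box 0 a → ENNReal.ofReal |(matB β l).det| * hsNormSq (P l) ≤
      ENNReal.ofReal (∏ i, b i * q i) := by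
  have h1 : ∀ᵐ l : Fin r → ℝ, ∀ j,
      (∏ i, ENNReal.ofReal (b i)⁻¹) * ‖P l (stdBasis d j)‖ₑ ^ 2 =
      (∏ i, ENNReal.ofReal (a i)) * (∏ i, ENNReal.ofReal (q i)) *
        ‖planOp hβ φ l (P l (stdBasis d j))‖ₑ ^ 2 :=
    ae_all_iff.2 fun j => (ae_plancherelMeasure_iff hβ).1
      (ae_enorm_projection_sq_eq hβ ha hq hb hP hPm hframe _)
  filter_upwards [h1, (ae_plancherelMeasure_iff hβ).1 (mem_fieldSpace.1 hφ),
    ae_hsNormSq_planOp_le hβ ha hq hb hφ hframe] with l h2 h3 h4 hl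
  have h5 : (∏ i, ENNReal.ofReal (b i)⁻¹) * hsNormSq (P l) =
      (∏ i, ENNReal.ofReal (a i)) * (∏ i, ENNReal.ofReal (q i)) * hsNormSq (planOp hβ φ l) := by
    rw [← h3, hsNormSq_eq, hsNormSq_eq, ← ENNReal.tsum_mul_left, ← ENNReal.tsum_mul_left]
    exact tsum_congr h2
  have h6 : (∏ i, ENNReal.ofReal (b i)) * ∏ i, ENNReal.ofReal (b i)⁻¹ = 1 := by
    rw [← Finset.prod_mul_distrib]
    refine Finset.prod_eq_one fun i _ => ?_
    rw [← ENNReal.ofReal_mul (hb i).le, mul_inv_cancel₀ (hb i).ne', ENNReal.ofReal_one]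
  have h7 : ENNReal.ofReal (∏ i, b i * q i) =
      (∏ i, ENNReal.ofReal (b i)) * ∏ i, ENNReal.ofReal (q i) := by
    rw [Finset.prod_mul_distrib, ENNReal.ofReal_mul (Finset.prod_nonneg fun i _ => (hb i).le),
      ENNReal.ofReal_prod_of_nonneg fun i _ => (hb i).le,
      ENNReal.ofReal_prod_of_nonneg fun i _ => (hq i).le]
  set D := ENNReal.ofReal |(matB β l).det|
  set A := ∏ i, ENNReal.ofReal (a i)
  set B := ∏ i, ENNReal.ofReal (b i)
  set Q := ∏ i, ENNReal.ofReal (q i)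
  calc D * hsNormSq (P l) = B * D * ((∏ i, ENNReal.ofReal (b i)⁻¹) * hsNormSq (P l)) := by
        rw [← one_mul (D * hsNormSq (P l)), ← h6]
        ring
    _ = B * Q * (A * (D * hsNormSq (planOp hβ φ l))) := by
        rw [h5]
        ring
    _ ≤ B * Q * 1 := by
        gcongr
        exact h4 hl
    _ = _ := by rw [mul_one, h7]

/-- Boxes are half-open so that they tile; the closed box adds only points with some coordinate
zero, a null set. -/
theorem ae_mem_box_of_mem_Icc (a : Fin r → ℝ) :
    ∀ᵐ l : Fin r → ℝ, (∀ k, 0 ≤ l k ∧ l k ≤ a k) → l ∈ box 0 a := by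
  filter_upwards [ae_all_iff.2 fun k =>
    Measure.ae_eval_ne (μ := fun _ : Fin r => (volume : Measure ℝ)) k 0] with l hl h k
  refine ⟨lt_of_le_of_ne (h k).1 (hl k).symm, ?_⟩
  rw [Pi.zero_apply, zero_add]
  exact (h k).2

end Multiplicity

end NilpotentFrames

end

/-! ### Conclusion -/

open NilpotentFrames MeasureTheory in
theorem mainTheorem5 {r d : ℕ} (hd : 0 < d) {𝔫 : Type*} [LieRing 𝔫] [LieAlgebra ℝ 𝔫]
    (β : Module.Basis (Fin r ⊕ Fin d ⊕ Fin d) ℝ 𝔫) (hβ : IsAdmissibleBasis β)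
    (a : Fin r → ℝ) (q b : Fin d → ℝ)
    (ha : ∀ k, 0 < a k) (hq : ∀ i, 0 < q i) (hb : ∀ i, 0 < b i)
    (I : Set (Fin r → ℝ)) (hI : I ⊆ {l ∈ crossSection β | ∀ k, 0 ≤ l k ∧ l k ≤ a k})
    (K : Submodule ℂ (L2N β)) (hK_closed : IsClosed (K : Set (L2N β)))
    (hK_inv : ∀ g : NilGroup β, ∀ f ∈ K, leftRegular g f ∈ K)
    (φ : L2N β) (hφ : φ ∈ K)
    (hframe : IsParsevalFrame K
      (fun γ : quasiLattice β a q b => leftRegular (γ : NilGroup β) φ)) :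
    (∃ P, IsProjectionField K P) ∧
      ∀ P, IsProjectionField K P →
        ∀ᵐ l : Fin r → ℝ, l ∈ I →
          ENNReal.ofReal |(matB β l).det| * (multiplicity P l : ENNReal) ≤
            ENNReal.ofReal (∏ i, b i * q i) := by
  refine ⟨⟨_, exists_isProjectionField hβ hK_closed hK_inv hφ hframe⟩, fun P hP => ?_⟩
  obtain ⟨hP1, hP2, rfl⟩ := (isProjectionField_iff hβ).1 hP
  filter_upwards [ae_mul_hsNormSq_projection_le hβ ha hq hb hP1 hP2 hφ hframe,
    ae_mem_box_of_mem_Icc a] with l h1 h2 hl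
  exact (mul_le_mul_right (toENat_rank_le_hsNormSq (hP1 l)) _).trans (h1 (h2 (hI hl).2))
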